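/- Setting. A hypergraph $\mathcal H=(\mathcal V,\mathcal E)$ consists of a finite set $\mathcal V$ of attributes and a set $\mathcal E$ of subsets of $\mathcal V$ (hyperedges). Every attribute $A$ has a domain $\mathcal D^A$ with at least two elements. $(K,\otimes,0,1)$ is a commutative monoid with an absorbing element $0$; an operator is an operation $\oplus$ on $K$ that makes $(K,\oplus,\otimes)$ a commutative semiring with additive identity $0$. An aggregation ordering $\alpha=(a_1,\oplus_1),\dots,(a_s,\oplus_s)$ is a sequence of pairs of an attribute of $\mathcal V$ and an operator, with distinct attributes. $V(\alpha)$ is the set of attributes in $\alpha$, $V(-\alpha)=\mathcal V\setminus V(\alpha)$ is the set of output attributes, and $\alpha_F$ is $\alpha$ restricted to the attributes in $F$. An instance $I$ assigns to each $F\in\mathcal E$ a $K$-annotated relation $R_F$, i.e. a finitely supported map $\prod_{A\in F}\mathcal D^A\to K$, and the AJAR query is $Q_{\mathcal H,\alpha}(I)=\Sigma_{(a_1,\oplus_1)}\cdots\Sigma_{(a_s,\oplus_s)}\Join_{F\in\mathcal E}R_F$, where the join multiplies annotations by $\otimes$ and $\Sigma_{(A,\oplus)}$ aggregates the attribute $A$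 away by $\oplus$. Write $\alpha\equiv_{\mathcal H}\beta$ if $\beta$ is a rearrangement of $\alpha$ and $Q_{\mathcal H,\alpha}(I)=Q_{\mathcal H,\beta}(I)$ for all instances $I$. Write $A<_{\mathcal H,\alpha}B$ if $A$ is an output attribute and $B$ is not, or $A$ precedes $B$ in every $\beta\equiv_{\mathcal H}\alpha$. GHDs. A GHD of $\mathcal H$ is a finite nonempty rooted tree $\mathcal T$ with bags $\chi(t)\subseteq\mathcal V$ such that every hyperedge is contained in some bag and, for each attribute $A$, the nodes $t$ with $A\in\chi(t)$ form a connected subtree, whose topmost node is called $TOP(A)$. A GHD of $\mathcal H$ is valid for $Q_{\mathcal H,\alpha}$ if there is $\beta\equiv_{\mathcal H}\alpha$ such that, for all attributes $A,B$, whenever $TOP(A)$ is a proper ancestor of $TOP(B)$, either $A$ is an output attribute or $A$ precedes $B$ in $\beta$. A function $\gamma:2^{\mathcal V}\to\mathbb R$ is node-monotone if $\gamma(A)\le\gamma(B)$ for $A\subseteq B\subseteq\mathcal V$; the $\gamma$-width of a GHD is $\max_t\gamma(\chi(t))$. A (valid) GHD is optimal if it has the least $\gamma$-width among all (valid) GHDs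 of the same hypergraph (query). Decomposition. Let $\mathcal C$ be the set of connected components of $\mathcal H\setminus V(-\alpha)$. For $C\in\mathcal C$ let $\mathcal E_C=\{E\in\mathcal E: E\cap C\ne\emptyset\}$, $C^+=\bigcup_{E\in\mathcal E_C}E$, and $C^O=\{x\in C: y\not<_{\mathcal H,\alpha}x\text{ for all }y\in C\}$. A GHD $(\mathcal T,\chi)$ of $\mathcal H$ is decomposable for $Q_{\mathcal H,\alpha}$ if (recursively) there is a subtree $\mathcal T_0$ of $\mathcal T$ containing the root with $\bigcup_{t\in\mathcal T_0}\chi(t)=V(-\alpha)$ such that for each $C\in\mathcal C$ exactly one of the subtrees of $\mathcal T\setminus\mathcal T_0$ (each rooted at its node adjacent to $\mathcal T_0$) is a decomposable GHD for $Q_{(C^+,\mathcal E_C),\,\alpha_{C\setminus C^O}}$. The set $H(\mathcal H,\alpha)$ of characteristic hypergraphs is defined recursively by $$H(\mathcal H,\alpha)=\{\mathcal H_0\}\cup\bigcup_{C\in\mathcal C}H(\mathcal H_C^+,\alpha_{C\setminus C^O}),$$ $$\mathcal H_0=\bigl(V(-\alpha),\{F\in\mathcal E:F\subseteq V(-\alpha)\}\cup\{V(-\alpha)\cap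 C^+:C\in\mathcal C\}\bigr),\qquad \mathcal H_C^+=\bigl(C^+,\mathcal E_C\cup\{V(-\alpha)\cap C^+\}\bigr).$$ A GHD $G$ is assembled from GHDs $G_0,\dots,G_k$ if the nodes of $G$ are partitioned into the node sets of $G_0,\dots,G_k$, with the same bags, so that each $G_i$, as an unrooted tree, is the subgraph of $G$ induced on its nodes (thus $G$ arises from $G_0,\dots,G_k$ by adding connecting edges and choosing a root). Theorem. Let $\mathcal H$ be a hypergraph each of whose attributes lies in some hyperedge, $\alpha$ an aggregation ordering, and $\mathcal H_0,\dots,\mathcal H_k$ the characteristic hypergraphs of $Q_{\mathcal H,\alpha}$. 1. For arbitrary GHDs $G_0,\dots,G_k$ of $\mathcal H_0,\dots,\mathcal H_k$ there is a decomposable GHD $G$ for $Q_{\mathcal H,\alpha}$ that is assembled from $G_0,\dots,G_k$, and $\gamma\text{-width}(G)=\max_i\gamma\text{-width}(G_i)$ for every node-monotone $\gamma$. 2. Conversely, for every decomposable GHD $G$ for $Q_{\mathcal H,\alpha}$ there are GHDs $G_0,\dots,G_k$ of $\mathcal H_0,\dots,\mathcal H_k$ from which $G$ is assembled, and $\gamma\text{-width}(G)=\max_i\gamma\text{-width}(G_i)$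 for every node-monotone $\gamma$. 3. Let $\gamma$ be node-monotone. If each $G_i$ is an optimal GHD of $\mathcal H_i$, then some decomposable GHD assembled from $G_0,\dots,G_k$ is an optimal valid GHD for $Q_{\mathcal H,\alpha}$. Moreover the least $\gamma$-widths of GHDs of the $\mathcal H_i$ and of valid GHDs for $Q_{\mathcal H,\alpha}$ exist, and the latter equals the maximum over $i$ of the former. -/

import Mathlib

namespace Ajar

universe u v w

/-! ### Hypergraphs -/

/-- A finite hypergraph: a finite set of attributes and a set of hyperedges, all of them subsets of
the set of attributes. -/
@[ext] structure Hypergraph (V : Type u) where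
  verts : Finset V
  edges : Finset (Finset V)
  edges_subset : ∀ F ∈ edges, F ⊆ verts

/-! ### Operators, aggregation orderings, instances and queries -/

/-- An aggregation operator `⊕` on `K`: an operation such that `(K, ⊕, ⊗)` is a commutative semiring
whose additive identity is the common element `0`; here `⊗`, `0`, `1` are those of `K`. -/
@[ext] structure AggOp (K : Type v) [CommMonoidWithZero K] where
  op : K → K → K
  op_assoc : ∀ a b c, op (op a b) c = op a (op b c)
  op_comm : ∀ a b, op a b = op b a
  op_zero : ∀ a, op a 0 = a
  mul_op : ∀ a b c, a * op b c = op (a * b) (a * c)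

/-- The commutative monoid `(K, ⊕, 0)`. -/
@[reducible] def AggOp.toAddCommMonoid {K : Type v} [CommMonoidWithZero K] (o : AggOp K) :
    AddCommMonoid K where
  add := o.op
  zero := 0
  add_assoc := o.op_assoc
  zero_add := fun a => (o.op_comm 0 a).trans (o.op_zero a)
  add_zero := o.op_zero
  add_comm := o.op_comm
  nsmul := @nsmulRec K ⟨0⟩ ⟨o.op⟩

/-- The `⊕`-aggregate of a finitely supported family of annotations. -/
noncomputable def AggOp.sum {K : Type v} [CommMonoidWithZero K] (o : AggOp K) {X : Type w}
    (f : X → K) : K :=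
  letI := o.toAddCommMonoid
  ∑ᶠ x, f x

section

variable {V : Type u} [DecidableEq V] {K : Type v} [CommMonoidWithZero K]

/-- `V(α)`: the attributes that occur in an aggregation ordering `α`, which is a list of
attribute-operator pairs. -/
def attrs (α : List (V × AggOp K)) : Finset V := (α.map Prod.fst).toFinset

/-- `α_F`: the ordering `α` restricted to the attributes in `F`. -/
def restrictTo (α : List (V × AggOp K)) (F : Finset V) : List (V × AggOp K) :=
  α.filter (fun p => p.1 ∈ F)

/-- `A` and `B` occur in the ordering `β`, and `A` occurs before `B`. -/
def Precedes (β : List (V × AggOp K)) (A B : V) : Prop :=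
  B ∈ β.map Prod.fst ∧ (β.map Prod.fst).idxOf A < (β.map Prod.fst).idxOf B

/-- `V(-α)`: the output attributes. -/
def outputs (H : Hypergraph V) (α : List (V × AggOp K)) : Finset V := H.verts \ attrs α

/-- `α` is an aggregation ordering for `H`: its attributes belong to `H`, each occurring at most
once. -/
def IsOrdering (H : Hypergraph V) (α : List (V × AggOp K)) : Prop :=
  (α.map Prod.fst).Nodup ∧ attrs α ⊆ H.verts

variable (D : V → Type w)

variable (K) in
/-- A database instance: for every hyperedge `F` a `K`-annotated relation over `F`, that is a
finitely supported map from the tuples over `F` to annotations (an absent tuple is the same as a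
tuple with annotation `0`). -/
abbrev Instance : Type (max u v w) := ∀ F : Finset V, ((∀ A : F, D A) →₀ K)

variable {D}

/-- The annotated join of the relations of an instance: the annotation of a tuple is the product of
the annotations of its projections. -/
def join (H : Hypergraph V) (I : Instance K D) (t : ∀ A, D A) : K :=
  ∏ F ∈ H.edges, I F (fun A => t A)

/-- The aggregation `Σ_(A,⊕)`. The result does not depend on the coordinate `A` any more. -/
noncomputable def aggregate (p : V × AggOp K) (f : (∀ A, D A) → K) (t : ∀ A, D A) : K :=
  p.2.sum (fun a : D p.1 => f (Function.update t p.1 a))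

/-- The query `Q_{H,α}(I) = Σ_{α_1} ⋯ Σ_{α_s} ⋈_F R_F`, as a function of a tuple that depends on the
output attributes only. -/
noncomputable def query (H : Hypergraph V) (α : List (V × AggOp K)) (I : Instance K D) :
    (∀ A, D A) → K :=
  α.foldr aggregate (join H I)

variable (D)

/-- `α ≡_H β`: the two orderings have the same attribute-operator pairs, and the two queries have
the same answer on all instances. -/
def Equivalent (H : Hypergraph V) (α β : List (V × AggOp K)) : Prop :=
  β.Perm α ∧ ∀ I : Instance K D, query H α I = query H β I

/-- `PREC(A, B)`: `A` precedes `B` in all orderings that are equivalent to `α`. -/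
def Prec (H : Hypergraph V) (α : List (V × AggOp K)) (A B : V) : Prop :=
  ∀ β, Equivalent D H α β → Precedes β A B

/-- The partial order `A <_{H,α} B`. -/
def Lt (H : Hypergraph V) (α : List (V × AggOp K)) (A B : V) : Prop :=
  (A ∈ outputs H α ∧ B ∈ attrs α) ∨ Prec D H α A B

/-! ### Connected components and the smaller queries -/

/-- Two attributes of `H ∖ V(-α)` that occur together in a hyperedge. -/
def Linked (H : Hypergraph V) (α : List (V × AggOp K)) (A B : V) : Prop :=
  A ∈ attrs α ∧ B ∈ attrs α ∧ ∃ F ∈ H.edges, A ∈ F ∧ B ∈ F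

open Classical in
/-- The connected components of `H ∖ V(-α)`. -/
noncomputable def components (H : Hypergraph V) (α : List (V × AggOp K)) : Finset (Finset V) :=
  (attrs α).image fun A => (attrs α).filter fun B => Relation.ReflTransGen (Linked H α) A B

/-- `E_C`: the hyperedges that meet `C`. -/
def edgesMeeting (H : Hypergraph V) (C : Finset V) : Finset (Finset V) :=
  H.edges.filter fun F => (F ∩ C).Nonempty

/-- `C⁺ = ⋃_{E ∈ E_C} E`. -/
def plus (H : Hypergraph V) (C : Finset V) : Finset V := (edgesMeeting H C).biUnion id

open Classical in
/-- `C^O`: the elements of `C` that have no predecessor in `C` in the order `<_{H,α}`. -/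
noncomputable def initial (H : Hypergraph V) (α : List (V × AggOp K)) (C : Finset V) : Finset V :=
  C.filter fun x => ∀ y ∈ C, ¬ Lt D H α y x

/-- The ordering `α_{C ∖ C^O}`. -/
noncomputable def subOrdering (H : Hypergraph V) (α : List (V × AggOp K)) (C : Finset V) :
    List (V × AggOp K) :=
  restrictTo α (C \ initial D H α C)

/-- The hypergraph `(⋃_{E ∈ E_C} E, E_C)`. -/
def subHypergraph (H : Hypergraph V) (C : Finset V) : Hypergraph V where
  verts := plus H C
  edges := edgesMeeting H C
  edges_subset := fun _ hF => Finset.subset_biUnion_of_mem id hF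

/-- The hypergraph `H_C⁺ = (C⁺, E_C ∪ {V(-α) ∩ C⁺})`. -/
def subHypergraphPlus (H : Hypergraph V) (α : List (V × AggOp K)) (C : Finset V) :
    Hypergraph V where
  verts := plus H C
  edges := insert (outputs H α ∩ plus H C) (edgesMeeting H C)
  edges_subset := by
    intro F hF
    rcases Finset.mem_insert.1 hF with rfl | hF
    · exact Finset.inter_subset_right
    · exact Finset.subset_biUnion_of_mem id hF

/-- The hypergraph
`H_0 = (V(-α), {F ∈ E | F ⊆ V(-α)} ∪ {V(-α) ∩ C⁺ | C a connected component of H ∖ V(-α)})`. -/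
noncomputable def topHypergraph (H : Hypergraph V) (α : List (V × AggOp K)) : Hypergraph V where
  verts := outputs H α
  edges := (H.edges.filter fun F => F ⊆ outputs H α) ∪
    (components H α).image fun C => outputs H α ∩ plus H C
  edges_subset := by
    intro F hF
    rcases Finset.mem_union.1 hF with hF | hF
    · exact (Finset.mem_filter.1 hF).2
    · obtain ⟨C, -, rfl⟩ := Finset.mem_image.1 hF
      exact Finset.inter_subset_left

/-- The characteristic hypergraphs `H(H, α) = {H_0} ∪ ⋃_C H(H_C⁺, α_{C ∖ C^O})`, where `C` runs
through the connected components of `H ∖ V(-α)`. -/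
inductive IsCharacteristic : Hypergraph V → List (V × AggOp K) → Hypergraph V → Prop
  | top (H : Hypergraph V) (α : List (V × AggOp K)) : IsCharacteristic H α (topHypergraph H α)
  | sub (H : Hypergraph V) (α : List (V × AggOp K)) (C : Finset V) (H' : Hypergraph V) :
      C ∈ components H α →
      IsCharacteristic (subHypergraphPlus H α C) (subOrdering D H α C) H' →
      IsCharacteristic H α H'

/-- The set of characteristic hypergraphs. -/
def characteristicHypergraphs (H : Hypergraph V) (α : List (V × AggOp K)) : Set (Hypergraph V) :=
  {H' | IsCharacteristic D H α H'}

/-- The orderings of the smaller queries are shorter: the earliest element of `C` belongs to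
`C^O`. -/
theorem length_subOrdering_lt (H : Hypergraph V) (α : List (V × AggOp K)) (C : Finset V)
    (hC : C ∈ components H α) : (subOrdering D H α C).length < α.length := by
  classical
  obtain ⟨A, hA, rfl⟩ := Finset.mem_image.1 hC
  set C := (attrs α).filter fun B => Relation.ReflTransGen (Linked H α) A B with hCdef
  have hne : C.Nonempty := ⟨A, Finset.mem_filter.2 ⟨hA, Relation.ReflTransGen.refl⟩⟩
  obtain ⟨x, hx, hmin⟩ := Finset.exists_min_image C (fun B => (α.map Prod.fst).idxOf B) hne
  have hxα : x ∈ α.map Prod.fst := List.mem_toFinset.1 (Finset.mem_filter.1 hx).1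
  have hini : x ∈ initial D H α C := by
    refine Finset.mem_filter.2 ⟨hx, fun y hy hlt => ?_⟩
    rcases hlt with ⟨hy', -⟩ | hprec
    · exact (Finset.mem_sdiff.1 hy').2 (Finset.mem_filter.1 hy).1
    · exact absurd (hprec α ⟨List.Perm.refl _, fun _ => rfl⟩).2 (not_lt.2 (hmin y hy))
  obtain ⟨p, hp, rfl⟩ := List.mem_map.1 hxα
  refine lt_of_le_of_ne (List.length_filter_le _ _) fun h => ?_
  have h2 := List.length_filter_eq_length_iff.1 h p hp
  simp only [decide_eq_true_eq, Finset.mem_sdiff] at h2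
  exact h2.2 hini

end

/-! ### Generalized hypertree decompositions -/

/-- A graph with a bag of attributes on each node and a chosen root. -/
structure BagGraph (V : Type u) where
  Node : Type u
  graph : SimpleGraph Node
  bag : Node → Finset V
  root : Node

section

variable {V : Type u}

/-- `G` is a (rooted) generalized hypertree decomposition of `H`. -/
structure IsGHD (H : Hypergraph V) (G : BagGraph V) : Prop where
  finite : Finite G.Node
  isTree : G.graph.IsTree
  bag_subset : ∀ t, G.bag t ⊆ H.verts
  covers : ∀ F ∈ H.edges, ∃ t, F ⊆ G.bag t
  running_intersection : ∀ A ∈ H.verts, (G.graph.induce {t | A ∈ G.bag t}).Preconnected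

/-- `s` is an ancestor of `t`, or equal to `t`: it lies on the way from the root to `t`. -/
def BagGraph.AncestorOrEq (G : BagGraph V) (s t : G.Node) : Prop :=
  ∀ p : G.graph.Walk G.root t, s ∈ p.support

/-- `s` is a proper ancestor of `t`. -/
def BagGraph.Ancestor (G : BagGraph V) (s t : G.Node) : Prop :=
  s ≠ t ∧ G.AncestorOrEq s t

/-- `t = TOP(A)`: the topmost node whose bag contains `A`. -/
def BagGraph.IsTop (G : BagGraph V) (A : V) (t : G.Node) : Prop :=
  A ∈ G.bag t ∧ ∀ s, A ∈ G.bag s → G.AncestorOrEq t s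

/-- The restriction of `G` to a set `S` of nodes, with a root chosen in `S`. -/
def BagGraph.restrict (G : BagGraph V) (S : Set G.Node) (r : S) : BagGraph V where
  Node := S
  graph := G.graph.induce S
  bag := fun t => G.bag t
  root := r

/-- `T₀` is the node set of a rooted subtree: a connected subgraph that contains the root. -/
def BagGraph.IsRootedSubtree (G : BagGraph V) (T₀ : Set G.Node) : Prop :=
  G.root ∈ T₀ ∧ (G.graph.induce T₀).Connected

/-- `S` is the node set of one of the subtrees into which `T ∖ T₀` falls. -/
def BagGraph.IsBranch (G : BagGraph V) (T₀ S : Set G.Node) : Prop :=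
  ∃ c : (G.graph.induce T₀ᶜ).ConnectedComponent, S = Subtype.val '' c.supp

/-- The `γ`-width of a decomposition: the maximum of `γ` over its (finitely many) bags. -/
noncomputable def BagGraph.width (γ : Finset V → ℝ) (G : BagGraph V) : ℝ := ⨆ t, γ (G.bag t)

/-- Node-monotone functions on the subsets of the vertex set of `H`. -/
def NodeMonotone (H : Hypergraph V) (γ : Finset V → ℝ) : Prop :=
  ∀ A B : Finset V, A ⊆ B → B ⊆ H.verts → γ A ≤ γ B

/-- `G` consists of the pairwise disjoint pieces `P i`, connected by additional edges: the nodes of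
`G` are partitioned into the nodes of the `P i`, the bags are the same, and the subgraph of `G`
induced on the nodes of `P i` is the graph of `P i`. The roots of the pieces play no role. -/
def IsAssembledFrom {ι : Type u} (P : ι → BagGraph V) (G : BagGraph V) : Prop :=
  ∃ e : (Σ i, (P i).Node) ≃ G.Node,
    (∀ i t, G.bag (e ⟨i, t⟩) = (P i).bag t) ∧
    ∀ i s t, G.graph.Adj (e ⟨i, s⟩) (e ⟨i, t⟩) ↔ (P i).graph.Adj s t

/-- `G` is a GHD of `H` of least `γ`-width. -/
def IsOptimalGHD (γ : Finset V → ℝ) (H : Hypergraph V) (G : BagGraph V) : Prop :=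
  IsGHD H G ∧ ∀ G' : BagGraph V, IsGHD H G' → G.width γ ≤ G'.width γ

variable [DecidableEq V] {K : Type v} [CommMonoidWithZero K]

/-- `G` is compatible with the ordering `β`: if `TOP(A)` is an ancestor of `TOP(B)`, then `A` is an
output attribute or `A` occurs before `B` in `β`. -/
def Compatible (H : Hypergraph V) (β : List (V × AggOp K)) (G : BagGraph V) : Prop :=
  ∀ A ∈ H.verts, ∀ B ∈ H.verts, ∀ s t, G.IsTop A s → G.IsTop B t → G.Ancestor s t →
    A ∈ outputs H β ∨ Precedes β A B

variable (D : V → Type w)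

/-- `G` is a valid GHD of `Q_{H,α}`: a GHD of `H` that is compatible with at least one ordering
equivalent to `α`. -/
def IsValid (H : Hypergraph V) (α : List (V × AggOp K)) (G : BagGraph V) : Prop :=
  IsGHD H G ∧ ∃ β, Equivalent D H α β ∧ Compatible H β G

/-- `G` is a valid GHD of `Q_{H,α}` of least `γ`-width among the valid GHDs. -/
def IsOptimalValid (γ : Finset V → ℝ) (H : Hypergraph V) (α : List (V × AggOp K))
    (G : BagGraph V) : Prop :=
  IsValid D H α G ∧ ∀ G' : BagGraph V, IsValid D H α G' → G.width γ ≤ G'.width γ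

/-- `G` is a decomposable GHD of `Q_{H,α}`: there is a rooted subtree `T₀` whose bags have union
`V(-α)`, and for each connected component `C` of `H ∖ V(-α)` exactly one of the subtrees of
`T ∖ T₀` is a decomposable GHD of the query of `(⋃_{E ∈ E_C} E, E_C)` and `α_{C ∖ C^O}`. The root of
a subtree of `T ∖ T₀` is its node that is adjacent to `T₀`. -/
def IsDecomposable (H : Hypergraph V) (α : List (V × AggOp K)) (G : BagGraph V) : Prop :=
  IsGHD H G ∧
  ∃ T₀ : Set G.Node, G.IsRootedSubtree T₀ ∧
    (∀ A, (∃ t ∈ T₀, A ∈ G.bag t) ↔ A ∈ outputs H α) ∧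
    ∀ C, (hC : C ∈ components H α) →
      ∃! S : Set G.Node, G.IsBranch T₀ S ∧
        ∃ r : S, (∃ t ∈ T₀, G.graph.Adj t r) ∧
          IsDecomposable (subHypergraph H C) (subOrdering D H α C) (G.restrict S r)
termination_by α.length
decreasing_by exact length_subOrdering_lt D H α C hC

end

end Ajar

/-! Equivalence of orderings is first made combinatorial: two rearrangements are equivalent iff
every connected set `S` of aggregated attributes has the same first operator in both
(`equivalent_of_sameFirst`, `Equivalent.sameFirst`). Sufficiency: neighbouring aggregations commute
if their operators agree (Fubini), or if their attributes lie in different components of what is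
still to be aggregated, since then the join factors and `⊗` distributes. Necessity: let the
relations hold just two tuples that differ exactly on `S`, annotated `x` and `y`; they merge into `x
⊕ y` at the moment when the first attribute of `S`, which is aggregated last, is summed out.

Consequently `x ∈ C` lies in `C^O` iff its operator is the first operator of every connected set of
aggregated attributes around it (`mem_initial_iff`). So all of `C^O` shares one operator, every
component `C'` of `C ∖ C^O` starts with another one, and an element of `C^O` adjacent to `C'`
precedes all of `C'` in every equivalent ordering (`precedes_of_mem_initial`).

Decomposable GHDs are valid: sort `α` by depth in the tree. An attribute at the top of a connected
set has the first operator of that set (`IsDecomposable.firstOp_eq_of_top`), so the sorted ordering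
is equivalent to `α`.

Valid GHDs are no narrower than the best GHDs of the characteristic hypergraphs: by validity no
attribute of a component `C` has its top strictly above that of an adjacent output, so the topmost
node meeting `C` contains the whole interface `V(-α) ∩ C⁺` (`Admissible.exists_outputs_subset`).
Recursively the same tree covers every hyperedge of every characteristic hypergraph, and cutting its
bags down gives GHDs of these (`IsValid.isGHD_trim`).

Finally, the interface is a hyperedge both of `H_0` and of the top hypergraph of the query of
`H_C⁺`. GHDs of these can therefore be linked at nodes containing it
(`exists_decomposable_assembly`); conversely, a decomposable GHD is cut at its linking edges
(`IsDecomposable.exists_labelling`). The width of an assembled GHD is the maximum over its pieces,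
which meets the lower bound for valid GHDs when the pieces are optimal. -/

namespace Ajar

universe u v w

set_option linter.unusedSectionVars false

open Relation

/-! ### Connected sets of a relation -/

section ConnOn

variable {X : Type*}

/-- The relation `r` restricted to the set `S`. -/
def RelOn (r : X → X → Prop) (S : Set X) (a b : X) : Prop := a ∈ S ∧ b ∈ S ∧ r a b

/-- `S` is connected with respect to the relation `r`. -/
def ConnOn (r : X → X → Prop) (S : Set X) : Prop :=
  ∀ a ∈ S, ∀ b ∈ S, ReflTransGen (RelOn r S) a b

theorem RelOn.symm {r : X → X → Prop} (hr : ∀ a b, r a b → r b a) {S : Set X} {a b : X}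
    (h : RelOn r S a b) : RelOn r S b a := ⟨h.2.1, h.1, hr _ _ h.2.2⟩

theorem RelOn.mono {r : X → X → Prop} {S T : Set X} (hST : S ⊆ T) {a b : X}
    (h : RelOn r S a b) : RelOn r T a b := ⟨hST h.1, hST h.2.1, h.2.2⟩

theorem reflTransGen_relOn_symm {r : X → X → Prop} (hr : ∀ a b, r a b → r b a) {S : Set X}
    {a b : X} (h : ReflTransGen (RelOn r S) a b) : ReflTransGen (RelOn r S) b a := by
  induction h with
  | refl => exact .refl
  | tail _ h ih => exact ReflTransGen.head (h.symm hr) ih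

theorem reflTransGen_relOn_mono {r : X → X → Prop} {S T : Set X} (hST : S ⊆ T) {a b : X}
    (h : ReflTransGen (RelOn r S) a b) : ReflTransGen (RelOn r T) a b :=
  ReflTransGen.mono (fun _ _ h => h.mono hST) _ _ h

theorem reflTransGen_relOn_mem {r : X → X → Prop} {S : Set X} {a b : X} (ha : a ∈ S)
    (h : ReflTransGen (RelOn r S) a b) : b ∈ S := by
  induction h with
  | refl => exact ha
  | tail _ h _ => exact h.2.1

theorem ConnOn.singleton (r : X → X → Prop) (a : X) : ConnOn r {a} := by
  rintro _ rfl _ rfl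
  exact .refl

theorem ConnOn.mono_rel {r r' : X → X → Prop} {S : Set X} (h : ConnOn r S)
    (hr : ∀ a ∈ S, ∀ b ∈ S, r a b → r' a b) : ConnOn r' S := fun a ha b hb =>
  ReflTransGen.mono (fun _ _ h => ⟨h.1, h.2.1, hr _ h.1 _ h.2.1 h.2.2⟩) _ _ (h a ha b hb)

theorem ConnOn.union {r : X → X → Prop} (hr : ∀ a b, r a b → r b a) {S T : Set X}
    (hS : ConnOn r S) (hT : ConnOn r T) {s t : X} (hs : s ∈ S) (ht : t ∈ T) (h : s = t ∨ r s t) :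
    ConnOn r (S ∪ T) := by
  have key : ∀ a ∈ S ∪ T, ReflTransGen (RelOn r (S ∪ T)) a s := by
    rintro a (ha | ha)
    · exact reflTransGen_relOn_mono Set.subset_union_left (hS a ha s hs)
    · have h1 := reflTransGen_relOn_mono (T := S ∪ T) Set.subset_union_right (hT a ha t ht)
      rcases h with rfl | h
      · exact h1
      · exact h1.tail ⟨.inr ht, .inl hs, hr _ _ h⟩
  exact fun a ha b hb => (key a ha).trans (reflTransGen_relOn_symm hr (key b hb))

/-- A connected set that meets both a set and its complement is crossed by a related pair. -/
theorem ConnOn.exists_crossing {r : X → X → Prop} {S Y : Set X} (hS : ConnOn r S) {a b : X}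
    (ha : a ∈ S) (haY : a ∈ Y) (hb : b ∈ S) (hbY : b ∉ Y) :
    ∃ c ∈ S, ∃ d ∈ S, c ∈ Y ∧ d ∉ Y ∧ r c d := by
  by_contra! hno
  have : ∀ x, ReflTransGen (RelOn r S) a x → x ∈ Y := by
    intro x hx
    induction hx with
    | refl => exact haY
    | tail _ h ih =>
      by_contra hd
      exact hno _ h.1 _ h.2.1 ih hd h.2.2
  exact hbY (this b (hS a ha b hb))

theorem connOn_reachable {r : X → X → Prop} (hr : ∀ a b, r a b → r b a) {S : Set X} {a : X} :
    ConnOn r {b | ReflTransGen (RelOn r S) a b} := by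
  have key : ∀ b, ReflTransGen (RelOn r S) a b →
      ReflTransGen (RelOn r {b | ReflTransGen (RelOn r S) a b}) a b := by
    intro b hb
    induction hb with
    | refl => exact .refl
    | tail h h' ih => exact ih.tail ⟨h, h.tail h', h'.2.2⟩
  exact fun b hb c hc => (reflTransGen_relOn_symm hr (key b hb)).trans (key c hc)

end ConnOn

/-! ### Connected sets of attributes -/

section Conn

variable {V : Type u} {K : Type v} [CommMonoidWithZero K]

/-- Two attributes that occur together in a hyperedge. -/
def Hypergraph.Adj (H : Hypergraph V) (A B : V) : Prop := ∃ F ∈ H.edges, A ∈ F ∧ B ∈ F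

theorem Hypergraph.Adj.symm {H : Hypergraph V} (A B : V) (h : H.Adj A B) : H.Adj B A := by
  obtain ⟨F, hF, hA, hB⟩ := h
  exact ⟨F, hF, hB, hA⟩

/-- The finite set `S` of attributes is connected in `H`. -/
def Conn (H : Hypergraph V) (S : Finset V) : Prop := ConnOn H.Adj (S : Set V)

/-- Every attribute lies in a hyperedge. -/
def Covered (H : Hypergraph V) : Prop := ∀ A ∈ H.verts, ∃ F ∈ H.edges, A ∈ F

open Classical in
/-- The connected component of `x` in `S`. -/
noncomputable def compOf (H : Hypergraph V) (S : Finset V) (x : V) : Finset V :=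
  S.filter fun b => ReflTransGen (RelOn H.Adj (S : Set V)) x b

theorem mem_compOf {H : Hypergraph V} {S : Finset V} {x b : V} (hx : x ∈ S) :
    b ∈ compOf H S x ↔ ReflTransGen (RelOn H.Adj (S : Set V)) x b := by
  classical
  rw [compOf, Finset.mem_filter]
  exact ⟨fun h => h.2, fun h => ⟨reflTransGen_relOn_mem (S := (S : Set V)) hx h, h⟩⟩

theorem compOf_subset (H : Hypergraph V) (S : Finset V) (x : V) : compOf H S x ⊆ S := by
  classical exact Finset.filter_subset _ _

theorem self_mem_compOf {H : Hypergraph V} {S : Finset V} {x : V} (hx : x ∈ S) :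
    x ∈ compOf H S x := (mem_compOf hx).2 .refl

theorem conn_compOf {H : Hypergraph V} {S : Finset V} {x : V} (hx : x ∈ S) :
    Conn H (compOf H S x) := by
  have : (compOf H S x : Set V) = {b | ReflTransGen (RelOn H.Adj (S : Set V)) x b} := by
    ext b; exact mem_compOf hx
  rw [Conn, this]
  exact connOn_reachable Hypergraph.Adj.symm

theorem mem_compOf_of_adj {H : Hypergraph V} {S : Finset V} {x b c : V} (hx : x ∈ S)
    (hb : b ∈ compOf H S x) (hc : c ∈ S) (h : H.Adj b c) : c ∈ compOf H S x :=
  (mem_compOf hx).2 (((mem_compOf hx).1 hb).tail ⟨compOf_subset H S x hb, hc, h⟩)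

theorem Conn.insert [DecidableEq V] {H : Hypergraph V} {S : Finset V} (hS : Conn H S) {x y : V}
    (hy : y ∈ S) (h : H.Adj y x) : Conn H (insert x S) := by
  have := ConnOn.union Hypergraph.Adj.symm hS (ConnOn.singleton H.Adj x) (s := y) (t := x) hy
    rfl (.inr h)
  rwa [Conn, Finset.coe_insert, Set.insert_eq, Set.union_comm]

theorem Conn.mono {H H' : Hypergraph V} {S : Finset V} (h : Conn H S)
    (hr : ∀ a ∈ S, ∀ b ∈ S, H.Adj a b → H'.Adj a b) : Conn H' S := ConnOn.mono_rel h hr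

/-! ### Components -/

variable [DecidableEq V] {H : Hypergraph V} {α β : List (V × AggOp K)} {C C' : Finset V}

theorem mem_attrs {A : V} : A ∈ attrs α ↔ ∃ o, (A, o) ∈ α := by
  simp [attrs]

theorem mem_components : C ∈ components H α ↔ ∃ A ∈ attrs α, C = compOf H (attrs α) A := by
  classical
  unfold components compOf
  rw [Finset.mem_image]
  refine exists_congr fun A => and_congr_right fun _ => ?_
  rw [eq_comm]
  constructor <;> (intro h; rw [h]; ext b; simp only [Finset.mem_filter]; rfl)

theorem components_subset (hC : C ∈ components H α) : C ⊆ attrs α := by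
  obtain ⟨A, -, rfl⟩ := mem_components.1 hC
  exact compOf_subset _ _ _

theorem components_nonempty (hC : C ∈ components H α) : C.Nonempty := by
  obtain ⟨A, hA, rfl⟩ := mem_components.1 hC
  exact ⟨A, self_mem_compOf hA⟩

theorem components_conn (hC : C ∈ components H α) : Conn H C := by
  obtain ⟨A, hA, rfl⟩ := mem_components.1 hC
  exact conn_compOf hA

theorem mem_component_of_adj (hC : C ∈ components H α) {A B : V} (hA : A ∈ C) (hB : B ∈ attrs α)
    (h : H.Adj A B) : B ∈ C := by
  obtain ⟨A', hA', rfl⟩ := mem_components.1 hC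
  exact mem_compOf_of_adj hA' hA hB h

theorem exists_component (H : Hypergraph V) {A : V} (hA : A ∈ attrs α) :
    ∃ C ∈ components H α, A ∈ C :=
  ⟨_, mem_components.2 ⟨A, hA, rfl⟩, self_mem_compOf hA⟩

theorem Conn.subset_component {S : Finset V} (hS : Conn H S) (hSα : S ⊆ attrs α)
    (hC : C ∈ components H α) {x : V} (hxS : x ∈ S) (hxC : x ∈ C) : S ⊆ C := by
  intro y hy
  by_contra hyC
  obtain ⟨c, hc, d, hd, hcC, hdC, h⟩ := ConnOn.exists_crossing hS (Y := (C : Set V)) hxS hxC hy hyC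
  exact hdC (mem_component_of_adj hC hcC (hSα hd) h)

theorem component_unique (hC : C ∈ components H α) (hC' : C' ∈ components H α) {A : V}
    (hA : A ∈ C) (hA' : A ∈ C') : C = C' :=
  Finset.Subset.antisymm
    ((components_conn hC).subset_component (components_subset hC) hC' hA hA')
    ((components_conn hC').subset_component (components_subset hC') hC hA' hA)

theorem mem_edgesMeeting {F : Finset V} :
    F ∈ edgesMeeting H C ↔ F ∈ H.edges ∧ ∃ A ∈ F, A ∈ C := by
  simp [edgesMeeting, Finset.Nonempty]

theorem mem_plus {A : V} : A ∈ plus H C ↔ ∃ B ∈ C, H.Adj B A := by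
  simp only [plus, Finset.mem_biUnion, mem_edgesMeeting, id, Hypergraph.Adj]
  constructor
  · rintro ⟨F, ⟨hF, B, hBF, hBC⟩, hA⟩; exact ⟨B, hBC, F, hF, hBF, hA⟩
  · rintro ⟨B, hBC, F, hF, hBF, hA⟩; exact ⟨F, ⟨hF, B, hBF, hBC⟩, hA⟩

theorem plus_subset : plus H C ⊆ H.verts := by
  intro A hA
  obtain ⟨B, -, F, hF, -, hA⟩ := mem_plus.1 hA
  exact H.edges_subset F hF hA

theorem subset_plus (hH : Covered H) (hC : C ⊆ H.verts) : C ⊆ plus H C := by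
  intro A hA
  obtain ⟨F, hF, hAF⟩ := hH A (hC hA)
  exact mem_plus.2 ⟨A, hA, F, hF, hAF, hAF⟩

theorem mem_outputs {A : V} : A ∈ outputs H α ↔ A ∈ H.verts ∧ A ∉ attrs α := by
  simp [outputs]

theorem mem_component_of_mem_plus (hC : C ∈ components H α) {A : V} (hA : A ∈ plus H C)
    (hAα : A ∈ attrs α) : A ∈ C := by
  obtain ⟨B, hB, h⟩ := mem_plus.1 hA
  exact mem_component_of_adj hC hB hAα h

/-- A hyperedge consists of output attributes, or it meets a component. -/
theorem edge_subset_outputs_or {F : Finset V} (hF : F ∈ H.edges) :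
    F ⊆ outputs H α ∨ ∃ C ∈ components H α, F ∈ edgesMeeting H C := by
  by_cases h : ∃ A ∈ F, A ∈ attrs α
  · obtain ⟨A, hAF, hA⟩ := h
    obtain ⟨C, hC, hAC⟩ := exists_component H hA
    exact .inr ⟨C, hC, mem_edgesMeeting.2 ⟨hF, A, hAF, hAC⟩⟩
  · push Not at h
    exact .inl fun A hA => mem_outputs.2 ⟨H.edges_subset F hF hA, h A hA⟩

/-! ### The first operator of a set of attributes -/

/-- The operator of the first attribute of `S` in `α`. -/
def firstOp (α : List (V × AggOp K)) (S : Finset V) : Option (AggOp K) :=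
  (α.find? fun p => p.1 ∈ S).map Prod.snd

/-- `p` is the first element of `α` whose attribute lies in `S`. -/
def IsFirst (α : List (V × AggOp K)) (S : Finset V) (p : V × AggOp K) : Prop :=
  ∃ l₁ l₂, α = l₁ ++ p :: l₂ ∧ p.1 ∈ S ∧ ∀ q ∈ l₁, q.1 ∉ S

/-- Each connected set of attributes has the same first operator in `α` and in `β`. -/
def SameFirst (H : Hypergraph V) (α β : List (V × AggOp K)) : Prop :=
  ∀ S ⊆ attrs α, Conn H S → firstOp α S = firstOp β S

theorem find?_eq_some_iff_isFirst {S : Finset V} {p : V × AggOp K} :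
    α.find? (fun p => p.1 ∈ S) = some p ↔ IsFirst α S p := by
  rw [List.find?_eq_some_iff_append]
  constructor
  · rintro ⟨h, l₁, l₂, rfl, h2⟩
    exact ⟨l₁, l₂, rfl, by simpa using h, fun q hq => by simpa using h2 q hq⟩
  · rintro ⟨l₁, l₂, rfl, h, h2⟩
    exact ⟨by simpa using h, l₁, l₂, rfl, fun q hq => by simpa using h2 q hq⟩

theorem IsFirst.firstOp {S : Finset V} {p : V × AggOp K} (h : IsFirst α S p) :
    firstOp α S = some p.2 := by
  rw [Ajar.firstOp, find?_eq_some_iff_isFirst.2 h]; rfl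

theorem IsFirst.mem {S : Finset V} {p : V × AggOp K} (h : IsFirst α S p) : p ∈ α := by
  obtain ⟨l₁, l₂, rfl, -, -⟩ := h; simp

theorem IsFirst.fst_mem {S : Finset V} {p : V × AggOp K} (h : IsFirst α S p) : p.1 ∈ S := by
  obtain ⟨l₁, l₂, -, h, -⟩ := h; exact h

theorem exists_isFirst {S : Finset V} {A : V} (hA : A ∈ S) (hα : A ∈ attrs α) :
    ∃ p, IsFirst α S p := by
  obtain ⟨o, ho⟩ := mem_attrs.1 hα
  cases h : α.find? (fun p => p.1 ∈ S) with
  | none => exact absurd hA (by simpa using List.find?_eq_none.1 h _ ho)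
  | some p => exact ⟨p, find?_eq_some_iff_isFirst.1 h⟩

theorem IsFirst.mono {S T : Finset V} {p : V × AggOp K} (hp : IsFirst α S p) (hT : T ⊆ S)
    (hpT : p.1 ∈ T) : IsFirst α T p := by
  obtain ⟨l₁, l₂, rfl, -, h⟩ := hp
  exact ⟨l₁, l₂, rfl, hpT, fun q hq hqT => h q hq (hT hqT)⟩

theorem op_unique (hα : (α.map Prod.fst).Nodup) {p q : V × AggOp K} (hp : p ∈ α) (hq : q ∈ α)
    (h : p.1 = q.1) : p = q := List.inj_on_of_nodup_map hα hp hq h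

theorem isFirst_singleton (hα : (α.map Prod.fst).Nodup) {p : V × AggOp K} (hp : p ∈ α) :
    IsFirst α {p.1} p := by
  obtain ⟨q, hq⟩ := exists_isFirst (α := α) (Finset.mem_singleton_self p.1)
    (mem_attrs.2 ⟨p.2, hp⟩)
  have := op_unique hα hq.mem hp (Finset.mem_singleton.1 hq.fst_mem)
  rwa [this] at hq

theorem IsFirst.precedes {S : Finset V} {p : V × AggOp K} (h : IsFirst α S p) {B : V}
    (hB : B ∈ S) (hBα : B ∈ attrs α) (hne : p.1 ≠ B) : Precedes α p.1 B := by
  obtain ⟨l₁, l₂, rfl, hp, h⟩ := h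
  refine ⟨List.mem_toFinset.1 hBα, ?_⟩
  have h1 : ∀ A ∈ S, A ∉ l₁.map Prod.fst := by
    intro A hA hA'
    obtain ⟨q, hq, rfl⟩ := List.mem_map.1 hA'
    exact h q hq hA
  rw [List.map_append, List.map_cons, List.idxOf_append_of_notMem (h1 _ hp),
    List.idxOf_append_of_notMem (h1 _ hB), List.idxOf_cons_self, List.idxOf_cons_ne _ hne]
  omega

theorem Precedes.asymm {A B : V} (h : Precedes α A B) : ¬ Precedes α B A :=
  fun h' => absurd h.2 (not_lt.2 h'.2.le)

theorem not_precedes_head {p : V × AggOp K} {A : V} : ¬ Precedes (p :: α) A p.1 := by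
  rintro ⟨-, h⟩
  simp at h

theorem attrs_perm (h : β.Perm α) : attrs β = attrs α := by
  ext A; simp [attrs, h.mem_iff]

theorem firstOp_cons {p : V × AggOp K} {S : Finset V} :
    firstOp (p :: α) S = if p.1 ∈ S then some p.2 else firstOp α S := by
  unfold firstOp
  split_ifs with h <;> simp [h]

theorem firstOp_restrictTo {S F : Finset V} (h : S ⊆ F) :
    firstOp (restrictTo α F) S = firstOp α S := by
  unfold restrictTo
  induction α with
  | nil => rfl
  | cons p α ih =>
    rw [List.filter_cons]
    split_ifs with h1
    · rw [firstOp_cons, firstOp_cons, ih]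
    · rw [firstOp_cons, if_neg, ih]
      exact fun h2 => h1 (by simpa using h h2)

theorem firstOp_append_cons {l₁ l₂ : List (V × AggOp K)} {p : V × AggOp K} {S : Finset V}
    (hp : p.1 ∉ S) : firstOp (l₁ ++ p :: l₂) S = firstOp (l₁ ++ l₂) S := by
  simp only [firstOp, List.find?_append, List.find?_cons, hp, decide_false]

theorem attrs_restrictTo {F : Finset V} : attrs (restrictTo α F) = attrs α ∩ F := by
  ext A
  simp [attrs, restrictTo, and_comm]

end Conn

/-! ### Aggregates -/

section AggOp

variable {K : Type v} [CommMonoidWithZero K] (o : AggOp K)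

theorem AggOp.sum_eq {X : Type w} (f : X → K) (T : Finset X) (h : ∀ x, f x ≠ 0 → x ∈ T) :
    o.sum f = letI := o.toAddCommMonoid; ∑ x ∈ T, f x := by
  let _ := o.toAddCommMonoid
  exact finsum_eq_sum_of_support_subset f (fun x hx => h x hx)

theorem AggOp.sum_congr {X : Type w} {f g : X → K} (h : ∀ x, f x = g x) : o.sum f = o.sum g :=
  congrArg o.sum (funext h)

theorem AggOp.sum_eq_zero {X : Type w} {f : X → K} (h : ∀ x, f x = 0) : o.sum f = 0 := by
  rw [o.sum_eq f ∅ fun x hx => absurd (h x) hx]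
  let _ := o.toAddCommMonoid
  exact Finset.sum_empty

theorem AggOp.mul_sum {X : Type w} (k : K) (f : X → K) (T : Finset X)
    (h : ∀ x, f x ≠ 0 → x ∈ T) : o.sum (fun x => k * f x) = k * o.sum f := by
  rw [o.sum_eq f T h, o.sum_eq (fun x => k * f x) T
    fun x hx => h x fun h0 => hx (by rw [h0, mul_zero])]
  let _ := o.toAddCommMonoid
  let m : K →+ K := { toFun := fun a => k * a, map_zero' := mul_zero k, map_add' := o.mul_op k }
  exact (map_sum m f T).symm

theorem AggOp.sum_comm {X Y : Type*} (f : X → Y → K) (T : Finset X) (U : Finset Y)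
    (h : ∀ x y, f x y ≠ 0 → x ∈ T ∧ y ∈ U) :
    o.sum (fun x => o.sum fun y => f x y) = o.sum fun y => o.sum fun x => f x y := by
  have hU : ∀ x, o.sum (fun y => f x y) = letI := o.toAddCommMonoid; ∑ y ∈ U, f x y :=
    fun x => o.sum_eq _ U fun y hy => (h x y hy).2
  have hT : ∀ y, o.sum (fun x => f x y) = letI := o.toAddCommMonoid; ∑ x ∈ T, f x y :=
    fun y => o.sum_eq _ T fun x hx => (h x y hx).1
  rw [o.sum_eq (fun x => o.sum fun y => f x y) T, o.sum_eq (fun y => o.sum fun x => f x y) U]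
  · simp only [hU, hT]
    let _ := o.toAddCommMonoid
    exact Finset.sum_comm
  · intro y hy
    by_contra hyU
    exact hy (o.sum_eq_zero fun x => by_contra fun h0 => hyU (h x y h0).2)
  · intro x hx
    by_contra hxT
    exact hx (o.sum_eq_zero fun y => by_contra fun h0 => hxT (h x y h0).1)

theorem AggOp.sum_pair {X : Type w} (f : X → K) {a b : X} (hab : a ≠ b)
    (h : ∀ x, x ≠ a → x ≠ b → f x = 0) : o.sum f = o.op (f a) (f b) := by
  classical
  rw [o.sum_eq f {a, b} fun x hx => ?_]
  · let _ := o.toAddCommMonoid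
    exact Finset.sum_pair hab
  · by_contra h'
    simp only [Finset.mem_insert, Finset.mem_singleton, not_or] at h'
    exact hx (h x h'.1 h'.2)

theorem AggOp.sum_single {X : Type w} (f : X → K) (a : X) (h : ∀ x, x ≠ a → f x = 0) :
    o.sum f = f a := by
  classical
  rw [o.sum_eq f {a} fun x hx => ?_]
  · let _ := o.toAddCommMonoid
    exact Finset.sum_singleton _ _
  · by_contra h'
    exact hx (h x (by simpa using h'))

end AggOp

/-! ### Rearranging aggregations. -/

section Query

variable {V : Type u} [DecidableEq V] {K : Type v} [CommMonoidWithZero K] {D : V → Type w}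

/-- The values of the coordinate `b` at which `f` does not vanish form a finite set. -/
def FinAt (b : V) (f : (∀ A, D A) → K) : Prop := ∃ T : Finset (D b), ∀ t, f t ≠ 0 → t b ∈ T

/-- `f` does not depend on the coordinate `b`. -/
def IndepOf (b : V) (f : (∀ A, D A) → K) : Prop := ∀ t d, f (Function.update t b d) = f t

theorem FinAt.aggregate {b : V} {f : (∀ A, D A) → K} (h : FinAt b f) {p : V × AggOp K}
    (hb : b ≠ p.1) : FinAt b (aggregate p f) := by
  obtain ⟨T, hT⟩ := h
  refine ⟨T, fun t ht => ?_⟩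
  by_contra htT
  refine ht (p.2.sum_eq_zero fun a => by_contra fun h0 => htT ?_)
  have := hT _ h0
  rwa [Function.update_of_ne hb] at this

theorem IndepOf.aggregate_self (p : V × AggOp K) (f : (∀ A, D A) → K) :
    IndepOf p.1 (aggregate p f) := by
  intro t d
  simp [Ajar.aggregate]

theorem IndepOf.aggregate {b : V} {f : (∀ A, D A) → K} (h : IndepOf b f) (p : V × AggOp K) :
    IndepOf b (aggregate p f) := by
  intro t d
  by_cases hb : b = p.1
  · subst hb; exact IndepOf.aggregate_self p f t d
  · refine p.2.sum_congr fun a => ?_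
    rw [Function.update_comm hb, h]

theorem aggregate_mul {p : V × AggOp K} {f g : (∀ A, D A) → K} (hf : FinAt p.1 f)
    (hg : IndepOf p.1 g) :
    aggregate p (fun t => g t * f t) = fun t => g t * aggregate p f t := by
  obtain ⟨T, hT⟩ := hf
  funext t
  have : ∀ a, g (Function.update t p.1 a) = g t := fun a => hg t a
  simp only [aggregate, this]
  exact p.2.mul_sum _ _ T fun a ha => by simpa using hT _ ha

theorem aggregate_mul' {p : V × AggOp K} {f g : (∀ A, D A) → K} (hf : FinAt p.1 f)
    (hg : IndepOf p.1 g) :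
    aggregate p (fun t => f t * g t) = fun t => aggregate p f t * g t := by
  simp only [mul_comm _ (g _)]
  exact aggregate_mul hf hg

theorem aggregate_comm_of_op_eq {p q : V × AggOp K} (hpq : p.1 ≠ q.1) (hop : p.2 = q.2)
    {f : (∀ A, D A) → K} (hp : FinAt p.1 f) (hq : FinAt q.1 f) :
    aggregate p (aggregate q f) = aggregate q (aggregate p f) := by
  obtain ⟨T, hT⟩ := hp
  obtain ⟨U, hU⟩ := hq
  funext t
  simp only [aggregate, hop]
  rw [q.2.sum_comm _ T U]
  · refine q.2.sum_congr fun b => q.2.sum_congr fun a => ?_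
    rw [Function.update_comm hpq]
  · intro a b h
    have h1 := hT _ h
    have h2 := hU _ h
    rw [Function.update_of_ne hpq, Function.update_self] at h1
    rw [Function.update_self] at h2
    exact ⟨h1, h2⟩

theorem aggregate_comm_mul {p q : V × AggOp K} {f g : (∀ A, D A) → K}
    (hf : FinAt p.1 f) (hfq : IndepOf q.1 f) (hg : FinAt q.1 g) (hgp : IndepOf p.1 g) :
    aggregate p (aggregate q fun t => f t * g t) =
      aggregate q (aggregate p fun t => f t * g t) := by
  rw [aggregate_mul hg hfq, aggregate_mul' hf hgp, aggregate_mul' hf (hgp.aggregate q),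
    aggregate_mul hg (hfq.aggregate p)]

theorem FinAt.foldr {b : V} {f : (∀ A, D A) → K} (h : FinAt b f) {L : List (V × AggOp K)}
    (hb : b ∉ attrs L) : FinAt b (L.foldr Ajar.aggregate f) := by
  induction L with
  | nil => exact h
  | cons p L ih =>
    have h1 : b ≠ p.1 ∧ b ∉ attrs L := by simpa [attrs] using hb
    exact (ih h1.2).aggregate h1.1

theorem IndepOf.foldr {b : V} {f : (∀ A, D A) → K} (h : IndepOf b f) (L : List (V × AggOp K)) :
    IndepOf b (L.foldr Ajar.aggregate f) := by
  induction L with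
  | nil => exact h
  | cons p L ih => exact ih.aggregate p

/-- Aggregation distributes over a product whose factors have no aggregated attribute in common. -/
theorem foldr_aggregate_mul (Y : Finset V) {f g : (∀ A, D A) → K} :
    ∀ L : List (V × AggOp K), (L.map Prod.fst).Nodup →
    (∀ p ∈ L, p.1 ∈ Y → FinAt p.1 f ∧ IndepOf p.1 g) →
    (∀ p ∈ L, p.1 ∉ Y → FinAt p.1 g ∧ IndepOf p.1 f) →
    L.foldr aggregate (fun t => f t * g t) =
      fun t => (L.filter fun p => p.1 ∈ Y).foldr aggregate f t *
        (L.filter fun p => p.1 ∉ Y).foldr aggregate g t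
  | [], _, _, _ => rfl
  | p :: L, hL, hY, hY' => by
    rw [List.map_cons, List.nodup_cons] at hL
    have hnot : ∀ P : V × AggOp K → Bool, p.1 ∉ attrs (L.filter P) := fun P h =>
      hL.1 (((List.filter_sublist (p := P)).map Prod.fst).subset (List.mem_toFinset.1 h))
    rw [List.foldr_cons, foldr_aggregate_mul Y L hL.2
      (fun q hq => hY q (List.mem_cons_of_mem _ hq))
      (fun q hq => hY' q (List.mem_cons_of_mem _ hq))]
    by_cases hp : p.1 ∈ Y
    · obtain ⟨h1, h2⟩ := hY p List.mem_cons_self hp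
      rw [aggregate_mul' (h1.foldr (hnot _)) (h2.foldr _)]
      simp [hp]
    · obtain ⟨h1, h2⟩ := hY' p List.mem_cons_self hp
      rw [aggregate_mul (h1.foldr (hnot _)) (h2.foldr _)]
      simp [hp]

/-- The join of the relations of a set of hyperedges. -/
def joinOn (E : Finset (Finset V)) (I : Instance K D) (t : ∀ A, D A) : K :=
  ∏ F ∈ E, I F (fun A => t A)

theorem finAt_joinOn {E : Finset (Finset V)} (I : Instance K D) {b : V}
    (h : ∃ F ∈ E, b ∈ F) : FinAt b (joinOn E I) := by
  classical
  obtain ⟨F, hF, hb⟩ := h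
  refine ⟨(I F).support.image fun s => s ⟨b, hb⟩, fun t ht => ?_⟩
  refine Finset.mem_image.2 ⟨fun A => t A, Finsupp.mem_support_iff.2 fun h0 => ht ?_, rfl⟩
  exact Finset.prod_eq_zero hF h0

theorem indepOf_joinOn {E : Finset (Finset V)} (I : Instance K D) {b : V}
    (h : ∀ F ∈ E, b ∉ F) : IndepOf b (joinOn E I) := by
  intro t d
  refine Finset.prod_congr rfl fun F hF => ?_
  congr 1
  funext A
  exact Function.update_of_ne (fun h2 : (A : V) = b => h F hF (h2 ▸ A.2)) _ _

/-- Equal operators commute by Fubini. Otherwise `q.1` lies outside the component of `p.1` among the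
attributes still to be aggregated, and the two aggregations act on different factors of the join.
That every attribute lies in a hyperedge makes all sums finite. -/
theorem aggregate_swap (H : Hypergraph V) (I : Instance K D) {p q : V × AggOp K}
    {L : List (V × AggOp K)} (hL : ((p :: q :: L).map Prod.fst).Nodup)
    (hcov : ∀ A ∈ attrs (p :: q :: L), ∃ F ∈ H.edges, A ∈ F)
    (h : p.2 = q.2 ∨ q.1 ∉ compOf H (attrs (p :: q :: L)) p.1) :
    aggregate p (aggregate q (L.foldr aggregate (join H I))) =
      aggregate q (aggregate p (L.foldr aggregate (join H I))) := by
  classical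
  have hL' : p.1 ≠ q.1 ∧ p.1 ∉ attrs L ∧ q.1 ∉ attrs L ∧ (L.map Prod.fst).Nodup := by
    simp only [List.map_cons, List.nodup_cons, List.mem_cons, not_or] at hL
    simpa only [attrs, List.mem_toFinset] using ⟨hL.1.1, hL.1.2, hL.2.1, hL.2.2⟩
  obtain ⟨hpq, hpL, hqL, hnd⟩ := hL'
  have hpm : p.1 ∈ attrs (p :: q :: L) := by simp [attrs]
  have hqm : q.1 ∈ attrs (p :: q :: L) := by simp [attrs]
  have hLm : ∀ r ∈ L, r.1 ∈ attrs (p :: q :: L) := fun r hr => mem_attrs.2 ⟨r.2, by simp [hr]⟩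
  rcases h with h | h
  · have hfin : ∀ r : V × AggOp K, r.1 ∈ attrs (p :: q :: L) → r.1 ∉ attrs L →
        FinAt r.1 (L.foldr aggregate (join H I)) := fun r hr hrL =>
      FinAt.foldr (finAt_joinOn I (hcov _ hr)) hrL
    exact aggregate_comm_of_op_eq hpq h (hfin p hpm hpL) (hfin q hqm hqL)
  -- The join is split by whether a hyperedge meets `Y`. Since `Y` is a component, no hyperedge
  -- meeting it contains one of the other attributes of the list.
  · set Y := compOf H (attrs (p :: q :: L)) p.1 with hY
    have hsplit : join H I = fun t => joinOn (H.edges.filter fun F => (F ∩ Y).Nonempty) I t *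
        joinOn (H.edges.filter fun F => ¬ (F ∩ Y).Nonempty) I t := by
      funext t
      exact (Finset.prod_filter_mul_prod_filter_not _ _ _).symm
    have hin : ∀ b ∈ attrs (p :: q :: L), b ∈ Y →
        FinAt b (joinOn (H.edges.filter fun F => (F ∩ Y).Nonempty) I) ∧
        IndepOf b (joinOn (H.edges.filter fun F => ¬ (F ∩ Y).Nonempty) I) := by
      intro b hb hbY
      refine ⟨finAt_joinOn I ?_, indepOf_joinOn I fun F hF hbF => ?_⟩
      · obtain ⟨F, hF, hbF⟩ := hcov b hb
        exact ⟨F, Finset.mem_filter.2 ⟨hF, b, Finset.mem_inter.2 ⟨hbF, hbY⟩⟩, hbF⟩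
      · exact (Finset.mem_filter.1 hF).2 ⟨b, Finset.mem_inter.2 ⟨hbF, hbY⟩⟩
    have hout : ∀ b ∈ attrs (p :: q :: L), b ∉ Y →
        FinAt b (joinOn (H.edges.filter fun F => ¬ (F ∩ Y).Nonempty) I) ∧
        IndepOf b (joinOn (H.edges.filter fun F => (F ∩ Y).Nonempty) I) := by
      intro b hb hbY
      have key : ∀ F ∈ H.edges, b ∈ F → ¬ (F ∩ Y).Nonempty := by
        rintro F hF hbF ⟨c, hc⟩
        obtain ⟨hcF, hcY⟩ := Finset.mem_inter.1 hc
        exact hbY (mem_compOf_of_adj hpm hcY hb ⟨F, hF, hcF, hbF⟩)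
      refine ⟨finAt_joinOn I ?_, indepOf_joinOn I fun F hF hbF => ?_⟩
      · obtain ⟨F, hF, hbF⟩ := hcov b hb
        exact ⟨F, Finset.mem_filter.2 ⟨hF, key F hF hbF⟩, hbF⟩
      · exact key F (Finset.mem_filter.1 hF).1 hbF (Finset.mem_filter.1 hF).2
    have hpY : p.1 ∈ Y := self_mem_compOf hpm
    rw [hsplit, foldr_aggregate_mul Y L hnd (fun r hr hrY => hin _ (hLm r hr) hrY)
      (fun r hr hrY => hout _ (hLm r hr) hrY)]
    have hnot : ∀ (P : V × AggOp K → Bool) {b : V}, b ∉ attrs L → b ∉ attrs (L.filter P) :=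
      fun P b hb h => hb (List.mem_toFinset.2
        (((List.filter_sublist (p := P)).map Prod.fst).subset (List.mem_toFinset.1 h)))
    exact aggregate_comm_mul ((hin _ hpm hpY).1.foldr (hnot _ hpL)) ((hout _ hqm h).2.foldr _)
      ((hout _ hqm h).1.foldr (hnot _ hqL)) ((hin _ hpm hpY).2.foldr _)

/-- `q` travels to the left past one neighbour at a time; the assumption on the connected sets
around `q` licenses each swap. -/
theorem foldr_move_to_front (H : Hypergraph V) (I : Instance K D) (q : V × AggOp K)
    (l₂ : List (V × AggOp K)) :
    ∀ l₁ : List (V × AggOp K), ((l₁ ++ q :: l₂).map Prod.fst).Nodup →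
    (∀ A ∈ attrs (l₁ ++ q :: l₂), ∃ F ∈ H.edges, A ∈ F) →
    (∀ S ⊆ attrs (l₁ ++ q :: l₂), Conn H S → q.1 ∈ S →
      firstOp (l₁ ++ q :: l₂) S = some q.2) →
    (l₁ ++ q :: l₂).foldr aggregate (join H I) =
      (q :: (l₁ ++ l₂)).foldr aggregate (join H I)
  | [], _, _, _ => rfl
  | p :: l₁, hnd, hcov, hS => by
    have hsub : attrs (l₁ ++ q :: l₂) ⊆ attrs (p :: l₁ ++ q :: l₂) := by
      intro A hA
      rw [mem_attrs] at hA ⊢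
      obtain ⟨o, ho⟩ := hA
      exact ⟨o, List.mem_cons_of_mem _ ho⟩
    have hperm : (p :: q :: (l₁ ++ l₂)).Perm (p :: l₁ ++ q :: l₂) :=
      (List.perm_middle.symm).cons p
    have hnd' : p.1 ∉ (l₁ ++ q :: l₂).map Prod.fst ∧ ((l₁ ++ q :: l₂).map Prod.fst).Nodup := by
      rw [List.cons_append, List.map_cons] at hnd
      exact List.nodup_cons.1 hnd
    have ih := foldr_move_to_front H I q l₂ l₁ hnd'.2 (fun A hA => hcov A (hsub hA))
      fun S hSs hc hq => by
        have hpS : p.1 ∉ S := fun h => hnd'.1 (List.mem_toFinset.1 (hSs h))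
        have := hS S (hSs.trans hsub) hc hq
        rwa [List.cons_append, firstOp_cons, if_neg hpS] at this
    rw [List.cons_append, List.foldr_cons, ih, List.foldr_cons, List.cons_append, List.foldr_cons,
      List.foldr_cons]
    refine aggregate_swap H I ?_ ?_ ?_
    · exact ((hperm.map Prod.fst).nodup_iff).2 hnd
    · rw [attrs_perm hperm]; exact hcov
    -- The component of `p.1` has first operator `p.2`, because `p` heads the list, and `q.2` by
    -- assumption if it contains `q.1`. So the operators agree, or the attributes are separated.
    · by_cases h : q.1 ∈ compOf H (attrs (p :: q :: (l₁ ++ l₂))) p.1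
      · left
        have hpm : p.1 ∈ attrs (p :: q :: (l₁ ++ l₂)) := by simp [attrs]
        have := hS _ ((compOf_subset _ _ _).trans (attrs_perm hperm).subset) (conn_compOf hpm) h
        rw [List.cons_append, firstOp_cons, if_pos (self_mem_compOf hpm)] at this
        exact Option.some_injective _ this
      · exact .inr h

/-- Orderings with the same first operators define the same query. -/
theorem foldr_eq_of_sameFirst (H : Hypergraph V) (I : Instance K D) :
    ∀ β α : List (V × AggOp K), β.Perm α → (α.map Prod.fst).Nodup →
    (∀ A ∈ attrs α, ∃ F ∈ H.edges, A ∈ F) → SameFirst H α β →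
    α.foldr aggregate (join H I) = β.foldr aggregate (join H I)
  | [], α, hp, _, _, _ => by rw [List.nil_perm.1 hp]
  | q :: β, α, hp, hnd, hcov, hS => by
    obtain ⟨l₁, l₂, rfl⟩ := List.append_of_mem (hp.subset List.mem_cons_self)
    have hp' : β.Perm (l₁ ++ l₂) := (hp.trans List.perm_middle).cons_inv
    have hperm : (q :: (l₁ ++ l₂)).Perm (l₁ ++ q :: l₂) := List.perm_middle.symm
    have hnd' : q.1 ∉ (l₁ ++ l₂).map Prod.fst ∧ ((l₁ ++ l₂).map Prod.fst).Nodup := by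
      have := ((hperm.map Prod.fst).nodup_iff).2 hnd
      rw [List.map_cons] at this
      exact List.nodup_cons.1 this
    have hsub : attrs (l₁ ++ l₂) ⊆ attrs (l₁ ++ q :: l₂) := by
      rw [← attrs_perm hperm]
      intro A hA
      rw [mem_attrs] at hA ⊢
      obtain ⟨o, ho⟩ := hA
      exact ⟨o, List.mem_cons_of_mem _ ho⟩
    -- The head `q` of `β` is brought to the front of `α`, then the tails are compared. Connected
    -- sets of the tail avoid `q.1`, so deleting `q` does not affect their first operators.
    rw [foldr_move_to_front H I q l₂ l₁ hnd hcov, List.foldr_cons, List.foldr_cons,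
      foldr_eq_of_sameFirst H I β (l₁ ++ l₂) hp' hnd'.2 (fun A hA => hcov A (hsub hA))]
    · intro S hSs hc
      have hqS : q.1 ∉ S := fun h => hnd'.1 (List.mem_toFinset.1 (hSs h))
      have := hS S (hSs.trans hsub) hc
      rw [firstOp_cons, if_neg hqS] at this
      rw [← this]
      simp only [firstOp, List.find?_append, List.find?_cons, hqS, decide_false]
    · intro S hSs hc hq
      rw [hS S hSs hc, firstOp_cons, if_pos hq]

theorem equivalent_of_sameFirst {H : Hypergraph V} (hH : Covered H) {α β : List (V × AggOp K)}
    (hα : IsOrdering H α) (hp : β.Perm α) (hS : SameFirst H α β) : Equivalent D H α β :=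
  ⟨hp, fun I => foldr_eq_of_sameFirst H I β α hp hα.1 (fun A hA => hH A (hα.2 hA)) hS⟩

end Query

/-! ### Instances that detect the first operator of a connected set -/

section Detect

variable {V : Type u} [DecidableEq V] {K : Type v} [CommMonoidWithZero K] {D : V → Type w}

/-- The tuples `t` and `s` agree on `U`. -/
def Agree (U : Finset V) (t s : ∀ A, D A) : Prop := ∀ A ∈ U, t A = s A

theorem agree_insert_update {U : Finset V} {b : V} (hb : b ∉ U) {t s : ∀ A, D A} {d : D b} :
    Agree (insert b U) (Function.update t b d) s ↔ Agree U t s ∧ d = s b := by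
  simp only [Agree, Finset.forall_mem_insert, Function.update_self, and_comm (b := d = s b)]
  refine and_congr_right fun _ => forall₂_congr fun A hA => ?_
  have hne : A ≠ b := fun h => hb (h ▸ hA)
  rw [Function.update_of_ne hne]

/-- `f` takes the value `x` at the tuple `d₀` over `U`, the value `y` at `d₁` and vanishes at all
other tuples. -/
def TwoPoint (U : Finset V) (d₀ d₁ : ∀ A, D A) (x y : K) (f : (∀ A, D A) → K) : Prop :=
  (∀ t, Agree U t d₀ → f t = x) ∧ (∀ t, Agree U t d₁ → f t = y) ∧
    ∀ t, ¬ Agree U t d₀ → ¬ Agree U t d₁ → f t = 0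

/-- `f` takes the value `x` at the tuple `d₀` over `U` and vanishes at all other tuples. -/
def OnePoint (U : Finset V) (d₀ : ∀ A, D A) (x : K) (f : (∀ A, D A) → K) : Prop :=
  (∀ t, Agree U t d₀ → f t = x) ∧ ∀ t, ¬ Agree U t d₀ → f t = 0

variable {U : Finset V} {d₀ d₁ : ∀ A, D A} {x y : K} {f : (∀ A, D A) → K} {p : V × AggOp K}

/-- While the two tuples still differ somewhere on `U`, the tuple outside `p.1` tells them apart,
and each sum has at most one nonzero term. -/
theorem TwoPoint.aggregate (h : TwoPoint (insert p.1 U) d₀ d₁ x y f) (hp : p.1 ∉ U)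
    (hd : ∃ a ∈ U, d₀ a ≠ d₁ a) : TwoPoint U d₀ d₁ x y (aggregate p f) := by
  obtain ⟨h0, h1, h2⟩ := h
  obtain ⟨a, haU, ha⟩ := hd
  refine ⟨fun t ht => ?_, fun t ht => ?_, fun t ht ht' => p.2.sum_eq_zero fun d => ?_⟩
  · rw [Ajar.aggregate, p.2.sum_single _ (d₀ p.1)]
    · exact h0 _ ((agree_insert_update hp).2 ⟨ht, rfl⟩)
    · intro d hd
      refine h2 _ (fun h => hd ((agree_insert_update hp).1 h).2) fun h => ha ?_
      rw [← ht a haU, ((agree_insert_update hp).1 h).1 a haU]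
  · rw [Ajar.aggregate, p.2.sum_single _ (d₁ p.1)]
    · exact h1 _ ((agree_insert_update hp).2 ⟨ht, rfl⟩)
    · intro d hd
      refine h2 _ (fun h => ha ?_) (fun h => hd ((agree_insert_update hp).1 h).2)
      rw [← ht a haU, ((agree_insert_update hp).1 h).1 a haU]
  · exact h2 _ (fun h => ht ((agree_insert_update hp).1 h).1)
      (fun h => ht' ((agree_insert_update hp).1 h).1)

/-- Here `p.1` is the last coordinate that distinguishes the two tuples, and summing it out combines
their annotations. -/
theorem TwoPoint.aggregate_of_eq (h : TwoPoint (insert p.1 U) d₀ d₁ x y f) (hp : p.1 ∉ U)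
    (hd : Agree U d₀ d₁) (hne : d₀ p.1 ≠ d₁ p.1) :
    OnePoint U d₀ (p.2.op x y) (Ajar.aggregate p f) := by
  obtain ⟨h0, h1, h2⟩ := h
  refine ⟨fun t ht => ?_, fun t ht => p.2.sum_eq_zero fun d => ?_⟩
  · have ht' : Agree U t d₁ := fun A hA => (ht A hA).trans (hd A hA)
    rw [Ajar.aggregate, p.2.sum_pair _ hne, h0 _ ((agree_insert_update hp).2 ⟨ht, rfl⟩),
      h1 _ ((agree_insert_update hp).2 ⟨ht', rfl⟩)]
    exact fun d hd0 hd1 => h2 _ (fun h => hd0 ((agree_insert_update hp).1 h).2)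
      (fun h => hd1 ((agree_insert_update hp).1 h).2)
  · exact h2 _ (fun h => ht ((agree_insert_update hp).1 h).1)
      (fun h => ht fun A hA => (((agree_insert_update hp).1 h).1 A hA).trans (hd A hA).symm)

theorem OnePoint.aggregate (h : OnePoint (insert p.1 U) d₀ x f) (hp : p.1 ∉ U) :
    OnePoint U d₀ x (aggregate p f) := by
  obtain ⟨h0, h1⟩ := h
  refine ⟨fun t ht => ?_, fun t ht => p.2.sum_eq_zero fun d => ?_⟩
  · rw [Ajar.aggregate, p.2.sum_single _ (d₀ p.1)]
    · exact h0 _ ((agree_insert_update hp).2 ⟨ht, rfl⟩)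
    · exact fun d hd => h1 _ fun h => hd ((agree_insert_update hp).1 h).2
  · exact h1 _ fun h => ht ((agree_insert_update hp).1 h).1

/-- The fold works from the right end of `L`, so the last attribute of `S` to disappear is the first
one in `L`. Until then the two points stay apart, at that moment they merge by its operator, and
afterwards a single point is carried along. -/
theorem foldr_aggregate_twoPoint {W S : Finset V} (hS : S.Nonempty) (hSW : S ⊆ W)
    (hd : ∀ A, d₀ A ≠ d₁ A ↔ A ∈ S) (hf : TwoPoint W d₀ d₁ x y f) :
    ∀ L : List (V × AggOp K), (L.map Prod.fst).Nodup → attrs L ⊆ W →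
      (¬ S ⊆ attrs L → TwoPoint (W \ attrs L) d₀ d₁ x y (L.foldr aggregate f)) ∧
      (S ⊆ attrs L → ∀ o, firstOp L S = some o →
        OnePoint (W \ attrs L) d₀ (o.op x y) (L.foldr aggregate f))
  | [], _, _ => by
    refine ⟨fun _ => by simpa [attrs] using hf, fun h => ?_⟩
    obtain ⟨a, ha⟩ := hS
    exact absurd (h ha) (by simp [attrs])
  | p :: L, hnd, hLW => by
    rw [List.map_cons, List.nodup_cons] at hnd
    have hpL : p.1 ∉ attrs L := fun h => hnd.1 (List.mem_toFinset.1 h)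
    have hcons : attrs (p :: L) = insert p.1 (attrs L) := by simp [attrs]
    rw [hcons] at hLW ⊢
    obtain ⟨hpW, hLW⟩ := Finset.insert_subset_iff.1 hLW
    obtain ⟨ih1, ih2⟩ := foldr_aggregate_twoPoint hS hSW hd hf L hnd.2 hLW
    have hU : W \ attrs L = insert p.1 (W \ insert p.1 (attrs L)) := by
      ext A
      by_cases hA : A = p.1
      · subst hA; simp [hpW, hpL]
      · simp [hA]
    have hpU : p.1 ∉ W \ insert p.1 (attrs L) := by simp
    rw [hU] at ih1 ih2
    rw [List.foldr_cons]
    constructor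
    · intro hSn
      refine (ih1 fun h => hSn (h.trans (Finset.subset_insert _ _))).aggregate hpU ?_
      obtain ⟨a, haS, ha⟩ := Finset.not_subset.1 hSn
      exact ⟨a, Finset.mem_sdiff.2 ⟨hSW haS, ha⟩, (hd a).2 haS⟩
    · intro hSs o ho
      rw [firstOp_cons] at ho
      split_ifs at ho with hpS
      · cases ho
        refine (ih1 fun h => hpL (h hpS)).aggregate_of_eq hpU (fun A hA => ?_) ((hd _).2 hpS)
        by_contra hne
        exact (Finset.mem_sdiff.1 hA).2 (hSs ((hd A).1 hne))
      · exact (ih2 (fun a ha => (Finset.mem_insert.1 (hSs ha)).resolve_left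
          (fun h => hpS (h ▸ ha))) o ho).aggregate hpU

open Classical in
/-- The relations that contain the tuples `d₀` and `d₁` only; the relation of `F₀` annotates them
with `x` and `y`. -/
noncomputable def pairInstance (d₀ d₁ : ∀ A, D A) (x y : K) (F₀ : Finset V) : Instance K D :=
  fun F => Finsupp.onFinset {fun A : F => d₀ A, fun A : F => d₁ A}
    (fun t => if t = (fun A : F => d₀ A) then (if F = F₀ then x else 1)
      else if t = (fun A : F => d₁ A) then (if F = F₀ then y else 1) else 0)
    (by
      intro t ht
      by_contra hn
      simp only [Finset.mem_insert, Finset.mem_singleton, not_or] at hn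
      exact ht (by rw [if_neg hn.1, if_neg hn.2]))

/-- A tuple in the support of the join agrees with `d₀` or `d₁` on each hyperedge. Connectedness of
`S` forces the same choice throughout `S`, and outside `S` there is nothing to choose. -/
theorem join_pairInstance {H : Hypergraph V} (hH : Covered H) {S F₀ : Finset V} (hS : Conn H S)
    (hd : ∀ A, d₀ A ≠ d₁ A ↔ A ∈ S) (hF₀ : F₀ ∈ H.edges) {a : V} (ha : a ∈ S) (haF : a ∈ F₀) :
    TwoPoint H.verts d₀ d₁ x y (join H (pairInstance d₀ d₁ x y F₀)) := by
  classical
  have hval : ∀ (F : Finset V) (t : ∀ A, D A), pairInstance d₀ d₁ x y F₀ F (fun A => t A) =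
      if (fun A : F => t A) = (fun A : F => d₀ A) then (if F = F₀ then x else 1)
      else if (fun A : F => t A) = (fun A : F => d₁ A) then (if F = F₀ then y else 1) else 0 :=
    fun F t => rfl
  have hres : ∀ (F : Finset V) (t s : ∀ A, D A),
      (fun A : F => t A) = (fun A : F => s A) ↔ Agree F t s := fun F t s =>
    ⟨fun h A hA => congrFun h ⟨A, hA⟩, fun h => funext fun A => h A A.2⟩
  simp only [hres] at hval
  refine ⟨fun t ht => ?_, fun t ht => ?_, fun t ht0 ht1 => ?_⟩
  · have : ∀ F ∈ H.edges, pairInstance d₀ d₁ x y F₀ F (fun A => t A) =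
        if F = F₀ then x else 1 := fun F hF => by
      have h1 : Agree F t d₀ := fun A hA => ht A (H.edges_subset F hF hA)
      rw [hval, if_pos h1]
    rw [join, Finset.prod_congr rfl this, Finset.prod_ite_eq' H.edges F₀ (fun _ => x), if_pos hF₀]
  · have : ∀ F ∈ H.edges, pairInstance d₀ d₁ x y F₀ F (fun A => t A) =
        if F = F₀ then y else 1 := fun F hF => by
      have h1 : Agree F t d₁ := fun A hA => ht A (H.edges_subset F hF hA)
      rw [hval]
      -- `pairInstance` tests for `d₀` first. The two tuples may coincide on a hyperedge, but not on
      -- `F₀`, which contains `a ∈ S`.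
      split_ifs with h0 hFF
      · subst hFF
        exact absurd ((h0 a haF).symm.trans (h1 a haF)) ((hd a).2 ha)
      all_goals rfl
    rw [join, Finset.prod_congr rfl this, Finset.prod_ite_eq' H.edges F₀ (fun _ => y), if_pos hF₀]
  · by_contra hne
    have hF : ∀ F ∈ H.edges, Agree F t d₀ ∨ Agree F t d₁ := by
      intro F hF
      by_contra! hn
      refine hne (Finset.prod_eq_zero hF ?_)
      rw [hval, if_neg hn.1, if_neg hn.2]
    -- Symmetric in `d₀` and `d₁`: agreement with `s` at `a` spreads along `S`, because a hyperedge
    -- with an attribute of `S` where `t` equals `s` cannot follow `s'`.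
    have key : ∀ (s s' : ∀ A, D A), (∀ A, s A ≠ s' A ↔ A ∈ S) →
        (∀ F ∈ H.edges, Agree F t s ∨ Agree F t s') → t a = s a → Agree H.verts t s := by
      intro s s' hs hor hta
      have hSs : ∀ b, ReflTransGen (RelOn H.Adj (S : Set V)) a b → t b = s b := by
        intro b hb
        induction hb with
        | refl => exact hta
        | tail _ h ih =>
          obtain ⟨hc, hd', F, hF, hcF, hdF⟩ := h
          rcases hor F hF with h | h
          · exact h _ hdF
          · exact absurd (ih.symm.trans (h _ hcF)) ((hs _).2 hc)
      intro A hA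
      by_cases hAS : A ∈ S
      · exact hSs A (hS a ha A hAS)
      · obtain ⟨F, hF, hAF⟩ := hH A hA
        rcases hor F hF with h | h
        · exact h A hAF
        · rw [h A hAF]
          by_contra hne
          exact hAS ((hs A).1 (Ne.symm hne))
    rcases hF F₀ hF₀ with h | h
    · exact ht0 (key d₀ d₁ hd hF (h a haF))
    · exact ht1 (key d₁ d₀ (fun A => ne_comm.trans (hd A)) (fun F hF' => (hF F hF').symm)
        (h a haF))

/-- One instance and one tuple serve all orderings at once, which is what allows the first operators
of two equivalent orderings to be compared. -/
theorem exists_instance_query_eq [∀ A, Nontrivial (D A)] {H : Hypergraph V} (hH : Covered H)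
    {S : Finset V} (hS : Conn H S) {a : V} (ha : a ∈ S) (hSH : S ⊆ H.verts) (x y : K) :
    ∃ (I : Instance K D) (t : ∀ A, D A), ∀ α : List (V × AggOp K), IsOrdering H α →
      S ⊆ attrs α → ∀ o, firstOp α S = some o → query H α I t = o.op x y := by
  classical
  have d₀ : ∀ A, D A := fun A => Classical.arbitrary _
  choose e he using fun A => exists_ne (d₀ A)
  let d₁ : ∀ A, D A := fun A => if A ∈ S then e A else d₀ A
  have hd : ∀ A, d₀ A ≠ d₁ A ↔ A ∈ S := by
    intro A
    by_cases hA : A ∈ S <;> simp [d₁, hA, (he A).symm]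
  obtain ⟨F₀, hF₀, haF⟩ := hH a (hSH ha)
  refine ⟨pairInstance d₀ d₁ x y F₀, d₀, fun α hα hSα o ho => ?_⟩
  exact ((foldr_aggregate_twoPoint ⟨a, ha⟩ hSH hd
    (join_pairInstance hH hS hd hF₀ ha haF) α hα.1 hα.2).2 hSα o ho).1 d₀ fun _ _ => rfl

theorem IsOrdering.perm {H : Hypergraph V} {α β : List (V × AggOp K)} (hα : IsOrdering H α)
    (h : β.Perm α) : IsOrdering H β :=
  ⟨((h.map Prod.fst).nodup_iff).2 hα.1, by rw [attrs_perm h]; exact hα.2⟩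

theorem firstOp_empty {α : List (V × AggOp K)} : firstOp α ∅ = none := by
  simp [firstOp]

/-- Equivalent orderings have the same first operators. -/
theorem Equivalent.sameFirst [∀ A, Nontrivial (D A)] {H : Hypergraph V} (hH : Covered H)
    {α β : List (V × AggOp K)} (hα : IsOrdering H α) (h : Equivalent D H α β) :
    SameFirst H α β := by
  intro S hSα hS
  rcases S.eq_empty_or_nonempty with rfl | ⟨a, ha⟩
  · rw [firstOp_empty, firstOp_empty]
  have hSβ : S ⊆ attrs β := by rwa [attrs_perm h.1]
  obtain ⟨p, hp⟩ := exists_isFirst ha (hSα ha)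
  obtain ⟨q, hq⟩ := exists_isFirst ha (hSβ ha)
  rw [hp.firstOp, hq.firstOp]
  congr 1
  ext x y
  obtain ⟨I, t, hI⟩ := exists_instance_query_eq (D := D) hH hS ha (hSα.trans hα.2) x y
  rw [← hI α hα hSα _ hp.firstOp, ← hI β (hα.perm h.1) hSβ _ hq.firstOp, h.2 I]

end Detect

/-! ### The initial elements of a component -/

section Initial

variable {V : Type u} [DecidableEq V] {K : Type v} [CommMonoidWithZero K] {D : V → Type w}
  [∀ A, Nontrivial (D A)] {H : Hypergraph V} {α β : List (V × AggOp K)} {C C' : Finset V}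

/-- The criterion for moving an attribute to the front of its ordering. -/
theorem sameFirst_cons {l₁ l₂ : List (V × AggOp K)} {p : V × AggOp K}
    (h : ∀ S ⊆ attrs (l₁ ++ p :: l₂), Conn H S → p.1 ∈ S →
      firstOp (l₁ ++ p :: l₂) S = some p.2) :
    SameFirst H (l₁ ++ p :: l₂) (p :: (l₁ ++ l₂)) := by
  intro S hS hc
  rw [firstOp_cons]
  split_ifs with hp
  · exact h S hS hc hp
  · exact firstOp_append_cons hp

theorem initial_subset : initial D H α C ⊆ C := by
  classical exact Finset.filter_subset _ _

/-- Induction on `S`. If the first attribute `q` of `S` had another operator than `x`, then `q`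
would precede `x` in every equivalent ordering, against the minimality of `x` in `C`. -/
theorem firstOp_eq_of_mem_initial (hH : Covered H) (hα : IsOrdering H α)
    (hC : C ∈ components H α) {x : V} (hx : x ∈ initial D H α C) :
    ∀ S ⊆ attrs α, Conn H S → x ∈ S → firstOp α S = firstOp α {x} := by
  classical
  obtain ⟨hxC, hmin⟩ := Finset.mem_filter.1 hx
  intro S
  induction S using Finset.strongInduction with
  | H S ih =>
  intro hSα hS hxS
  obtain ⟨q, hq⟩ := exists_isFirst hxS (hSα hxS)
  by_contra hne
  have hqx : x ≠ q.1 := by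
    rintro rfl
    rw [hq.firstOp, (isFirst_singleton hα.1 hq.mem).firstOp] at hne
    exact hne rfl
  have hxe : x ∈ S.erase q.1 := Finset.mem_erase.2 ⟨hqx, hxS⟩
  -- `S'` is connected with the operator of `x` first, by induction; `S' ∪ {q}` is connected with
  -- the operator of `q` first. Equivalent orderings preserve both facts.
  set S' := compOf H (S.erase q.1) x with hS'
  have hS'e : S' ⊆ S.erase q.1 := compOf_subset _ _ _
  have hS'S : S' ⊂ S := hS'e.trans_ssubset (Finset.erase_ssubset hq.fst_mem)
  have hxS' : x ∈ S' := self_mem_compOf hxe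
  have hS'c : Conn H S' := conn_compOf hxe
  have hqS' : q.1 ∉ S' := fun h => Finset.notMem_erase _ _ (hS'e h)
  have h1 := ih S' hS'S (hS'S.subset.trans hSα) hS'c hxS'
  have hTc : Conn H (insert q.1 S') := by
    obtain ⟨c, hc, d, hd, hcS', hdS', hcd⟩ := ConnOn.exists_crossing hS (Y := (S' : Set V))
      hxS hxS' hq.fst_mem hqS'
    have hdq : d = q.1 := by
      by_contra hdq
      exact hdS' (mem_compOf_of_adj hxe hcS' (Finset.mem_erase.2 ⟨hdq, hd⟩) hcd)
    exact hS'c.insert hcS' (hdq ▸ hcd)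
  have hTS : insert q.1 S' ⊆ S := Finset.insert_subset hq.fst_mem hS'S.subset
  have hqT : IsFirst α (insert q.1 S') q := hq.mono hTS (Finset.mem_insert_self _ _)
  have hqC : q.1 ∈ C := hS.subset_component hSα hC hxS hxC hq.fst_mem
  refine hmin q.1 hqC (.inr fun β hβ => ?_)
  have hsame := hβ.sameFirst hH hα
  have hβa : attrs β = attrs α := attrs_perm hβ.1
  obtain ⟨r, hr⟩ := exists_isFirst (α := β) (Finset.mem_insert_of_mem hxS' : x ∈ insert q.1 S')
    (by rw [hβa]; exact hSα hxS)
  -- If the first attribute `r` of `S' ∪ {q}` in `β` lay in `S'`, it would also be first in `S'`,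
  -- and the two different first operators would coincide.
  have hrq : r.1 = q.1 := by
    by_contra hrq
    have hrS' : r.1 ∈ S' := (Finset.mem_insert.1 hr.fst_mem).resolve_left hrq
    have h2 := (hr.mono (Finset.subset_insert _ _) hrS').firstOp
    rw [← hsame S' (hS'S.subset.trans hSα) hS'c, h1] at h2
    have h3 := hr.firstOp
    rw [← hsame _ (hTS.trans hSα) hTc, hqT.firstOp] at h3
    exact hne (by rw [hq.firstOp, h2, h3])
  rw [← hrq]
  exact hr.precedes (Finset.mem_insert_of_mem hxS') (by rw [hβa]; exact hSα hxS)
    (fun h => hqx (h.symm.trans hrq))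

/-- Moving `x` to the front yields an equivalent ordering, in which nothing precedes `x`. -/
theorem mem_initial_of_firstOp_eq (hH : Covered H) (hα : IsOrdering H α)
    (hC : C ∈ components H α) {x : V} (hx : x ∈ C)
    (h : ∀ S ⊆ attrs α, Conn H S → x ∈ S → firstOp α S = firstOp α {x}) :
    x ∈ initial D H α C := by
  classical
  refine Finset.mem_filter.2 ⟨hx, fun y hy hlt => ?_⟩
  rcases hlt with ⟨hy', -⟩ | hprec
  · exact (mem_outputs.1 hy').2 (components_subset hC hy)
  obtain ⟨o, ho⟩ := mem_attrs.1 (components_subset hC hx)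
  have h1 := (isFirst_singleton hα.1 ho).firstOp
  obtain ⟨l₁, l₂, rfl⟩ := List.append_of_mem ho
  have hp : ((x, o) :: (l₁ ++ l₂)).Perm (l₁ ++ (x, o) :: l₂) := List.perm_middle.symm
  exact not_precedes_head (hprec _ (equivalent_of_sameFirst hH hα hp
    (sameFirst_cons fun S hS hc hxS => (h S hS hc hxS).trans h1)))

theorem mem_initial_iff (hH : Covered H) (hα : IsOrdering H α)
    (hC : C ∈ components H α) {x : V} : x ∈ initial D H α C ↔
      x ∈ C ∧ ∀ S ⊆ attrs α, Conn H S → x ∈ S → firstOp α S = firstOp α {x} :=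
  ⟨fun hx => ⟨initial_subset hx, firstOp_eq_of_mem_initial hH hα hC hx⟩,
    fun hx => mem_initial_of_firstOp_eq hH hα hC hx.1 hx.2⟩

theorem isFirst_mem_initial (hH : Covered H) (hα : IsOrdering H α) (hC : C ∈ components H α)
    {p : V × AggOp K} (hp : IsFirst α C p) : p.1 ∈ initial D H α C := by
  refine mem_initial_of_firstOp_eq hH hα hC hp.fst_mem fun S hS hc hpS => ?_
  rw [(hp.mono (hc.subset_component hS hC hpS hp.fst_mem) hpS).firstOp,
    (isFirst_singleton hα.1 hp.mem).firstOp]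

theorem initial_nonempty (hH : Covered H) (hα : IsOrdering H α) (hC : C ∈ components H α) :
    (initial D H α C).Nonempty := by
  obtain ⟨A, hA⟩ := components_nonempty hC
  obtain ⟨p, hp⟩ := exists_isFirst hA (components_subset hC hA)
  exact ⟨_, isFirst_mem_initial hH hα hC hp⟩

/-! ### The smaller queries -/

theorem attrs_subOrdering (hC : C ∈ components H α) :
    attrs (subOrdering D H α C) = C \ initial D H α C := by
  rw [subOrdering, attrs_restrictTo]
  exact Finset.inter_eq_right.2 (Finset.sdiff_subset.trans (components_subset hC))

theorem attrs_subOrdering_subset (hC : C ∈ components H α) :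
    attrs (subOrdering D H α C) ⊆ C := by
  rw [attrs_subOrdering hC]; exact Finset.sdiff_subset

theorem mem_edges_subHypergraphPlus {F : Finset V} : F ∈ (subHypergraphPlus H α C).edges ↔
    F = outputs H α ∩ plus H C ∨ F ∈ edgesMeeting H C := Finset.mem_insert

theorem adj_subHypergraph {A B : V} (hA : A ∈ C) : (subHypergraph H C).Adj A B ↔ H.Adj A B := by
  constructor
  · rintro ⟨F, hF, h⟩; exact ⟨F, (mem_edgesMeeting.1 hF).1, h⟩
  · rintro ⟨F, hF, h⟩; exact ⟨F, mem_edgesMeeting.2 ⟨hF, A, h.1, hA⟩, h⟩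

theorem adj_subHypergraphPlus (hC : C ∈ components H α) {A B : V} (hA : A ∈ C) :
    (subHypergraphPlus H α C).Adj A B ↔ H.Adj A B := by
  constructor
  · rintro ⟨F, hF, h⟩
    rcases mem_edges_subHypergraphPlus.1 hF with rfl | hF
    · exact absurd (components_subset hC hA) (mem_outputs.1 (Finset.mem_inter.1 h.1).1).2
    · exact ⟨F, (mem_edgesMeeting.1 hF).1, h⟩
  · rintro ⟨F, hF, h⟩
    exact ⟨F, mem_edges_subHypergraphPlus.2 (.inr (mem_edgesMeeting.2 ⟨hF, A, h.1, hA⟩)), h⟩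

theorem covered_subHypergraph : Covered (subHypergraph H C) := fun A hA => by
  obtain ⟨F, hF, hAF⟩ := Finset.mem_biUnion.1 (hA : A ∈ plus H C)
  exact ⟨F, hF, hAF⟩

theorem covered_subHypergraphPlus : Covered (subHypergraphPlus H α C) := fun A hA => by
  obtain ⟨F, hF, hAF⟩ := Finset.mem_biUnion.1 (hA : A ∈ plus H C)
  exact ⟨F, Finset.mem_insert_of_mem hF, hAF⟩

theorem nodup_subOrdering (hα : IsOrdering H α) :
    ((subOrdering D H α C).map Prod.fst).Nodup :=
  hα.1.sublist ((List.filter_sublist).map Prod.fst)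

theorem isOrdering_subHypergraph (hH : Covered H) (hα : IsOrdering H α)
    (hC : C ∈ components H α) : IsOrdering (subHypergraph H C) (subOrdering D H α C) :=
  ⟨nodup_subOrdering hα, (attrs_subOrdering_subset hC).trans
    (subset_plus hH ((components_subset hC).trans hα.2))⟩

theorem isOrdering_subHypergraphPlus (hH : Covered H) (hα : IsOrdering H α)
    (hC : C ∈ components H α) : IsOrdering (subHypergraphPlus H α C) (subOrdering D H α C) :=
  isOrdering_subHypergraph hH hα hC

theorem compOf_congr {H H' : Hypergraph V} {S : Finset V}
    (h : ∀ a ∈ S, ∀ b ∈ S, H.Adj a b ↔ H'.Adj a b) (x : V) : compOf H S x = compOf H' S x := by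
  have : RelOn H.Adj (S : Set V) = RelOn H'.Adj (S : Set V) := by
    funext a b
    exact propext (and_congr_right fun ha => and_congr_right fun hb => h a ha b hb)
  unfold compOf
  rw [this]

theorem components_congr {H H' : Hypergraph V}
    (h : ∀ a ∈ attrs α, ∀ b ∈ attrs α, H.Adj a b ↔ H'.Adj a b) :
    components H α = components H' α := by
  ext C
  simp only [mem_components, compOf_congr h]

/-- `C^O` is defined through the answers on all instances of the hypergraph, but `mem_initial_iff`
shows that only adjacency among the aggregated attributes matters. This makes `(C⁺, E_C)` and `H_C⁺`
interchangeable in the recursion: the extra hyperedge contains output attributes only. -/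
theorem initial_congr {H H' : Hypergraph V} (hH : Covered H) (hH' : Covered H')
    (hα : IsOrdering H α) (hα' : IsOrdering H' α)
    (h : ∀ a ∈ attrs α, ∀ b ∈ attrs α, H.Adj a b ↔ H'.Adj a b) (hC : C ∈ components H α) :
    initial D H α C = initial D H' α C := by
  ext x
  rw [mem_initial_iff hH hα hC, mem_initial_iff hH' hα' (by rwa [← components_congr h])]
  have hconn : ∀ S ⊆ attrs α, (Conn H S ↔ Conn H' S) := fun S hS =>
    ⟨fun hc => hc.mono fun a ha b hb => (h a (hS ha) b (hS hb)).1,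
      fun hc => hc.mono fun a ha b hb => (h a (hS ha) b (hS hb)).2⟩
  exact and_congr_right fun _ => forall₂_congr fun S hS => by rw [hconn S hS]

theorem components_subHypergraphPlus (hC : C ∈ components H α) :
    components (subHypergraphPlus H α C) (subOrdering D H α C) =
      components (subHypergraph H C) (subOrdering D H α C) :=
  components_congr fun a ha b _ => by
    rw [adj_subHypergraphPlus hC (attrs_subOrdering_subset hC ha),
      adj_subHypergraph (attrs_subOrdering_subset hC ha)]

theorem subOrdering_subHypergraphPlus (hH : Covered H) (hα : IsOrdering H α)
    (hC : C ∈ components H α)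
    (hC' : C' ∈ components (subHypergraph H C) (subOrdering D H α C)) :
    subOrdering D (subHypergraphPlus H α C) (subOrdering D H α C) C' =
      subOrdering D (subHypergraph H C) (subOrdering D H α C) C' := by
  refine congrArg (fun I => restrictTo (subOrdering D H α C) (C' \ I))
    (initial_congr covered_subHypergraphPlus covered_subHypergraph
      (isOrdering_subHypergraphPlus hH hα hC) (isOrdering_subHypergraph hH hα hC) ?_
      (by rwa [components_subHypergraphPlus hC]))
  intro a ha b _
  rw [adj_subHypergraphPlus hC (attrs_subOrdering_subset hC ha),
      adj_subHypergraph (attrs_subOrdering_subset hC ha)]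

theorem edgesMeeting_subHypergraph (hC' : C' ⊆ C) :
    edgesMeeting (subHypergraph H C) C' = edgesMeeting H C' := by
  ext F
  simp only [mem_edgesMeeting, subHypergraph]
  constructor
  · rintro ⟨⟨h, -⟩, h'⟩; exact ⟨h, h'⟩
  · rintro ⟨h, A, hA, hAC⟩; exact ⟨⟨h, A, hA, hC' hAC⟩, A, hA, hAC⟩

theorem edgesMeeting_subHypergraphPlus (hC : C ∈ components H α) (hC' : C' ⊆ C) :
    edgesMeeting (subHypergraphPlus H α C) C' = edgesMeeting H C' := by
  ext F
  rw [mem_edgesMeeting, mem_edgesMeeting, mem_edges_subHypergraphPlus, mem_edgesMeeting]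
  constructor
  · rintro ⟨rfl | ⟨h, -⟩, A, hA, hAC⟩
    · exact absurd (components_subset hC (hC' hAC)) (mem_outputs.1 (Finset.mem_inter.1 hA).1).2
    · exact ⟨h, A, hA, hAC⟩
  · rintro ⟨h, A, hA, hAC⟩; exact ⟨.inr ⟨h, A, hA, hC' hAC⟩, A, hA, hAC⟩

theorem subHypergraph_subHypergraph (hC' : C' ⊆ C) :
    subHypergraph (subHypergraph H C) C' = subHypergraph H C' := by
  ext1
  · exact congrArg (fun E : Finset (Finset V) => E.biUnion id)
      (edgesMeeting_subHypergraph hC')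
  · exact edgesMeeting_subHypergraph hC'

theorem plus_subHypergraphPlus (hC : C ∈ components H α) (hC' : C' ⊆ C) :
    plus (subHypergraphPlus H α C) C' = plus H C' := by
  rw [plus, plus, edgesMeeting_subHypergraphPlus hC hC']

theorem subHypergraph_subHypergraphPlus (hC : C ∈ components H α) (hC' : C' ⊆ C) :
    subHypergraph (subHypergraphPlus H α C) C' = subHypergraph H C' := by
  ext1
  · exact plus_subHypergraphPlus hC hC'
  · exact edgesMeeting_subHypergraphPlus hC hC'

theorem mem_outputs_subOrdering (hC : C ∈ components H α) {A : V} (hA : A ∈ plus H C) :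
    A ∈ outputs (subHypergraphPlus H α C) (subOrdering D H α C) ↔
      A ∈ outputs H α ∨ A ∈ initial D H α C := by
  rw [mem_outputs, mem_outputs, attrs_subOrdering hC, Finset.mem_sdiff]
  have h1 : A ∈ (subHypergraphPlus H α C).verts := hA
  have h2 := plus_subset hA
  simp only [h1, h2, true_and, not_and, not_not]
  constructor
  · intro h
    by_cases hAα : A ∈ attrs α
    · exact .inr (h (mem_component_of_mem_plus hC hA hAα))
    · exact .inl hAα
  · rintro (h | h) hAC
    · exact absurd (components_subset hC hAC) h
    · exact h

theorem Conn.of_subHypergraphPlus {S : Finset V} (hC : C ∈ components H α) (hS : S ⊆ C)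
    (h : Conn (subHypergraphPlus H α C) S) : Conn H S :=
  h.mono fun _ ha _ _ hab => (adj_subHypergraphPlus hC (hS ha)).1 hab

theorem Conn.to_subHypergraphPlus {S : Finset V} (hC : C ∈ components H α) (hS : S ⊆ C)
    (h : Conn H S) : Conn (subHypergraphPlus H α C) S :=
  h.mono fun _ ha _ _ hab => (adj_subHypergraphPlus hC (hS ha)).2 hab

theorem Conn.to_subHypergraph {S : Finset V} (hS : S ⊆ C)
    (h : Conn H S) : Conn (subHypergraph H C) S :=
  h.mono fun _ ha _ _ hab => (adj_subHypergraph (hS ha)).2 hab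

theorem firstOp_subOrdering {S : Finset V} (hC : C ∈ components H α)
    (hS : S ⊆ attrs (subOrdering D H α C)) : firstOp (subOrdering D H α C) S = firstOp α S :=
  firstOp_restrictTo (by rwa [attrs_subOrdering hC] at hS)

theorem SameFirst.subOrdering (h : SameFirst H α β) (hC : C ∈ components H α) :
    SameFirst (subHypergraphPlus H α C) (Ajar.subOrdering D H α C) β := by
  intro S hS hc
  have hSC := hS.trans (attrs_subOrdering_subset hC)
  rw [firstOp_subOrdering hC hS]
  exact h S (hSC.trans (components_subset hC)) (hc.of_subHypergraphPlus hC hSC)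

/-- The components of the smaller queries do not have the first operator of an initial attribute
next to them. -/
theorem firstOp_component_ne (hH : Covered H) (hα : IsOrdering H α) (hC : C ∈ components H α)
    (hC' : C' ∈ components (subHypergraphPlus H α C) (subOrdering D H α C)) {x : V}
    (hx : x ∈ initial D H α C) : firstOp α C' ≠ firstOp α {x} := by
  intro heq
  have hC'a := components_subset hC'
  have hC'C := hC'a.trans (attrs_subOrdering_subset hC)
  have hC'α := hC'C.trans (components_subset hC)
  obtain ⟨A, hA⟩ := components_nonempty hC'
  obtain ⟨p, hp⟩ := exists_isFirst hA (hC'α hA)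
  have hpa := hC'a hp.fst_mem
  rw [attrs_subOrdering hC, Finset.mem_sdiff] at hpa
  -- Otherwise the first attribute `p` of `C'` would belong to `C^O`. A connected set around `p`
  -- either meets `C^O`, and then starts with the operator common to `C^O`, or is contained in `C'`,
  -- where `p` comes first.
  refine hpa.2 (mem_initial_of_firstOp_eq hH hα hC hpa.1 fun S hS hc hpS => ?_)
  rw [(isFirst_singleton hα.1 hp.mem).firstOp]
  by_cases h : ∃ z ∈ S, z ∈ initial D H α C
  · obtain ⟨z, hzS, hz⟩ := h
    have hCα := components_subset hC
    have hCc := components_conn hC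
    rw [firstOp_eq_of_mem_initial hH hα hC hz S hS hc hzS,
      ← firstOp_eq_of_mem_initial hH hα hC hz C hCα hCc (initial_subset hz),
      firstOp_eq_of_mem_initial hH hα hC hx C hCα hCc (initial_subset hx), ← heq, hp.firstOp]
  · push Not at h
    have hSC : S ⊆ C := hc.subset_component hS hC hpS hpa.1
    have hSC' : S ⊆ C' := (hc.to_subHypergraphPlus hC hSC).subset_component
      (fun a ha => by
        rw [attrs_subOrdering hC]; exact Finset.mem_sdiff.2 ⟨hSC ha, h a ha⟩) hC' hpS hp.fst_mem
    exact (hp.mono hSC' hpS).firstOp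

/-- `C' ∪ {x}` is connected and starts with the operator of `x`, while `C'` starts with a different
one. So the first attribute of `C' ∪ {x}` in `β` can only be `x`. -/
theorem precedes_of_mem_initial (hH : Covered H) (hα : IsOrdering H α) (hC : C ∈ components H α)
    (hC' : C' ∈ components (subHypergraphPlus H α C) (subOrdering D H α C)) {x : V}
    (hx : x ∈ initial D H α C) (hxC' : x ∈ plus H C') (hβ : SameFirst H α β)
    (hαβ : attrs α ⊆ attrs β) {A : V} (hA : A ∈ C') : Precedes β x A := by
  have hC'a := components_subset hC'
  have hC'C := hC'a.trans (attrs_subOrdering_subset hC)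
  have hC'α := hC'C.trans (components_subset hC)
  have hxC := initial_subset hx
  have hC'c : Conn H C' := (components_conn hC').of_subHypergraphPlus hC hC'C
  obtain ⟨B, hB, hadj⟩ := mem_plus.1 hxC'
  have hTc : Conn H (insert x C') := hC'c.insert hB hadj
  have hTα : insert x C' ⊆ attrs α := Finset.insert_subset (components_subset hC hxC) hC'α
  have hAT : A ∈ insert x C' := Finset.mem_insert_of_mem hA
  obtain ⟨r, hr⟩ := exists_isFirst hAT (hαβ (hTα hAT))
  have hrx : r.1 = x := by
    by_contra hrx
    have h1 := (hr.mono (Finset.subset_insert _ _)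
      ((Finset.mem_insert.1 hr.fst_mem).resolve_left hrx)).firstOp
    rw [← hβ C' hC'α hC'c] at h1
    have h2 := hr.firstOp
    rw [← hβ _ hTα hTc, firstOp_eq_of_mem_initial hH hα hC hx _ hTα hTc
      (Finset.mem_insert_self _ _)] at h2
    exact firstOp_component_ne hH hα hC hC' hx (h1.trans h2.symm)
  rw [← hrx]
  refine hr.precedes hAT (hαβ (hTα hAT)) fun h => ?_
  have := hC'a hA
  rw [attrs_subOrdering hC, Finset.mem_sdiff, ← h, hrx] at this
  exact this.2 hx

end Initial

/-! ### Connected sets of nodes in a tree -/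

section Graph

variable {N : Type*} {G : SimpleGraph N} {S T : Set N}

theorem reachable_induce_iff {a b : S} :
    (G.induce S).Reachable a b ↔ ReflTransGen (RelOn G.Adj S) (a : N) b := by
  rw [SimpleGraph.reachable_iff_reflTransGen]
  constructor
  · intro h
    induction h with
    | refl => exact .refl
    | tail _ h ih => exact ih.tail ⟨Subtype.coe_prop _, Subtype.coe_prop _, h⟩
  · obtain ⟨b, hb⟩ := b
    intro h
    change ReflTransGen _ _ b at h
    induction h with
    | refl => exact .refl
    | tail _ h ih => exact (ih h.1).tail h.2.2

theorem preconnected_induce_iff_connOn : (G.induce S).Preconnected ↔ ConnOn G.Adj S := by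
  constructor
  · intro h a ha b hb
    exact reachable_induce_iff.1 (h ⟨a, ha⟩ ⟨b, hb⟩)
  · rintro h ⟨a, ha⟩ ⟨b, hb⟩
    exact reachable_induce_iff.2 (h a ha b hb)

theorem connOn_univ_of_connected (h : G.Connected) : ConnOn G.Adj Set.univ := by
  intro a _ b _
  refine ReflTransGen.mono (fun _ _ h => ⟨trivial, trivial, h⟩) _ _
    ((SimpleGraph.reachable_iff_reflTransGen a b).1 (h.preconnected a b))

theorem exists_path_of_reflTransGen {a b : N} (ha : a ∈ S)
    (h : ReflTransGen (RelOn G.Adj S) a b) :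
    ∃ p : G.Walk a b, p.IsPath ∧ ∀ x ∈ p.support, x ∈ S := by
  classical
  suffices ∃ p : G.Walk a b, ∀ x ∈ p.support, x ∈ S by
    obtain ⟨p, hp⟩ := this
    exact ⟨p.bypass, p.bypass_isPath, fun x hx => hp x (p.support_bypass_subset_support hx)⟩
  induction h with
  | refl => exact ⟨.nil, by simpa using ha⟩
  | tail _ h ih =>
    obtain ⟨p, hp⟩ := ih
    refine ⟨p.concat h.2.2, fun x hx => ?_⟩
    rw [SimpleGraph.Walk.support_concat, List.mem_append, List.mem_singleton] at hx
    rcases hx with hx | rfl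
    · exact hp x hx
    · exact h.2.1

theorem ConnOn.exists_path (hS : ConnOn G.Adj S) {a b : N} (ha : a ∈ S) (hb : b ∈ S) :
    ∃ p : G.Walk a b, p.IsPath ∧ ∀ x ∈ p.support, x ∈ S :=
  exists_path_of_reflTransGen ha (hS a ha b hb)

theorem reflTransGen_of_walk {a b : N} (p : G.Walk a b) (hp : ∀ x ∈ p.support, x ∈ S) :
    ReflTransGen (RelOn G.Adj S) a b := by
  induction p with
  | nil => exact .refl
  | cons h p ih =>
    refine ReflTransGen.head ⟨hp _ (by simp), hp _ (by simp), h⟩ (ih fun x hx => hp x ?_)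
    exact List.mem_cons_of_mem _ hx

theorem path_eq (hG : G.IsAcyclic) {a b : N} {p q : G.Walk a b} (hp : p.IsPath) (hq : q.IsPath) :
    p = q :=
  congrArg Subtype.val ((hG.subsingleton_path a b).elim (⟨p, hp⟩ : G.Path a b) ⟨q, hq⟩)

theorem path_support_subset (hG : G.IsAcyclic) (hS : ConnOn G.Adj S) {a b : N} (ha : a ∈ S)
    (hb : b ∈ S) {p : G.Walk a b} (hp : p.IsPath) : ∀ x ∈ p.support, x ∈ S := by
  obtain ⟨q, hq, hqS⟩ := hS.exists_path ha hb
  have : p = q := path_eq hG hp hq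
  rwa [this]

theorem ConnOn.inter (hG : G.IsAcyclic) (hS : ConnOn G.Adj S) (hT : ConnOn G.Adj T) :
    ConnOn G.Adj (S ∩ T) := by
  intro a ha b hb
  obtain ⟨p, hp, hpS⟩ := hS.exists_path ha.1 hb.1
  exact reflTransGen_of_walk p fun x hx =>
    ⟨hpS x hx, path_support_subset hG hT ha.2 hb.2 hp x hx⟩

/-- In a forest two disjoint connected sets are joined by at most one edge. -/
theorem crossing_unique (hG : G.IsAcyclic) (hS : ConnOn G.Adj S) (hT : ConnOn G.Adj T)
    (hd : ∀ x ∈ S, x ∉ T) {a b a' b' : N} (ha : a ∈ S) (hb : b ∈ T) (ha' : a' ∈ S)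
    (hb' : b' ∈ T) (h : G.Adj a b) (h' : G.Adj a' b') : a = a' ∧ b = b' := by
  obtain ⟨p, hp, hpS⟩ := hS.exists_path ha ha'
  obtain ⟨q, hq, hqT⟩ := hT.exists_path hb hb'
  -- Two paths from `a` to `b'`: one crosses at once and continues in `T`, the other stays in `S`
  -- and crosses at the end. In a forest they coincide.
  have hq' : (q.cons h).IsPath :=
    (SimpleGraph.Walk.cons_isPath_iff h q).2 ⟨hq, fun hh => hd a ha (hqT a hh)⟩
  have hp' : (p.concat h').IsPath := hp.concat (fun hh => hd b' (hpS b' hh) hb') h'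
  have heq : q.cons h = p.concat h' := path_eq hG hq' hp'
  have hs : a :: q.support = p.support ++ [b'] := by
    rw [← SimpleGraph.Walk.support_concat p h', ← heq, SimpleGraph.Walk.support_cons]
  constructor
  · have : a' ∈ a :: q.support := by
      rw [hs, List.mem_append]; exact .inl p.end_mem_support
    rcases List.mem_cons.1 this with h | h
    · exact h.symm
    · exact absurd (hqT a' h) (hd a' ha')
  · have : b ∈ p.support ++ [b'] := by
      rw [← hs]; exact List.mem_cons_of_mem _ q.start_mem_support
    rcases List.mem_append.1 this with h | h
    · exact absurd hb (hd b (hpS b h))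
    · exact List.mem_singleton.1 h

end Graph

/-! ### Ancestors -/

section Ancestor

variable {V : Type u} {G : BagGraph V}

theorem BagGraph.AncestorOrEq.trans {s t u : G.Node} (h : G.AncestorOrEq s t)
    (h' : G.AncestorOrEq t u) : G.AncestorOrEq s u := by
  classical
  intro p
  exact p.support_takeUntil_subset_support (h' p) (h (p.takeUntil t (h' p)))

theorem BagGraph.AncestorOrEq.dist_lt (hG : G.graph.Connected) {s t : G.Node}
    (h : G.AncestorOrEq s t) (hne : s ≠ t) :
    G.graph.dist G.root s < G.graph.dist G.root t := by
  classical
  obtain ⟨p, hp⟩ := hG.exists_walk_length_eq_dist G.root t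
  rw [← hp]
  exact (SimpleGraph.dist_le _).trans_lt (SimpleGraph.Walk.length_takeUntil_lt_length (h p) hne)

theorem BagGraph.AncestorOrEq.antisymm (hG : G.graph.Connected) {s t : G.Node}
    (h : G.AncestorOrEq s t) (h' : G.AncestorOrEq t s) : s = t := by
  by_contra hne
  exact absurd (h.dist_lt hG hne) (h'.dist_lt hG (Ne.symm hne)).le.not_gt

theorem ancestorOrEq_of_mem_path (hG : G.graph.IsAcyclic) {s t : G.Node}
    {p : G.graph.Walk G.root t} (hp : p.IsPath) (hs : s ∈ p.support) : G.AncestorOrEq s t := by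
  classical
  intro q
  have : q.bypass = p := path_eq hG q.bypass_isPath hp
  exact q.support_bypass_subset_support (this ▸ hs)

/-- A nonempty connected set of nodes has a topmost node. -/
theorem exists_top (hG : G.graph.IsTree) {U : Set G.Node} (hU : ConnOn G.graph.Adj U)
    (hne : U.Nonempty) : ∃ u ∈ U, ∀ v ∈ U, G.AncestorOrEq u v := by
  classical
  -- A walk towards `U` is stopped at the first node `u` of `U` it reaches. Continued inside `U` to
  -- any `v`, it gives the unique path from the root to `v`, so `u` is above `v`.
  have key : ∀ {a b : G.Node} (p : G.graph.Walk a b), b ∈ U →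
      ∃ u ∈ U, ∃ q : G.graph.Walk a u, ∀ x ∈ q.support, x ∈ U → x = u := by
    intro a b p
    induction p with
    | nil => exact fun h => ⟨_, h, .nil, by simp⟩
    | @cons a c b h p ih =>
      intro hb
      by_cases ha : a ∈ U
      · exact ⟨a, ha, .nil, by simp⟩
      · obtain ⟨u, hu, q, hq⟩ := ih hb
        refine ⟨u, hu, q.cons h, fun x hx hxU => ?_⟩
        rw [SimpleGraph.Walk.support_cons, List.mem_cons] at hx
        rcases hx with rfl | hx
        · exact absurd hxU ha
        · exact hq x hx hxU
  obtain ⟨b, hb⟩ := hne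
  obtain ⟨p⟩ := hG.connected.preconnected G.root b
  obtain ⟨u, hu, q, hq⟩ := key p hb
  refine ⟨u, hu, fun v hv => ?_⟩
  obtain ⟨w, hw, hwU⟩ := hU.exists_path hu hv
  have hq' : ∀ x ∈ q.bypass.support, x ∈ U → x = u := fun x hx =>
    hq x (q.support_bypass_subset_support hx)
  have hpath : (q.bypass.append w).IsPath := by
    rw [SimpleGraph.Walk.isPath_def, SimpleGraph.Walk.support_append]
    refine List.Nodup.append q.bypass_isPath.support_nodup
      (hw.support_nodup.sublist (List.tail_sublist _)) ?_
    intro x hx hx'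
    have hxu := hq' x hx (hwU x (List.mem_of_mem_tail hx'))
    subst hxu
    have := hw.support_nodup
    rw [← SimpleGraph.Walk.cons_tail_support, List.nodup_cons] at this
    exact this.1 hx'
  refine ancestorOrEq_of_mem_path hG.isAcyclic hpath ?_
  rw [SimpleGraph.Walk.mem_support_append_iff]
  exact .inl q.bypass.end_mem_support

/-- Go down to `a`, then inside `U` to `v`: this walk passes through `u`, and on its first part `u`
can only be `a` itself. -/
theorem mem_of_between (hG : G.graph.IsTree) {U : Set G.Node} (hU : ConnOn G.graph.Adj U)
    {a u v : G.Node} (ha : a ∈ U) (hv : v ∈ U) (hau : G.AncestorOrEq a u)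
    (huv : G.AncestorOrEq u v) : u ∈ U := by
  classical
  obtain ⟨q, -, hqU⟩ := hU.exists_path ha hv
  obtain ⟨p⟩ := hG.connected.preconnected G.root a
  rcases (SimpleGraph.Walk.mem_support_append_iff _ _).1 (huv (p.bypass.append q)) with h | h
  · rw [← hau.antisymm hG.connected (ancestorOrEq_of_mem_path hG.isAcyclic p.bypass_isPath h)]
    exact ha
  · exact hqU u h

theorem mem_of_ancestorOrEq_of_root_mem {T : Set G.Node} (hT : ConnOn G.graph.Adj T)
    (hr : G.root ∈ T) {u t : G.Node} (ht : t ∈ T) (h : G.AncestorOrEq u t) : u ∈ T := by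
  obtain ⟨p, -, hp⟩ := hT.exists_path hr ht
  exact hp u (h p)

/-! ### Branches -/

theorem isBranch_iff {T₀ S : Set G.Node} : G.IsBranch T₀ S ↔
    S.Nonempty ∧ (∀ t ∈ S, t ∉ T₀) ∧ ConnOn G.graph.Adj S ∧
      ∀ a ∈ S, ∀ b, b ∉ T₀ → G.graph.Adj a b → b ∈ S := by
  have hmk : ∀ x : (T₀ᶜ : Set G.Node),
      Subtype.val '' ((G.graph.induce T₀ᶜ).connectedComponentMk x).supp =
        {b | ReflTransGen (RelOn G.graph.Adj T₀ᶜ) (x : G.Node) b} := by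
    intro x
    ext b
    constructor
    · rintro ⟨y, hy, rfl⟩
      exact reachable_induce_iff.1 (SimpleGraph.ConnectedComponent.exact hy).symm
    · intro hb
      have hbT : b ∈ T₀ᶜ := reflTransGen_relOn_mem x.2 hb
      exact ⟨⟨b, hbT⟩, SimpleGraph.ConnectedComponent.sound
        (SimpleGraph.Reachable.symm (reachable_induce_iff.2
          (show ReflTransGen (RelOn G.graph.Adj T₀ᶜ) (x : G.Node) (⟨b, hbT⟩ : (T₀ᶜ : Set G.Node))
            from hb))), rfl⟩
  have hsymm : ∀ a b, G.graph.Adj a b → G.graph.Adj b a := fun _ _ h => h.symm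
  constructor
  · rintro ⟨c, rfl⟩
    induction c using SimpleGraph.ConnectedComponent.ind with
    | h x =>
      rw [hmk]
      refine ⟨⟨x, .refl⟩, fun t ht => reflTransGen_relOn_mem (S := T₀ᶜ) x.2 ht,
        connOn_reachable hsymm, fun a ha b hb hab => ReflTransGen.tail ha ⟨?_, hb, hab⟩⟩
      exact reflTransGen_relOn_mem x.2 ha
  · rintro ⟨⟨a, ha⟩, hd, hc, hcl⟩
    refine ⟨(G.graph.induce T₀ᶜ).connectedComponentMk ⟨a, hd a ha⟩, ?_⟩
    rw [hmk]
    refine Set.Subset.antisymm (fun b hb => reflTransGen_relOn_mono hd (hc a ha b hb)) ?_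
    intro b hb
    change ReflTransGen _ a b at hb
    induction hb with
    | refl => exact ha
    | tail _ h ih => exact hcl _ ih _ h.2.1 h.2.2

theorem isRootedSubtree_iff {T₀ : Set G.Node} :
    G.IsRootedSubtree T₀ ↔ G.root ∈ T₀ ∧ ConnOn G.graph.Adj T₀ := by
  refine and_congr_right fun hr => ?_
  rw [← preconnected_induce_iff_connOn]
  exact ⟨fun h => h.preconnected, fun h => @SimpleGraph.Connected.mk _ _ h ⟨⟨_, hr⟩⟩⟩

theorem connOn_restrict {S : Set G.Node} {r : S} {U : Set S} :
    ConnOn (G.restrict S r).graph.Adj U ↔ ConnOn G.graph.Adj (Subtype.val '' U) := by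
  constructor
  · rintro h _ ⟨a, ha, rfl⟩ _ ⟨b, hb, rfl⟩
    have := h a ha b hb
    induction this with
    | refl => exact .refl
    | tail _ h' ih => exact (ih h'.1).tail ⟨⟨_, h'.1, rfl⟩, ⟨_, h'.2.1, rfl⟩, h'.2.2⟩
  · rintro h ⟨a, haS⟩ ha ⟨b, hbS⟩ hb
    have key : ∀ c : G.Node, ReflTransGen (RelOn G.graph.Adj (Subtype.val '' U)) a c →
        ∃ hc : c ∈ S, ReflTransGen (RelOn (G.restrict S r).graph.Adj U) ⟨a, haS⟩ ⟨c, hc⟩ := by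
      intro c hc
      induction hc with
      | refl => exact ⟨haS, .refl⟩
      | tail _ h' ih =>
        obtain ⟨hc, ih⟩ := ih
        obtain ⟨⟨x, hx, rfl⟩, ⟨y, hy, rfl⟩, hadj⟩ := h'
        exact ⟨y.2, ih.tail ⟨hx, hy, hadj⟩⟩
    exact (key b (h a ⟨⟨a, haS⟩, ha, rfl⟩ b ⟨⟨b, hbS⟩, hb, rfl⟩)).2

/-- The nodes whose bags contain `A`. -/
def BagGraph.nodes (G : BagGraph V) (A : V) : Set G.Node := {t | A ∈ G.bag t}

theorem IsGHD.connOn_nodes {H : Hypergraph V} (h : IsGHD H G) {A : V} (hA : A ∈ H.verts) :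
    ConnOn G.graph.Adj (G.nodes A) :=
  preconnected_induce_iff_connOn.1 (h.running_intersection A hA)

/-- The nodes whose bags meet a connected set of attributes form a connected set. -/
theorem connOn_nodes_of_conn {H : Hypergraph V}
    (hcov : ∀ F ∈ H.edges, ∃ t, F ⊆ G.bag t)
    (hrun : ∀ A ∈ H.verts, ConnOn G.graph.Adj (G.nodes A)) {S : Finset V} (hS : Conn H S)
    (hSH : S ⊆ H.verts) : ConnOn G.graph.Adj {t | ∃ A ∈ S, A ∈ G.bag t} := by
  rintro s ⟨A, hA, hs⟩ t ⟨B, hB, ht⟩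
  have hsub : ∀ A ∈ S, G.nodes A ⊆ {t | ∃ A ∈ S, A ∈ G.bag t} := fun A hA t ht => ⟨A, hA, ht⟩
  have key : ∀ C, ReflTransGen (RelOn H.Adj (S : Set V)) A C → ∀ t, C ∈ G.bag t →
      ReflTransGen (RelOn G.graph.Adj {t | ∃ A ∈ S, A ∈ G.bag t}) s t := by
    intro C hC
    induction hC with
    | refl =>
      intro t ht
      exact reflTransGen_relOn_mono (hsub A hA) (hrun A (hSH hA) s hs t ht)
    | tail _ h ih =>
      intro t ht
      obtain ⟨hX, hY, F, hF, hXF, hYF⟩ := h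
      obtain ⟨n, hn⟩ := hcov F hF
      exact (ih n (hn hXF)).trans
        (reflTransGen_relOn_mono (hsub _ hY) (hrun _ (hSH hY) n (hn hYF) t ht))
  exact key B (hS A hA B hB) t ht

end Ancestor

/-! ### Decomposable GHDs are valid -/

section Decomposable

variable {V : Type u} [DecidableEq V] {K : Type v} [CommMonoidWithZero K] {D : V → Type w}
  {H : Hypergraph V} {α β : List (V × AggOp K)} {C C' : Finset V} {G : BagGraph V}

variable (D) in
/-- The parts of a decomposable GHD: the top part `T₀`, and for each component `C` the branch
`S C`, its root `r C` and the neighbour `p C` of `r C` in `T₀`. -/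
structure IsBranching (H : Hypergraph V) (α : List (V × AggOp K)) (G : BagGraph V)
    (T₀ : Set G.Node) (S : Finset V → Set G.Node) (r p : Finset V → G.Node) : Prop where
  isGHD : IsGHD H G
  root_mem : G.root ∈ T₀
  conn : ConnOn G.graph.Adj T₀
  outputs_iff : ∀ A, (∃ t ∈ T₀, A ∈ G.bag t) ↔ A ∈ outputs H α
  branch : ∀ C ∈ components H α, G.IsBranch T₀ (S C)
  p_mem : ∀ C ∈ components H α, p C ∈ T₀
  adj : ∀ C ∈ components H α, G.graph.Adj (p C) (r C)
  dec : ∀ C ∈ components H α, ∃ hr : r C ∈ S C,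
    IsDecomposable D (subHypergraph H C) (subOrdering D H α C) (G.restrict (S C) ⟨r C, hr⟩)

theorem IsDecomposable.isGHD (h : IsDecomposable D H α G) : IsGHD H G := by
  rw [IsDecomposable] at h
  exact h.1

theorem IsDecomposable.exists_branching (h : IsDecomposable D H α G) :
    ∃ T₀ S r p, IsBranching D H α G T₀ S r p := by
  rw [IsDecomposable] at h
  obtain ⟨hG, T₀, hT₀, hout, hS⟩ := h
  have : ∀ C, C ∈ components H α → ∃ (S : Set G.Node) (r p : G.Node), G.IsBranch T₀ S ∧ p ∈ T₀ ∧
      G.graph.Adj p r ∧ ∃ hr : r ∈ S, IsDecomposable D (subHypergraph H C)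
        (subOrdering D H α C) (G.restrict S ⟨r, hr⟩) := by
    intro C hC
    obtain ⟨S, ⟨hb, r, ⟨p, hp, hadj⟩, hd⟩, -⟩ := hS C hC
    exact ⟨S, r, p, hb, hp, hadj, r.2, hd⟩
  have hne : Nonempty G.Node := ⟨G.root⟩
  choose! S r p h1 h2 h3 h4 using this
  obtain ⟨hr, hc⟩ := isRootedSubtree_iff.1 hT₀
  exact ⟨T₀, S, r, p, hG, hr, hc, hout, h1, h2, h3, h4⟩

namespace IsBranching

variable {T₀ : Set G.Node} {S : Finset V → Set G.Node} {r p : Finset V → G.Node}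

theorem r_mem (b : IsBranching D H α G T₀ S r p) (hC : C ∈ components H α) : r C ∈ S C :=
  (b.dec C hC).1

theorem notMem_top (b : IsBranching D H α G T₀ S r p) (hC : C ∈ components H α) {t : G.Node}
    (ht : t ∈ S C) : t ∉ T₀ := (isBranch_iff.1 (b.branch C hC)).2.1 t ht

theorem connOn_branch (b : IsBranching D H α G T₀ S r p) (hC : C ∈ components H α) :
    ConnOn G.graph.Adj (S C) := (isBranch_iff.1 (b.branch C hC)).2.2.1

theorem mem_of_adj (b : IsBranching D H α G T₀ S r p) (hC : C ∈ components H α) {s t : G.Node}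
    (hs : s ∈ S C) (ht : t ∉ T₀) (h : G.graph.Adj s t) : t ∈ S C :=
  (isBranch_iff.1 (b.branch C hC)).2.2.2 s hs t ht h

theorem bag_subset_plus (b : IsBranching D H α G T₀ S r p) (hC : C ∈ components H α)
    {t : G.Node} (ht : t ∈ S C) : G.bag t ⊆ plus H C := by
  obtain ⟨hr, hd⟩ := b.dec C hC
  exact hd.isGHD.bag_subset ⟨t, ht⟩

theorem exists_mem_bag (b : IsBranching D H α G T₀ S r p) (hC : C ∈ components H α) {A : V}
    (hA : A ∈ plus H C) : ∃ t ∈ S C, A ∈ G.bag t := by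
  obtain ⟨hr, hd⟩ := b.dec C hC
  obtain ⟨F, hF, hAF⟩ := covered_subHypergraph (H := H) (C := C) A hA
  obtain ⟨t, ht⟩ := hd.isGHD.covers F hF
  exact ⟨t.1, t.2, ht hAF⟩

/-- The nodes of `A` form a connected set that meets `S C` and avoids `T₀`, whose bags contain
outputs only; a branch can be left only through `T₀`. -/
theorem mem_branch (b : IsBranching D H α G T₀ S r p) (hH : Covered H) (hα : IsOrdering H α)
    (hC : C ∈ components H α) {A : V} (hA : A ∈ C) {t : G.Node} (ht : A ∈ G.bag t) :
    t ∈ S C := by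
  have hAα := components_subset hC hA
  obtain ⟨s, hs, hAs⟩ := b.exists_mem_bag hC (subset_plus hH ((components_subset hC).trans hα.2) hA)
  by_contra htS
  obtain ⟨c, hc, d, hd, hcS, hdS, hcd⟩ :=
    (b.isGHD.connOn_nodes (hα.2 hAα)).exists_crossing (Y := S C) hAs hs ht htS
  refine hdS (b.mem_of_adj hC hcS (fun hdT => ?_) hcd)
  exact (mem_outputs.1 ((b.outputs_iff A).1 ⟨d, hdT, hd⟩)).2 hAα

theorem branch_unique (b : IsBranching D H α G T₀ S r p) (hH : Covered H) (hα : IsOrdering H α)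
    (hC : C ∈ components H α) (hC' : C' ∈ components H α) {t : G.Node} (ht : t ∈ S C)
    (ht' : t ∈ S C') : C = C' := by
  obtain ⟨A, hA⟩ := components_nonempty hC
  obtain ⟨s, hs, hAs⟩ := b.exists_mem_bag hC (subset_plus hH ((components_subset hC).trans hα.2) hA)
  have hsS' : s ∈ S C' := by
    by_contra hsS'
    obtain ⟨c, hc, d, hd, hcS, hdS, hcd⟩ :=
      (b.connOn_branch hC).exists_crossing (Y := S C') ht ht' hs hsS'
    exact hdS (b.mem_of_adj hC' hcS (b.notMem_top hC hd) hcd)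
  exact component_unique hC hC' hA
    (mem_component_of_mem_plus hC' (b.bag_subset_plus hC' hsS' hAs) (components_subset hC hA))

/-- The nodes of `A` occur in `T₀` and in the branch, hence pass over from one to the other, and the
edge from `p C` to `r C` is the only crossing. -/
theorem mem_bag_of_mem_outputs (b : IsBranching D H α G T₀ S r p) (hC : C ∈ components H α)
    {A : V} (hA : A ∈ outputs H α) (hAC : A ∈ plus H C) :
    A ∈ G.bag (p C) ∧ A ∈ G.bag (r C) := by
  obtain ⟨s, hs, hAs⟩ := b.exists_mem_bag hC hAC
  obtain ⟨t, ht, hAt⟩ := (b.outputs_iff A).2 hA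
  obtain ⟨c, hc, d, hd, hcS, hdS, hcd⟩ :=
    (b.isGHD.connOn_nodes (plus_subset hAC)).exists_crossing (Y := S C) hAs hs hAt
      (fun h => b.notMem_top hC h ht)
  have hdT : d ∈ T₀ := by
    by_contra hdT
    exact hdS (b.mem_of_adj hC hcS hdT hcd)
  obtain ⟨rfl, rfl⟩ := crossing_unique b.isGHD.isTree.isAcyclic (b.connOn_branch hC) b.conn
    (fun x => b.notMem_top hC) hcS hdT (b.r_mem hC) (b.p_mem C hC) hcd (b.adj C hC).symm
  exact ⟨hd, hc⟩

/-- A walk inside the branch is prolonged to one from the root of `G` by a walk through `T₀` and the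
edge to `r C`; `u` does not lie in `T₀`. -/
theorem ancestorOrEq_restrict (b : IsBranching D H α G T₀ S r p) (hC : C ∈ components H α)
    {u v : S C} (h : G.AncestorOrEq u v) :
    (G.restrict (S C) ⟨r C, b.r_mem hC⟩).AncestorOrEq u v := by
  intro q
  obtain ⟨w, -, hw⟩ := b.conn.exists_path b.root_mem (b.p_mem C hC)
  let f : G.graph.induce (S C) →g G.graph := (SimpleGraph.Embedding.induce (S C)).toHom
  have hq : ∀ {a c : S C} (q : (G.graph.induce (S C)).Walk a c), (u : G.Node) ∈
      (q.map f).support → u ∈ q.support := by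
    intro a c q hu
    rw [SimpleGraph.Walk.support_map, List.mem_map] at hu
    obtain ⟨y, hy, hyu⟩ := hu
    rwa [← Subtype.ext hyu]
  refine hq q ?_
  have := h ((w.concat (b.adj C hC)).append (SimpleGraph.Walk.map f q))
  rcases (SimpleGraph.Walk.mem_support_append_iff _ _).1 this with h' | h'
  · rw [SimpleGraph.Walk.support_concat, List.mem_append, List.mem_singleton] at h'
    rcases h' with h' | h'
    · exact absurd (hw _ h') (b.notMem_top hC u.2)
    · rw [h']
      exact SimpleGraph.Walk.start_mem_support _
  · exact h'

end IsBranching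

/-- In a decomposable GHD an attribute at the top of a connected set of attributes has the first
operator of the set. -/
theorem IsDecomposable.firstOp_eq_of_top [∀ A, Nontrivial (D A)] :
    ∀ (n : ℕ) {H : Hypergraph V} {α : List (V × AggOp K)} {G : BagGraph V}, α.length = n →
    Covered H → IsOrdering H α → IsDecomposable D H α G →
    ∀ S ⊆ attrs α, Conn H S → ∀ w ∈ S, ∀ u, w ∈ G.bag u →
    (∀ A ∈ S, ∀ v, A ∈ G.bag v → G.AncestorOrEq u v) → firstOp α S = firstOp α {w} := by
  intro n
  induction n using Nat.strong_induction_on with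
  | _ n ih =>
  intro H α G hn hH hα hG X hXα hX w hw u hwu htop
  obtain ⟨T₀, S, r, p, b⟩ := hG.exists_branching
  obtain ⟨C, hC, hwC⟩ := exists_component H (hXα hw)
  have hXC : X ⊆ C := hX.subset_component hXα hC hw hwC
  have hCH := (components_subset hC).trans hα.2
  have huS : u ∈ S C := b.mem_branch hH hα hC hwC hwu
  obtain ⟨hr, hd⟩ := b.dec C hC
  by_cases hz : ∃ z ∈ X, z ∈ initial D H α C
  · obtain ⟨z, hzX, hz⟩ := hz
    refine firstOp_eq_of_mem_initial (D := D) hH hα hC ?_ X hXα hX hw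
    -- `z ∈ C^O` is an output of the smaller query and so occurs in its top part `T₁`. The node `u`
    -- lies above that occurrence, hence in `T₁` as well, and `w` too must belong to `C^O`.
    obtain ⟨T₁, S₁, r₁, p₁, b₁⟩ := hd.exists_branching
    have hzo : z ∈ outputs (subHypergraph H C) (subOrdering D H α C) :=
      (mem_outputs_subOrdering (D := D) hC (subset_plus hH hCH (hXC hzX))).2 (.inr hz)
    obtain ⟨t, ht, hzt⟩ := (b₁.outputs_iff z).2 hzo
    have hut : (G.restrict (S C) ⟨r C, hr⟩).AncestorOrEq ⟨u, huS⟩ t :=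
      b.ancestorOrEq_restrict hC (u := ⟨u, huS⟩) (v := t) (htop z hzX _ hzt)
    have huT := mem_of_ancestorOrEq_of_root_mem b₁.conn b₁.root_mem ht hut
    rcases (mem_outputs_subOrdering (D := D) hC (subset_plus hH hCH hwC)).1
      ((b₁.outputs_iff w).1 ⟨_, huT, hwu⟩) with h | h
    · exact absurd (hXα hw) (mem_outputs.1 h).2
    · exact h
  · push Not at hz
    have hXα' : X ⊆ attrs (subOrdering D H α C) := fun a ha => by
      rw [attrs_subOrdering hC]; exact Finset.mem_sdiff.2 ⟨hXC ha, hz a ha⟩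
    have := ih _ (hn ▸ length_subOrdering_lt D H α C hC) rfl covered_subHypergraph
      (isOrdering_subHypergraph hH hα hC) hd X hXα' (hX.to_subHypergraph hXC) w hw ⟨u, huS⟩ hwu
      (fun A hA v hAv => b.ancestorOrEq_restrict hC (u := ⟨u, huS⟩) (v := v) (htop A hA _ hAv))
    rwa [firstOp_subOrdering hC hXα', firstOp_subOrdering hC
      (Finset.singleton_subset_iff.2 (hXα' hw))] at this

/-- The distance from the root to the nodes whose bags contain `A`. -/
noncomputable def BagGraph.depth (G : BagGraph V) (A : V) : ℕ :=
  sInf {n | ∃ t, A ∈ G.bag t ∧ G.graph.dist G.root t = n}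

theorem BagGraph.depth_le {A : V} {t : G.Node} (h : A ∈ G.bag t) :
    G.depth A ≤ G.graph.dist G.root t := Nat.sInf_le ⟨t, h, rfl⟩

theorem BagGraph.exists_dist_eq_depth {A : V} {t : G.Node} (h : A ∈ G.bag t) :
    ∃ s, A ∈ G.bag s ∧ G.graph.dist G.root s = G.depth A := 
  Nat.sInf_mem (s := {n | ∃ t, A ∈ G.bag t ∧ G.graph.dist G.root t = n}) ⟨_, t, h, rfl⟩

theorem exists_mem_bag {A : V} (hH : Covered H) (hG : IsGHD H G) (hA : A ∈ H.verts) :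
    ∃ t, A ∈ G.bag t := by
  obtain ⟨F, hF, hAF⟩ := hH A hA
  obtain ⟨t, ht⟩ := hG.covers F hF
  exact ⟨t, ht hAF⟩

open Classical in
/-- The ordering sorted by depth. -/
noncomputable def sortByDepth (G : BagGraph V) (α : List (V × AggOp K)) : List (V × AggOp K) :=
  α.insertionSort fun p q => G.depth p.1 ≤ G.depth q.1

theorem sortByDepth_perm : (sortByDepth G α).Perm α := List.perm_insertionSort _ _

theorem depth_le_of_isFirst_sortByDepth {X : Finset V} {p : V × AggOp K}
    (hp : IsFirst (sortByDepth G α) X p) {A : V} (hA : A ∈ X) (hAα : A ∈ attrs α) :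
    G.depth p.1 ≤ G.depth A := by
  classical
  have hsort : (sortByDepth G α).Pairwise fun p q => G.depth p.1 ≤ G.depth q.1 := by
    have : Std.Total fun p q : V × AggOp K => G.depth p.1 ≤ G.depth q.1 :=
      ⟨fun _ _ => le_total _ _⟩
    have : IsTrans (V × AggOp K) fun p q => G.depth p.1 ≤ G.depth q.1 :=
      ⟨fun _ _ _ => le_trans⟩
    exact List.pairwise_insertionSort _ _
  rw [← attrs_perm (sortByDepth_perm (G := G))] at hAα
  obtain ⟨o, ho⟩ := mem_attrs.1 hAα
  obtain ⟨l₁, l₂, hl, -, hl₁⟩ := hp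
  rw [hl] at hsort ho
  rcases List.mem_append.1 ho with h | h
  · exact absurd hA (hl₁ _ h)
  · rcases List.mem_cons.1 h with rfl | h
    · exact le_rfl
    · exact List.rel_of_pairwise_cons (List.pairwise_append.1 hsort).2.1 h

/-- The ordering sorted by depth is the witness. The attribute of `X` that comes first there has its
top at the topmost node meeting `X`, so its operator is the first operator of `X` in `α` as well. -/
theorem IsDecomposable.isValid [∀ A, Nontrivial (D A)] (hH : Covered H) (hα : IsOrdering H α)
    (hG : IsDecomposable D H α G) : IsValid D H α G := by
  have hGHD := hG.isGHD
  have hconn := hGHD.isTree.connected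
  have hperm : (sortByDepth G α).Perm α := sortByDepth_perm
  have hattrs := attrs_perm hperm
  refine ⟨hGHD, sortByDepth G α, equivalent_of_sameFirst hH hα hperm ?_, ?_⟩
  · intro X hXα hX
    rcases X.eq_empty_or_nonempty with rfl | ⟨a, ha⟩
    · rw [firstOp_empty, firstOp_empty]
    obtain ⟨p, hp⟩ := exists_isFirst (α := sortByDepth G α) ha (by rw [hattrs]; exact hXα ha)
    have hpα : p ∈ α := hperm.mem_iff.1 hp.mem
    rw [hp.firstOp, ← (isFirst_singleton hα.1 hpα).firstOp]
    have hXH := hXα.trans hα.2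
    obtain ⟨t, ht⟩ := exists_mem_bag hH hGHD (hXH ha)
    obtain ⟨u, ⟨A, hA, hAu⟩, htop⟩ := exists_top hGHD.isTree
      (connOn_nodes_of_conn hGHD.covers (fun A hA => hGHD.connOn_nodes hA) hX hXH) ⟨t, a, ha, ht⟩
    obtain ⟨s, hs⟩ := exists_mem_bag hH hGHD (hXH hp.fst_mem)
    obtain ⟨s, hs, hds⟩ := BagGraph.exists_dist_eq_depth hs
    have hus : u = s := by
      by_contra hne
      have h1 := (htop s ⟨_, hp.fst_mem, hs⟩).dist_lt hconn hne
      have h2 := depth_le_of_isFirst_sortByDepth hp hA (hXα hA)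
      have h3 := BagGraph.depth_le hAu
      omega
    subst hus
    exact IsDecomposable.firstOp_eq_of_top _ rfl hH hα hG X hXα hX p.1 hp.fst_mem u hs
      fun A hA v hv => htop v ⟨A, hA, hv⟩
  · intro A hA B hB s t hs ht hst
    rw [outputs, hattrs]
    refine or_iff_not_imp_left.2 fun hAo => ?_
    obtain ⟨T₀, S, r, p, b⟩ := hG.exists_branching
    have hAα : A ∈ attrs α := by
      by_contra h
      exact hAo (mem_outputs.2 ⟨hA, h⟩)
    -- The top of an output lies in `T₀`, which is closed under ancestors; so above it there are
    -- only outputs.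
    have hBα : B ∈ attrs α := by
      by_contra h
      obtain ⟨n, hn, hBn⟩ := (b.outputs_iff B).2 (mem_outputs.2 ⟨hB, h⟩)
      have hsT := mem_of_ancestorOrEq_of_root_mem b.conn b.root_mem hn (hst.2.trans (ht.2 n hBn))
      exact hAo ((b.outputs_iff A).1 ⟨s, hsT, hs.1⟩)
    have hlt : G.depth A < G.depth B := by
      obtain ⟨n, hn, hdn⟩ := BagGraph.exists_dist_eq_depth ht.1
      rw [← hdn]
      refine (BagGraph.depth_le hs.1).trans_lt ?_
      refine (hst.2.dist_lt hconn hst.1).trans_le ?_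
      by_cases h : t = n
      · rw [h]
      · exact ((ht.2 n hn).dist_lt hconn h).le
    obtain ⟨q, hq⟩ := exists_isFirst (α := sortByDepth G α) (Finset.mem_insert_self A {B})
      (by rw [hattrs]; exact hAα)
    have hqA : q.1 = A := by
      have := depth_le_of_isFirst_sortByDepth hq (Finset.mem_insert_self A {B}) hAα
      rcases Finset.mem_insert.1 hq.fst_mem with h | h
      · exact h
      · rw [Finset.mem_singleton.1 h] at this
        omega
    rw [← hqA]
    refine hq.precedes (by simp) (by rw [hattrs]; exact hBα) ?_
    rintro rfl
    rw [hqA] at hlt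
    exact lt_irrefl _ hlt

end Decomposable

/-! ### Valid GHDs yield GHDs of the characteristic hypergraphs -/

section Trim

variable {V : Type u} [DecidableEq V] {K : Type v} [CommMonoidWithZero K] {D : V → Type w}
  {H H' : Hypergraph V} {α β : List (V × AggOp K)} {C C' : Finset V} {G : BagGraph V}

/-- The hyperedges of `H` are covered by the tree `G`, whose bags may contain further attributes,
and the tree is compatible with the ordering `β`, which has the same first operators as `α` on the
connected sets of `H`. -/
structure Admissible (H : Hypergraph V) (α β : List (V × AggOp K)) (G : BagGraph V) : Prop where
  covered : Covered H
  isOrdering : IsOrdering H α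
  isTree : G.graph.IsTree
  covers : ∀ F ∈ H.edges, ∃ t, F ⊆ G.bag t
  connOn_nodes : ∀ A ∈ H.verts, ConnOn G.graph.Adj (G.nodes A)
  attrs_subset : attrs α ⊆ attrs β
  sameFirst : SameFirst H α β
  precedes : ∀ A ∈ attrs α, ∀ B ∈ attrs α, ∀ s t, G.IsTop A s → G.IsTop B t →
    G.Ancestor s t → Precedes β A B
  -- At the start this follows from validity. In the smaller queries, where `C^O` has joined the
  -- outputs, it follows from `precedes`.
  not_ancestor : ∀ C ∈ components H α, ∀ A ∈ C, ∀ x ∈ outputs H α, x ∈ plus H C →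
    ∀ s t, G.IsTop A s → G.IsTop x t → ¬ G.Ancestor s t

/-- The topmost node `u` meeting `C` is the top of some `A ∈ C`. An output `x` adjacent to `C`
shares a node with the subtree of `C`, and the top of `x` is not strictly below `u`; hence the
subtree of `x` contains `u`. -/
theorem Admissible.exists_outputs_subset (h : Admissible H α β G) (hC : C ∈ components H α) :
    ∃ t, outputs H α ∩ plus H C ⊆ G.bag t := by
  have hCH := (components_subset hC).trans h.isOrdering.2
  set U : Set G.Node := {t | ∃ A ∈ C, A ∈ G.bag t} with hU
  have hUc : ConnOn G.graph.Adj U :=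
    connOn_nodes_of_conn h.covers h.connOn_nodes (components_conn hC) hCH
  have hUne : U.Nonempty := by
    obtain ⟨A, hA⟩ := components_nonempty hC
    obtain ⟨F, hF, hAF⟩ := h.covered A (hCH hA)
    obtain ⟨t, ht⟩ := h.covers F hF
    exact ⟨t, A, hA, ht hAF⟩
  obtain ⟨u, ⟨A, hA, hAu⟩, hu⟩ := exists_top h.isTree hUc hUne
  refine ⟨u, fun x hx => ?_⟩
  obtain ⟨hxo, hxC⟩ := Finset.mem_inter.1 hx
  obtain ⟨B, hB, F, hF, hBF, hxF⟩ := mem_plus.1 hxC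
  obtain ⟨v, hv⟩ := h.covers F hF
  have hvU : v ∈ U := ⟨B, hB, hv hBF⟩
  have hvx : v ∈ G.nodes x := hv hxF
  have hxc := h.connOn_nodes x (plus_subset hxC)
  obtain ⟨s, hsx, hs⟩ := exists_top h.isTree hxc ⟨v, hvx⟩
  -- The subtrees of `C` and `x` overlap, so their union has a topmost node `u'`. If it belongs to
  -- `C`, then `u` is above the top of `x`, hence equal to it; if it belongs to `x`, then `u` lies
  -- between `u'` and the shared node `v`.
  obtain ⟨u', hu', htop⟩ := exists_top h.isTree
    (ConnOn.union (fun _ _ h => h.symm) hUc hxc hvU hvx (.inl rfl)) ⟨v, .inl hvU⟩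
  have hanc : G.AncestorOrEq u u' → u ∈ G.nodes x := by
    intro huu'
    have hus := huu'.trans (htop s (.inr hsx))
    by_cases hne : u = s
    · rw [hne]; exact hsx
    · exact absurd ⟨hne, hus⟩ (h.not_ancestor C hC A hA x hxo hxC u s
        ⟨hAu, fun t ht => hu t ⟨A, hA, ht⟩⟩ ⟨hsx, hs⟩)
  rcases hu' with hu' | hu'
  · exact hanc (hu u' hu')
  · exact mem_of_between h.isTree hxc hu' hvx (htop u (.inl ⟨A, hA, hAu⟩)) (hu v hvU)

/-- The tree and `β` stay the same. The new hyperedge is covered by the previous lemma, and the new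
outputs, from `C^O`, precede the components they touch. -/
theorem Admissible.sub [∀ A, Nontrivial (D A)] (h : Admissible H α β G)
    (hC : C ∈ components H α) :
    Admissible (subHypergraphPlus H α C) (subOrdering D H α C) β G where
  covered := covered_subHypergraphPlus
  isOrdering := isOrdering_subHypergraphPlus h.covered h.isOrdering hC
  isTree := h.isTree
  covers F hF := by
    rcases mem_edges_subHypergraphPlus.1 hF with rfl | hF
    · exact h.exists_outputs_subset hC
    · exact h.covers F (mem_edgesMeeting.1 hF).1
  connOn_nodes A hA := h.connOn_nodes A (plus_subset hA)
  attrs_subset := ((attrs_subOrdering_subset hC).trans (components_subset hC)).trans h.attrs_subset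
  sameFirst := h.sameFirst.subOrdering hC
  precedes A hA B hB :=
    h.precedes A (components_subset hC (attrs_subOrdering_subset hC hA)) B
      (components_subset hC (attrs_subOrdering_subset hC hB))
  not_ancestor C' hC' A hA x hx hxC' s t hs ht hst := by
    have hC'C := (components_subset hC').trans (attrs_subOrdering_subset hC)
    rw [plus_subHypergraphPlus hC hC'C] at hxC'
    have hxC : x ∈ plus H C := by
      obtain ⟨B, hB, hBx⟩ := mem_plus.1 hxC'
      exact mem_plus.2 ⟨B, hC'C hB, hBx⟩
    rcases (mem_outputs_subOrdering (D := D) hC hxC).1 hx with hx | hx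
    · exact h.not_ancestor C hC A (hC'C hA) x hx hxC s t hs ht hst
    · exact (precedes_of_mem_initial h.covered h.isOrdering hC hC' hx hxC' h.sameFirst
        h.attrs_subset hA).asymm (h.precedes A (components_subset hC (hC'C hA)) x
          (components_subset hC (initial_subset hx)) s t hs ht hst)

theorem Admissible.covers_characteristic [∀ A, Nontrivial (D A)]
    (hH' : IsCharacteristic D H α H') (h : Admissible H α β G) :
    H'.verts ⊆ H.verts ∧ ∀ F ∈ H'.edges, ∃ t, F ⊆ G.bag t := by
  induction hH' with
  | top H α =>
    refine ⟨Finset.sdiff_subset, fun F hF => ?_⟩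
    rcases Finset.mem_union.1 hF with hF | hF
    · exact h.covers F (Finset.mem_filter.1 hF).1
    · obtain ⟨C, hC, rfl⟩ := Finset.mem_image.1 hF
      exact h.exists_outputs_subset hC
  | sub H α C H' hC _ ih =>
    obtain ⟨h1, h2⟩ := ih (h.sub hC)
    exact ⟨h1.trans plus_subset, h2⟩

theorem IsValid.admissible [∀ A, Nontrivial (D A)] (hH : Covered H) (hα : IsOrdering H α)
    (h : IsValid D H α G) : ∃ β, Admissible H α β G := by
  obtain ⟨hG, β, hβ, hcomp⟩ := h
  have hattrs : attrs β = attrs α := attrs_perm hβ.1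
  have hout : outputs H β = outputs H α := by rw [outputs, hattrs]; rfl
  refine ⟨β, hH, hα, hG.isTree, hG.covers, fun A hA => hG.connOn_nodes hA, hattrs.superset,
    hβ.sameFirst hH hα, fun A hA B hB s t hs ht hst => ?_, fun C hC A hA x hx hxC s t hs ht hst => ?_⟩
  · refine (hcomp A (hα.2 hA) B (hα.2 hB) s t hs ht hst).resolve_left fun h => ?_
    rw [hout] at h
    exact (mem_outputs.1 h).2 hA
  · have hAα := components_subset hC hA
    rcases hcomp A (hα.2 hAα) x (plus_subset hxC) s t hs ht hst with h | h
    · rw [hout] at h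
      exact (mem_outputs.1 h).2 hAα
    · have : x ∈ attrs β := List.mem_toFinset.2 h.1
      rw [hattrs] at this
      exact (mem_outputs.1 hx).2 this

/-- The decomposition `G` with all bags cut down to `W`. -/
def BagGraph.trim (G : BagGraph V) (W : Finset V) : BagGraph V where
  Node := G.Node
  graph := G.graph
  bag := fun t => G.bag t ∩ W
  root := G.root

theorem IsValid.isGHD_trim [∀ A, Nontrivial (D A)] (hH : Covered H) (hα : IsOrdering H α)
    (h : IsValid D H α G) (hH' : IsCharacteristic D H α H') : IsGHD H' (G.trim H'.verts) := by
  obtain ⟨β, hadm⟩ := h.admissible hH hα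
  obtain ⟨hverts, hcov⟩ := hadm.covers_characteristic hH'
  refine ⟨h.1.finite, h.1.isTree, fun t => Finset.inter_subset_right, fun F hF => ?_,
    fun A hA => ?_⟩
  · obtain ⟨t, ht⟩ := hcov F hF
    exact ⟨t, Finset.subset_inter ht (H'.edges_subset F hF)⟩
  · have : {t : (G.trim H'.verts).Node | A ∈ (G.trim H'.verts).bag t} = {t | A ∈ G.bag t} := by
      ext t
      exact Finset.mem_inter.trans (and_iff_left hA)
    rw [this]
    exact h.1.running_intersection A (hverts hA)

theorem width_trim_le {γ : Finset V → ℝ} (hγ : NodeMonotone H γ) (hG : IsGHD H G)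
    (W : Finset V) : (G.trim W).width γ ≤ G.width γ := by
  have := hG.finite
  exact ciSup_mono (ι := G.Node) (f := fun t => γ (G.bag t ∩ W)) (g := fun t => γ (G.bag t))
    (Set.finite_range _).bddAbove fun t => hγ _ _ Finset.inter_subset_left (hG.bag_subset t)

end Trim

/-! ### Distinct characteristic hypergraphs -/

section Distinct

variable {V : Type u} [DecidableEq V] {K : Type v} [CommMonoidWithZero K] {D : V → Type w}
  {H H' : Hypergraph V} {α β : List (V × AggOp K)} {C C' : Finset V}

theorem IsCharacteristic.verts_subset (h : IsCharacteristic D H α H') : H'.verts ⊆ H.verts := by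
  induction h with
  | top H α => exact Finset.sdiff_subset
  | sub H α C H' hC _ ih => exact ih.trans plus_subset

theorem exists_mem_verts_topHypergraph [∀ A, Nontrivial (D A)] (hH : Covered H)
    (hα : IsOrdering H α) (hC : C ∈ components H α) :
    ∃ A ∈ C, A ∈ (topHypergraph (subHypergraphPlus H α C) (subOrdering D H α C)).verts := by
  obtain ⟨A, hA⟩ := initial_nonempty (D := D) hH hα hC
  have hAC := initial_subset hA
  exact ⟨A, hAC, (mem_outputs_subOrdering (D := D) hC
    (subset_plus hH ((components_subset hC).trans hα.2) hAC)).2 (.inr hA)⟩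

/-- `H(H, α)` is a set, so a hypergraph that arose at two places of the recursion would receive just
one GHD. This cannot happen: those arising from `C` contain an attribute of `C`, the hypergraph
`H_0` contains none, and `C` can be recovered from that attribute. -/
theorem IsCharacteristic.eq_top_or_exists_mem [∀ A, Nontrivial (D A)]
    (h : IsCharacteristic D H α H') (hH : Covered H) (hα : IsOrdering H α) :
    H' = topHypergraph H α ∨ ∃ A ∈ attrs α, A ∈ H'.verts := by
  induction h with
  | top H α => exact .inl rfl
  | sub H α C H' hC _ ih =>
    rcases ih covered_subHypergraphPlus (isOrdering_subHypergraphPlus hH hα hC) with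
      rfl | ⟨A, hA, hA'⟩
    · obtain ⟨A, hA, hA'⟩ := exists_mem_verts_topHypergraph (D := D) hH hα hC
      exact .inr ⟨A, components_subset hC hA, hA'⟩
    · exact .inr ⟨A, components_subset hC (attrs_subOrdering_subset hC hA), hA'⟩

theorem IsCharacteristic.exists_mem_component [∀ A, Nontrivial (D A)] (hH : Covered H)
    (hα : IsOrdering H α) (hC : C ∈ components H α)
    (h : IsCharacteristic D (subHypergraphPlus H α C) (subOrdering D H α C) H') :
    ∃ A ∈ C, A ∈ H'.verts := by
  rcases h.eq_top_or_exists_mem covered_subHypergraphPlus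
    (isOrdering_subHypergraphPlus hH hα hC) with rfl | ⟨A, hA, hA'⟩
  · exact exists_mem_verts_topHypergraph hH hα hC
  · exact ⟨A, attrs_subOrdering_subset hC hA, hA'⟩

theorem IsCharacteristic.ne_top [∀ A, Nontrivial (D A)] (hH : Covered H)
    (hα : IsOrdering H α) (hC : C ∈ components H α)
    (h : IsCharacteristic D (subHypergraphPlus H α C) (subOrdering D H α C) H') :
    H' ≠ topHypergraph H α := by
  rintro rfl
  obtain ⟨A, hA, hA'⟩ := h.exists_mem_component hH hα hC
  exact (mem_outputs.1 hA').2 (components_subset hC hA)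

theorem IsCharacteristic.component_unique [∀ A, Nontrivial (D A)] (hH : Covered H)
    (hα : IsOrdering H α) (hC : C ∈ components H α) (hC' : C' ∈ components H α)
    (h : IsCharacteristic D (subHypergraphPlus H α C) (subOrdering D H α C) H')
    (h' : IsCharacteristic D (subHypergraphPlus H α C') (subOrdering D H α C') H') :
    C = C' := by
  obtain ⟨A, hA, hA'⟩ := h.exists_mem_component hH hα hC
  exact Ajar.component_unique hC hC' hA
    (mem_component_of_mem_plus hC' (h'.verts_subset hA') (components_subset hC hA))

end Distinct

/-! ### Isomorphisms of bag graphs -/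

section Iso

variable {V : Type u} [DecidableEq V] {K : Type v} [CommMonoidWithZero K] {D : V → Type w}
  {H : Hypergraph V} {α β : List (V × AggOp K)} {C C' : Finset V}

theorem ConnOn.image {X Y : Type*} {r : X → X → Prop} {r' : Y → Y → Prop} {S : Set X}
    (hS : ConnOn r S) {f : X → Y} (hf : ∀ a b, r a b → r' (f a) (f b)) : ConnOn r' (f '' S) := by
  rintro _ ⟨a, ha, rfl⟩ _ ⟨b, hb, rfl⟩
  have := hS a ha b hb
  induction this with
  | refl => exact .refl
  | tail _ h ih => exact (ih h.1).tail ⟨⟨_, h.1, rfl⟩, ⟨_, h.2.1, rfl⟩, hf _ _ h.2.2⟩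

/-- An isomorphism of graphs with bags. -/
structure BagIso (G G' : BagGraph V) where
  toEquiv : G.Node ≃ G'.Node
  adj : ∀ s t, G'.graph.Adj (toEquiv s) (toEquiv t) ↔ G.graph.Adj s t
  bag : ∀ t, G'.bag (toEquiv t) = G.bag t

variable {G G' : BagGraph V}

theorem IsGHD.of_iso (h : IsGHD H G) (φ : BagIso G G') : IsGHD H G' where
  finite := by
    have := h.finite
    exact Finite.of_equiv _ φ.toEquiv
  isTree := (SimpleGraph.Iso.isTree_iff ⟨φ.toEquiv, φ.adj _ _⟩).1 h.isTree
  bag_subset t := by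
    obtain ⟨t, rfl⟩ := φ.toEquiv.surjective t
    rw [φ.bag]
    exact h.bag_subset t
  covers F hF := by
    obtain ⟨t, ht⟩ := h.covers F hF
    exact ⟨φ.toEquiv t, by rwa [φ.bag]⟩
  running_intersection A hA := by
    rw [preconnected_induce_iff_connOn]
    have := (h.connOn_nodes hA).image (f := φ.toEquiv) fun a b => (φ.adj a b).2
    convert this using 1
    ext t
    obtain ⟨t, rfl⟩ := φ.toEquiv.surjective t
    rw [Set.mem_ofPred_eq, φ.bag, φ.toEquiv.injective.mem_set_image]
    rfl

/-- The restriction of an isomorphism to a set of nodes. -/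
def BagIso.restrict (φ : BagIso G G') (S : Set G.Node) (r : S) :
    BagIso (G.restrict S r) (G'.restrict (φ.toEquiv '' S) ⟨φ.toEquiv r, r, r.2, rfl⟩) where
  toEquiv := φ.toEquiv.image S
  adj s t := φ.adj s.1 t.1
  bag t := φ.bag t.1

theorem BagIso.isBranch (φ : BagIso G G') {T S : Set G.Node} (h : G.IsBranch T S) :
    G'.IsBranch (φ.toEquiv '' T) (φ.toEquiv '' S) := by
  obtain ⟨h1, h2, h3, h4⟩ := isBranch_iff.1 h
  refine isBranch_iff.2 ⟨h1.image _, ?_, h3.image fun a b => (φ.adj a b).2, ?_⟩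
  · rintro _ ⟨t, ht, rfl⟩ ht'
    rw [φ.toEquiv.injective.mem_set_image] at ht'
    exact h2 t ht ht'
  · rintro _ ⟨a, ha, rfl⟩ b hb hab
    obtain ⟨b, rfl⟩ := φ.toEquiv.surjective b
    rw [φ.toEquiv.injective.mem_set_image] at hb ⊢
    exact h4 a ha b hb ((φ.adj a b).1 hab)

theorem isBranch_eq_of_mem {T S S' : Set G.Node} (h : G.IsBranch T S) (h' : G.IsBranch T S')
    {t : G.Node} (ht : t ∈ S) (ht' : t ∈ S') : S = S' := by
  have key : ∀ {S S' : Set G.Node}, G.IsBranch T S → G.IsBranch T S' → t ∈ S → t ∈ S' →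
      S ⊆ S' := by
    intro S S' h h' ht ht' s hs
    by_contra hsS'
    obtain ⟨-, h2, h3, -⟩ := isBranch_iff.1 h
    obtain ⟨-, -, -, h4⟩ := isBranch_iff.1 h'
    obtain ⟨c, hc, d, hd, hcS, hdS, hcd⟩ := h3.exists_crossing (Y := S') ht ht' hs hsS'
    exact hdS (h4 c hcS d (h2 d hd) hcd)
  exact Set.Subset.antisymm (key h h' ht ht') (key h' h ht' ht)

/-- The branches of the components are unique. -/
theorem IsBranching.isDecomposable {T₀ : Set G.Node} {S : Finset V → Set G.Node}
    {r p : Finset V → G.Node} (b : IsBranching D H α G T₀ S r p) (hH : Covered H)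
    (hα : IsOrdering H α) : IsDecomposable D H α G := by
  rw [IsDecomposable]
  refine ⟨b.isGHD, T₀, isRootedSubtree_iff.2 ⟨b.root_mem, b.conn⟩, b.outputs_iff, fun C hC => ?_⟩
  obtain ⟨hr, hd⟩ := b.dec C hC
  refine ⟨S C, ⟨b.branch C hC, ⟨r C, hr⟩, ⟨p C, b.p_mem C hC, b.adj C hC⟩, hd⟩, ?_⟩
  rintro S' ⟨hS', r', -, hd'⟩
  -- A competing branch also has a bag with an attribute of `C`, and all such nodes lie in `S C`.
  obtain ⟨A, hA⟩ := components_nonempty hC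
  obtain ⟨t, ht⟩ := Ajar.exists_mem_bag covered_subHypergraph hd'.isGHD
    (subset_plus hH ((components_subset hC).trans hα.2) hA)
  exact isBranch_eq_of_mem hS' (b.branch C hC) t.2 (b.mem_branch hH hα hC hA ht)

theorem isDecomposable_of_parts (hH : Covered H) (hα : IsOrdering H α) (hG : IsGHD H G)
    {T₀ : Set G.Node} (hroot : G.root ∈ T₀) (hconn : ConnOn G.graph.Adj T₀)
    (hout : ∀ A, (∃ t ∈ T₀, A ∈ G.bag t) ↔ A ∈ outputs H α)
    (h : ∀ C ∈ components H α, ∃ (S : Set G.Node) (r p : G.Node), G.IsBranch T₀ S ∧ p ∈ T₀ ∧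
      G.graph.Adj p r ∧ ∃ hr : r ∈ S, IsDecomposable D (subHypergraph H C)
        (subOrdering D H α C) (G.restrict S ⟨r, hr⟩)) : IsDecomposable D H α G := by
  have hne : Nonempty G.Node := ⟨G.root⟩
  choose! S r p h1 h2 h3 h4 using h
  exact IsBranching.isDecomposable (T₀ := T₀) (S := S) (r := r) (p := p)
    ⟨hG, hroot, hconn, hout, h1, h2, h3, h4⟩ hH hα

/-- Needed because the branches of a glued tree are merely isomorphic to its pieces. -/
theorem IsDecomposable.of_iso [∀ A, Nontrivial (D A)] : ∀ (n : ℕ) {H : Hypergraph V} {α : List (V × AggOp K)}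
    {G G' : BagGraph V}, α.length = n → Covered H → IsOrdering H α → IsDecomposable D H α G →
    ∀ φ : BagIso G G', φ.toEquiv G.root = G'.root → IsDecomposable D H α G' := by
  intro n
  induction n using Nat.strong_induction_on with
  | _ n ih =>
  intro H α G G' hn hH hα hG φ hroot
  obtain ⟨T₀, S, r, p, b⟩ := hG.exists_branching
  refine isDecomposable_of_parts hH hα (b.isGHD.of_iso φ) (T₀ := φ.toEquiv '' T₀)
    ⟨_, b.root_mem, hroot⟩ (b.conn.image fun a b => (φ.adj a b).2) (fun A => ?_) fun C hC => ?_
  · rw [← b.outputs_iff, Set.exists_mem_image]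
    simp only [φ.bag]
  · obtain ⟨hr, hd⟩ := b.dec C hC
    exact ⟨φ.toEquiv '' S C, φ.toEquiv (r C), φ.toEquiv (p C), φ.isBranch (b.branch C hC),
      ⟨_, b.p_mem C hC, rfl⟩, (φ.adj _ _).2 (b.adj C hC), ⟨_, hr, rfl⟩,
      ih _ (hn ▸ length_subOrdering_lt D H α C hC) rfl covered_subHypergraph
        (isOrdering_subHypergraph hH hα hC) hd (φ.restrict (S C) ⟨r C, hr⟩) rfl⟩

/-! ### The hyperedge of the output attributes of a smaller query -/

theorem IsGHD.of_subHypergraphPlus (h : IsGHD (subHypergraphPlus H α C) G) :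
    IsGHD (subHypergraph H C) G :=
  ⟨h.finite, h.isTree, h.bag_subset, fun F hF => h.covers F (Finset.mem_insert_of_mem hF),
    h.running_intersection⟩

theorem IsGHD.to_subHypergraphPlus (h : IsGHD (subHypergraph H C) G)
    (hcov : ∃ t, outputs H α ∩ plus H C ⊆ G.bag t) : IsGHD (subHypergraphPlus H α C) G :=
  ⟨h.finite, h.isTree, h.bag_subset, fun F hF => by
    rcases mem_edges_subHypergraphPlus.1 hF with rfl | hF
    · exact hcov
    · exact h.covers F hF, h.running_intersection⟩

theorem IsDecomposable.of_subHypergraphPlus [∀ A, Nontrivial (D A)] (hH : Covered H)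
    (hα : IsOrdering H α) (hC : C ∈ components H α)
    (h : IsDecomposable D (subHypergraphPlus H α C) (subOrdering D H α C) G) :
    IsDecomposable D (subHypergraph H C) (subOrdering D H α C) G := by
  obtain ⟨T₀, S, r, p, b⟩ := h.exists_branching
  have hcomp := components_subHypergraphPlus (D := D) hC
  refine IsBranching.isDecomposable (T₀ := T₀) (S := S) (r := r) (p := p)
    ⟨b.isGHD.of_subHypergraphPlus, b.root_mem, b.conn, b.outputs_iff,
      fun C' hC' => b.branch C' (hcomp ▸ hC'), fun C' hC' => b.p_mem C' (hcomp ▸ hC'),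
      fun C' hC' => b.adj C' (hcomp ▸ hC'), fun C' hC' => ?_⟩
    covered_subHypergraph (isOrdering_subHypergraph hH hα hC)
  have hC'C := (components_subset hC').trans (attrs_subOrdering_subset hC)
  have := b.dec C' (hcomp ▸ hC')
  rwa [subHypergraph_subHypergraphPlus hC hC'C, ← subHypergraph_subHypergraph hC'C,
    subOrdering_subHypergraphPlus hH hα hC hC'] at this

theorem IsDecomposable.to_subHypergraphPlus [∀ A, Nontrivial (D A)] (hH : Covered H)
    (hα : IsOrdering H α) (hC : C ∈ components H α)
    (h : IsDecomposable D (subHypergraph H C) (subOrdering D H α C) G)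
    (hcov : ∃ t, outputs H α ∩ plus H C ⊆ G.bag t) :
    IsDecomposable D (subHypergraphPlus H α C) (subOrdering D H α C) G := by
  obtain ⟨T₀, S, r, p, b⟩ := h.exists_branching
  have hcomp := components_subHypergraphPlus (D := D) hC
  refine IsBranching.isDecomposable (T₀ := T₀) (S := S) (r := r) (p := p)
    ⟨b.isGHD.to_subHypergraphPlus hcov, b.root_mem, b.conn, b.outputs_iff,
      fun C' hC' => b.branch C' (hcomp ▸ hC'), fun C' hC' => b.p_mem C' (hcomp ▸ hC'),
      fun C' hC' => b.adj C' (hcomp ▸ hC'), fun C' hC' => ?_⟩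
    covered_subHypergraphPlus (isOrdering_subHypergraphPlus hH hα hC)
  have hC'C := (components_subset hC').trans (attrs_subOrdering_subset hC)
  have := b.dec C' (hcomp ▸ hC')
  rwa [subHypergraph_subHypergraphPlus hC hC'C, ← subHypergraph_subHypergraph hC'C,
    subOrdering_subHypergraphPlus hH hα hC (hcomp ▸ hC')]

end Iso

/-! ### Gluing trees -/

section Glue

variable {V : Type u} {ι : Type u}

/-- The edges of the glued graph: the edges of the pieces, and for each `i` an edge between the
node `p i` of `G₀` and the root of `G i`. -/
inductive GlueAdj (G₀ : BagGraph V) (G : ι → BagGraph V) (p : ι → G₀.Node) :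
    G₀.Node ⊕ (Σ i, (G i).Node) → G₀.Node ⊕ (Σ i, (G i).Node) → Prop
  | inl {a b : G₀.Node} : G₀.graph.Adj a b → GlueAdj G₀ G p (.inl a) (.inl b)
  | inr {i : ι} {a b : (G i).Node} :
      (G i).graph.Adj a b → GlueAdj G₀ G p (.inr ⟨i, a⟩) (.inr ⟨i, b⟩)
  | down (i : ι) : GlueAdj G₀ G p (.inl (p i)) (.inr ⟨i, (G i).root⟩)
  | up (i : ι) : GlueAdj G₀ G p (.inr ⟨i, (G i).root⟩) (.inl (p i))

/-- The graph that consists of `G₀` and the `G i`, the root of `G i` being joined to the node `p i`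
of `G₀`. -/
def glueGraph (G₀ : BagGraph V) (G : ι → BagGraph V) (p : ι → G₀.Node) :
    SimpleGraph (G₀.Node ⊕ (Σ i, (G i).Node)) where
  Adj := GlueAdj G₀ G p
  symm := by
    constructor
    intro a b h
    cases h with
    | inl h => exact .inl h.symm
    | inr h => exact .inr h.symm
    | down i => exact .up i
    | up i => exact .down i
  loopless := by
    constructor
    intro a h
    cases h with
    | inl h => exact h.ne rfl
    | inr h => exact h.ne rfl

/-- The glued graph with the bags of its pieces. -/
abbrev glue (G₀ : BagGraph V) (G : ι → BagGraph V) (p : ι → G₀.Node) (root : G₀.Node) :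
    BagGraph V where
  Node := G₀.Node ⊕ (Σ i, (G i).Node)
  graph := glueGraph G₀ G p
  bag := Sum.elim G₀.bag fun x => (G x.1).bag x.2
  root := .inl root

/-- `f` may contract edges, which a graph homomorphism may not. -/
theorem reachable_of_map {N N' : Type*} {G : SimpleGraph N} {G' : SimpleGraph N'} (f : N → N')
    (hf : ∀ a b, G.Adj a b → G'.Reachable (f a) (f b)) {a b : N} (h : G.Reachable a b) :
    G'.Reachable (f a) (f b) := by
  obtain ⟨p⟩ := h
  induction p with
  | nil => exact .refl _
  | cons h _ ih => exact (hf _ _ h).trans ih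

variable {G₀ : BagGraph V} {G : ι → BagGraph V} {p : ι → G₀.Node} {root : G₀.Node}

theorem glue_adj_inl {a b : G₀.Node} :
    (glueGraph G₀ G p).Adj (.inl a) (.inl b) ↔ G₀.graph.Adj a b :=
  ⟨fun h => by cases h with | inl h => exact h, fun h => GlueAdj.inl h⟩

theorem glue_adj_inr {i : ι} {a b : (G i).Node} :
    (glueGraph G₀ G p).Adj (.inr ⟨i, a⟩) (.inr ⟨i, b⟩) ↔ (G i).graph.Adj a b :=
  ⟨fun h => by cases h with | inr h => exact h, fun h => GlueAdj.inr h⟩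

theorem glue_connected (h₀ : G₀.graph.IsTree) (h : ∀ i, (G i).graph.IsTree) :
    (glueGraph G₀ G p).Connected := by
  have hne : Nonempty G₀.Node := h₀.connected.nonempty
  obtain ⟨root⟩ := hne
  have hne : Nonempty (G₀.Node ⊕ (Σ i, (G i).Node)) := ⟨.inl root⟩
  have key : ∀ x : (G₀.Node ⊕ (Σ i, (G i).Node)),
      (glueGraph G₀ G p).Reachable x (.inl root) := by
    have hinl : ∀ a b : G₀.Node, (glueGraph G₀ G p).Reachable (.inl a) (.inl b) :=
      fun a b => reachable_of_map (G' := (glueGraph G₀ G p)) (Sum.inl)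
        (fun a b h => SimpleGraph.Adj.reachable (GlueAdj.inl h)) (h₀.connected.preconnected a b)
    rintro (a | ⟨i, a⟩)
    · exact hinl a root
    · have h1 : (glueGraph G₀ G p).Reachable (.inr ⟨i, a⟩) (.inr ⟨i, (G i).root⟩) :=
        reachable_of_map (G' := (glueGraph G₀ G p)) (fun a => Sum.inr ⟨i, a⟩)
          (fun a b h => SimpleGraph.Adj.reachable (GlueAdj.inr h))
          ((h i).connected.preconnected a (G i).root)
      have h2 : (glueGraph G₀ G p).Reachable (.inr ⟨i, (G i).root⟩) (.inl (p i)) :=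
        SimpleGraph.Adj.reachable (GlueAdj.up i)
      exact (h1.trans h2).trans (hinl _ _)
  exact SimpleGraph.Connected.mk fun a b => (key a).trans (key b).symm

/-- Every edge is a bridge: a detour around it would be mapped to a detour inside one piece, or, for
a linking edge, out of a piece that has no other exit. -/
theorem glue_isTree (h₀ : G₀.graph.IsTree) (h : ∀ i, (G i).graph.IsTree) :
    (glueGraph G₀ G p).IsTree := by
  classical
  refine ⟨glue_connected h₀ h, SimpleGraph.isAcyclic_iff_forall_adj_isBridge.2 ?_⟩
  have hlink : ∀ i, ¬ ((glueGraph G₀ G p).deleteEdges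
      {s(.inl (p i), .inr ⟨i, (G i).root⟩)}).Reachable (.inl (p i)) (.inr ⟨i, (G i).root⟩) := by
    intro i hreach
    -- Only the deleted linking edge joins piece `i` to the rest, so `f` is constant along the
    -- remaining edges.
    let f : (G₀.Node ⊕ (Σ i, (G i).Node)) → Bool := Sum.elim (fun _ => false) fun x => decide (x.1 = i)
    have := reachable_of_map (G' := (⊥ : SimpleGraph Bool)) f (fun a b hab => by
      rw [SimpleGraph.deleteEdges_adj] at hab
      obtain ⟨hab, hne⟩ := hab
      have heq : f a = f b := by
        cases hab with
        | inl _ => rfl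
        | inr _ => rfl
        | down j =>
          have hji : j ≠ i := by
            rintro rfl
            exact hne rfl
          simp [f, hji]
        | up j =>
          have hji : j ≠ i := by
            rintro rfl
            exact hne Sym2.eq_swap
          simp [f, hji]
      rw [heq]) hreach
    simp [f] at this
  intro a b hab
  rw [SimpleGraph.isBridge_iff]
  intro hreach
  cases hab with
  | @inl a b hab =>
    refine SimpleGraph.isBridge_iff.1
      (SimpleGraph.isAcyclic_iff_forall_adj_isBridge.1 h₀.isAcyclic hab) ?_
    -- The retraction onto `G₀` that contracts each `G i` to `p i`.
    refine reachable_of_map (a := Sum.inl a) (b := Sum.inl b)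
      (Sum.elim id fun x => p x.1) (fun c d hcd => ?_) hreach
    rw [SimpleGraph.deleteEdges_adj] at hcd
    obtain ⟨hcd, hne⟩ := hcd
    cases hcd with
    | @inl c d hcd =>
      refine SimpleGraph.Adj.reachable (SimpleGraph.deleteEdges_adj.2 ⟨hcd, fun h => hne ?_⟩)
      rw [Set.mem_singleton_iff] at h ⊢
      exact congrArg (Sym2.map Sum.inl) h
    | inr _ => exact .refl _
    | down j => exact .refl _
    | up j => exact .refl _
  | @inr i a b hab =>
    refine SimpleGraph.isBridge_iff.1
      (SimpleGraph.isAcyclic_iff_forall_adj_isBridge.1 (h i).isAcyclic hab) ?_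
    -- The retraction onto `G i` that contracts everything else to its root.
    let f : (G₀.Node ⊕ (Σ i, (G i).Node)) → (G i).Node :=
      Sum.elim (fun _ => (G i).root) fun x => if hx : x.1 = i then hx ▸ x.2 else (G i).root
    have hf : ∀ c, f (.inr ⟨i, c⟩) = c := fun c => by simp [f]
    have hroot : ∀ j, f (.inr ⟨j, (G j).root⟩) = (G i).root := by
      intro j
      by_cases hj : j = i
      · subst hj; exact hf _
      · simp [f, hj]
    have := reachable_of_map (a := Sum.inr ⟨i, a⟩) (b := Sum.inr ⟨i, b⟩)
      (G' := (G i).graph.deleteEdges {s(a, b)}) f (fun c d hcd => ?_) hreach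
    · rwa [hf, hf] at this
    rw [SimpleGraph.deleteEdges_adj] at hcd
    obtain ⟨hcd, hne⟩ := hcd
    cases hcd with
    | inl _ => exact .refl _
    | @inr j c d hcd =>
      by_cases hj : j = i
      · subst hj
        rw [hf, hf]
        refine SimpleGraph.Adj.reachable (SimpleGraph.deleteEdges_adj.2 ⟨hcd, fun h => hne ?_⟩)
        rw [Set.mem_singleton_iff] at h ⊢
        exact congrArg (Sym2.map fun x => (Sum.inr ⟨j, x⟩ : (G₀.Node ⊕ (Σ i, (G i).Node)))) h
      · have : ∀ x : (G j).Node, f (.inr ⟨j, x⟩) = (G i).root := fun x => by simp [f, hj]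
        rw [this, this]
    | down j => rw [hroot]; exact .refl _
    | up j => rw [hroot]; exact .refl _
  | down i => exact hlink i hreach
  | up i =>
    rw [Sym2.eq_swap] at hreach
    exact hlink i hreach.symm

theorem glue_isBranch (h : ∀ i, (G i).graph.Connected) (i : ι) :
    (glue G₀ G p root).IsBranch (Set.range Sum.inl) (Set.range fun a => Sum.inr ⟨i, a⟩) := by
  refine isBranch_iff.2 ⟨⟨_, (G i).root, rfl⟩, ?_, ?_, ?_⟩
  · rintro _ ⟨a, rfl⟩ ⟨b, hb⟩
    cases hb
  · rw [← Set.image_univ]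
    exact (connOn_univ_of_connected (h i)).image fun a b hab => GlueAdj.inr hab
  · rintro _ ⟨a, rfl⟩ (b | ⟨j, b⟩) hb hab
    · exact absurd ⟨b, rfl⟩ hb
    · cases hab with
      | @inr _ _ b hab => exact ⟨b, rfl⟩

/-- The pieces of the glued graph. -/
noncomputable def glueIso (i : ι) : BagIso (G i) ((glue G₀ G p root).restrict
    (Set.range fun a => Sum.inr ⟨i, a⟩) ⟨Sum.inr ⟨i, (G i).root⟩, _, rfl⟩) where
  toEquiv := Equiv.ofInjective (fun a => (Sum.inr ⟨i, a⟩ : G₀.Node ⊕ (Σ i, (G i).Node)))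
    fun a b hab => by simpa using hab
  adj _ _ := glue_adj_inr (p := p)
  bag _ := rfl

end Glue

/-! ### Assembling GHDs of the characteristic hypergraphs -/

section Assemble

variable {V : Type u} [DecidableEq V] {K : Type v} [CommMonoidWithZero K] {D : V → Type w}
  {H : Hypergraph V} {α : List (V × AggOp K)} {C : Finset V}

variable (D) in
/-- The nodes of `G` are labelled by characteristic hypergraphs, and the nodes with the label `H'`
form a copy of `P H'`. -/
def IsAssembly (H : Hypergraph V) (α : List (V × AggOp K)) (P : Hypergraph V → BagGraph V)
    (G : BagGraph V) : Prop :=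
  ∃ f : G.Node → Hypergraph V, (∀ t, IsCharacteristic D H α (f t)) ∧
    ∀ H', IsCharacteristic D H α H' → ∃ e : (P H').Node → G.Node, Function.Injective e ∧
      (∀ t, f t = H' ↔ t ∈ Set.range e) ∧ (∀ t, G.bag (e t) = (P H').bag t) ∧
      ∀ s t, G.graph.Adj (e s) (e t) ↔ (P H').graph.Adj s t

theorem exists_outputs_mem_bag (hH : Covered H) {G : BagGraph V}
    (hG : IsGHD (topHypergraph H α) G) {A : V} (hA : A ∈ outputs H α) : ∃ t, A ∈ G.bag t := by
  obtain ⟨F, hF, hAF⟩ := hH A (mem_outputs.1 hA).1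
  rcases edge_subset_outputs_or (α := α) hF with h | ⟨C, hC, hFC⟩
  · obtain ⟨t, ht⟩ := hG.covers F (Finset.mem_union_left _ (Finset.mem_filter.2 ⟨hF, h⟩))
    exact ⟨t, ht hAF⟩
  · obtain ⟨t, ht⟩ := hG.covers (outputs H α ∩ plus H C)
      (Finset.mem_union_right _ (Finset.mem_image_of_mem _ hC))
    exact ⟨t, ht (Finset.mem_inter.2 ⟨hA, Finset.mem_biUnion.2 ⟨F, hFC, hAF⟩⟩)⟩

theorem outputs_inter_plus_mem_edges_topHypergraph [∀ A, Nontrivial (D A)]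
    (hC : C ∈ components H α) : outputs H α ∩ plus H C ∈
      (topHypergraph (subHypergraphPlus H α C) (subOrdering D H α C)).edges := by
  refine Finset.mem_union_left _ (Finset.mem_filter.2 ⟨Finset.mem_insert_self _ _, fun A hA => ?_⟩)
  obtain ⟨hAo, hAC⟩ := Finset.mem_inter.1 hA
  exact (mem_outputs_subOrdering (D := D) hC hAC).2 (.inl hAo)

/-- An aggregated attribute occurs in the piece of its own component only. An output occurring in
the piece of `C` belongs to the interface, hence to both ends of the linking edge, which connects
its nodes there to those in `G₀`. -/
theorem glue_isGHD (hH : Covered H) {G₀ : BagGraph V} (h₀ : IsGHD (topHypergraph H α) G₀)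
    {G : {C // C ∈ components H α} → BagGraph V}
    (hG : ∀ C : {C // C ∈ components H α}, IsGHD (subHypergraphPlus H α C) (G C))
    {p : {C // C ∈ components H α} → G₀.Node}
    (hp : ∀ C : {C // C ∈ components H α}, outputs H α ∩ plus H C.1 ⊆ G₀.bag (p C))
    (hr : ∀ C : {C // C ∈ components H α}, outputs H α ∩ plus H C.1 ⊆ (G C).bag (G C).root) (root : G₀.Node) :
    IsGHD H (glue G₀ G p root) where
  finite := by
    have := h₀.finite
    have := fun C => (hG C).finite
    exact inferInstanceAs (Finite (G₀.Node ⊕ (Σ C, (G C).Node)))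
  isTree := glue_isTree h₀.isTree fun C => (hG C).isTree
  bag_subset := by
    rintro (a | ⟨C, a⟩)
    · exact (h₀.bag_subset a).trans Finset.sdiff_subset
    · exact ((hG C).bag_subset a).trans plus_subset
  covers F hF := by
    rcases edge_subset_outputs_or (α := α) hF with h | ⟨C, hC, hFC⟩
    · obtain ⟨t, ht⟩ := h₀.covers F (Finset.mem_union_left _ (Finset.mem_filter.2 ⟨hF, h⟩))
      exact ⟨.inl t, ht⟩
    · obtain ⟨t, ht⟩ := (hG ⟨C, hC⟩).covers F (Finset.mem_insert_of_mem hFC)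
      exact ⟨.inr ⟨⟨C, hC⟩, t⟩, ht⟩
  running_intersection A hA := by
    rw [preconnected_induce_iff_connOn]
    change ConnOn (glueGraph G₀ G p).Adj {t | A ∈ (glue G₀ G p root).bag t}
    set N := {t | A ∈ (glue G₀ G p root).bag t} with hN
    have hN₀ : (Sum.inl '' G₀.nodes A) ⊆ N := by
      rintro _ ⟨a, ha, rfl⟩
      exact ha
    have hNC : ∀ C, ((fun a => Sum.inr ⟨C, a⟩) '' (G C).nodes A) ⊆ N := by
      rintro C _ ⟨a, ha, rfl⟩
      exact ha
    have hcC : ∀ C : {C // C ∈ components H α}, A ∈ plus H C.1 → ConnOn (glueGraph G₀ G p).Adj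
        ((fun a => Sum.inr ⟨C, a⟩) '' (G C).nodes A) := fun C hAC =>
      ((hG C).connOn_nodes hAC).image fun a b hab => GlueAdj.inr hab
    by_cases hAα : A ∈ attrs α
    · obtain ⟨C, hC, hAC⟩ := exists_component H hAα
      have : N = (fun a => Sum.inr ⟨⟨C, hC⟩, a⟩) '' (G ⟨C, hC⟩).nodes A := by
        refine Set.Subset.antisymm ?_ (hNC _)
        rintro (a | ⟨⟨C', hC'⟩, a⟩) ha
        · exact absurd hAα (mem_outputs.1 (h₀.bag_subset a ha)).2
        · have hAC' : A ∈ plus H C' := (hG ⟨C', hC'⟩).bag_subset a ha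
          have := component_unique hC hC' hAC (mem_component_of_mem_plus hC' hAC' hAα)
          subst this
          exact ⟨a, ha, rfl⟩
      rw [this]
      refine hcC _ ?_
      obtain ⟨F, hF, hAF⟩ := hH A hA
      exact mem_plus.2 ⟨A, hAC, F, hF, hAF, hAF⟩
    · have hAo : A ∈ outputs H α := mem_outputs.2 ⟨hA, hAα⟩
      obtain ⟨n, hn⟩ := exists_outputs_mem_bag hH h₀ hAo
      have hc₀ : ConnOn (glueGraph G₀ G p).Adj (Sum.inl '' G₀.nodes A) :=
        (h₀.connOn_nodes hAo).image fun a b hab => GlueAdj.inl hab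
      have hinl : ∀ a ∈ G₀.nodes A,
          ReflTransGen (RelOn (glueGraph G₀ G p).Adj N) (.inl a) (.inl n) := fun a ha =>
        reflTransGen_relOn_mono hN₀ (hc₀ _ ⟨a, ha, rfl⟩ _ ⟨n, hn, rfl⟩)
      have key : ∀ t ∈ N, ReflTransGen (RelOn (glueGraph G₀ G p).Adj N) t (.inl n) := by
        rintro (a | ⟨C, a⟩) ha
        · exact hinl a ha
        · have hAC : A ∈ plus H C.1 := (hG C).bag_subset a ha
          have hAi := Finset.mem_inter.2 ⟨hAo, hAC⟩
          have hroot : A ∈ (G C).bag (G C).root := hr C hAi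
          have hpC : A ∈ G₀.bag (p C) := hp C hAi
          have h1 := reflTransGen_relOn_mono (hNC C)
            (hcC C hAC _ ⟨a, ha, rfl⟩ _ ⟨(G C).root, hroot, rfl⟩)
          exact (h1.tail ⟨hroot, hpC, GlueAdj.up C⟩).trans (hinl _ hpC)
      exact fun s hs t ht => (key s hs).trans
        (reflTransGen_relOn_symm (fun _ _ h => SimpleGraph.Adj.symm h) (key t ht))

/-- The induction lets the root bag be prescribed by `t₀`: each smaller GHD is rooted at a node of
its top piece that contains the interface, and this root is linked to a node of the GHD of `H_0`
that contains the interface too. -/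
theorem exists_decomposable_assembly [∀ A, Nontrivial (D A)] :
    ∀ (n : ℕ) {H : Hypergraph V} {α : List (V × AggOp K)}, α.length = n → Covered H →
    IsOrdering H α → ∀ P : Hypergraph V → BagGraph V,
    (∀ H', IsCharacteristic D H α H' → IsGHD H' (P H')) → ∀ t₀ : (P (topHypergraph H α)).Node,
    ∃ G : BagGraph V, IsDecomposable D H α G ∧
      G.bag G.root = (P (topHypergraph H α)).bag t₀ ∧ IsAssembly D H α P G := by
  intro n
  induction n using Nat.strong_induction_on with
  | _ n ih =>
  intro H α hn hH hα P hP t₀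
  have h₀ : IsGHD (topHypergraph H α) (P (topHypergraph H α)) := hP _ (.top H α)
  have hsub : ∀ C : {C // C ∈ components H α}, ∃ (G : BagGraph V) (p : (P (topHypergraph H α)).Node),
      IsDecomposable D (subHypergraphPlus H α C) (subOrdering D H α C) G ∧
      outputs H α ∩ plus H C.1 ⊆ (P (topHypergraph H α)).bag p ∧ outputs H α ∩ plus H C.1 ⊆ G.bag G.root ∧
      IsAssembly D (subHypergraphPlus H α C) (subOrdering D H α C) P G := by
    rintro ⟨C, hC⟩
    obtain ⟨p, hp⟩ := h₀.covers (outputs H α ∩ plus H C)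
      (Finset.mem_union_right _ (Finset.mem_image_of_mem _ hC))
    obtain ⟨t, ht⟩ := (hP _ (.sub H α C _ hC (.top _ _))).covers _
      (outputs_inter_plus_mem_edges_topHypergraph (D := D) hC)
    obtain ⟨G, hG, hGt, hGP⟩ := ih _ (hn ▸ length_subOrdering_lt D H α C hC) rfl
      covered_subHypergraphPlus (isOrdering_subHypergraphPlus hH hα hC) P
      (fun H' hH' => hP H' (.sub H α C H' hC hH')) t
    exact ⟨G, p, hG, hp, by rwa [hGt], hGP⟩
  choose G p hG hp hr hGP using hsub
  have hGHD := glue_isGHD hH h₀ (G := G) (fun C => (hG C).isGHD) hp hr t₀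
  refine ⟨glue (P (topHypergraph H α)) G p t₀, ?_, rfl, ?_⟩
  · refine isDecomposable_of_parts hH hα hGHD (T₀ := Set.range Sum.inl) ⟨t₀, rfl⟩ ?_ ?_ ?_
    · rw [← Set.image_univ]
      exact (connOn_univ_of_connected h₀.isTree.connected).image fun a b hab => GlueAdj.inl hab
    · intro A
      constructor
      · rintro ⟨_, ⟨t, rfl⟩, ht⟩
        exact h₀.bag_subset t ht
      · intro hA
        obtain ⟨t, ht⟩ := exists_outputs_mem_bag hH h₀ hA
        exact ⟨_, ⟨t, rfl⟩, ht⟩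
    · intro C hC
      refine ⟨_, Sum.inr ⟨⟨C, hC⟩, (G ⟨C, hC⟩).root⟩, Sum.inl (p ⟨C, hC⟩),
        glue_isBranch (fun C => (hG C).isGHD.isTree.connected) ⟨C, hC⟩, ⟨_, rfl⟩, GlueAdj.down _,
        ⟨_, rfl⟩, ?_⟩
      exact IsDecomposable.of_iso _ rfl covered_subHypergraph (isOrdering_subHypergraph hH hα hC)
        ((hG ⟨C, hC⟩).of_subHypergraphPlus hH hα hC) (glueIso (G := G) (p := p) (root := t₀) ⟨C, hC⟩)
        rfl
  · choose f hf he using hGP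
    refine ⟨Sum.elim (fun _ => topHypergraph H α) fun x => f x.1 x.2, ?_, ?_⟩
    · rintro (a | ⟨C, a⟩)
      · exact .top H α
      · exact .sub H α C.1 _ C.2 (hf C a)
    · intro H' hH'
      cases hH' with
      | top =>
        refine ⟨Sum.inl, Sum.inl_injective, ?_, fun t => rfl, fun s t => glue_adj_inl (p := p)⟩
        rintro (a | ⟨C, a⟩)
        · exact ⟨fun _ => ⟨a, rfl⟩, fun _ => rfl⟩
        · constructor
          · intro h
            exact absurd h ((hf C a).ne_top hH hα C.2)
          · rintro ⟨b, hb⟩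
            cases hb
      | sub _ _ C _ hC hH' =>
        obtain ⟨e, he1, he2, he3, he4⟩ := he ⟨C, hC⟩ H' hH'
        refine ⟨fun t => Sum.inr ⟨⟨C, hC⟩, e t⟩, fun s t hst => he1 (by simpa using hst), ?_,
          fun t => he3 t, fun s t => (glue_adj_inr (p := p)).trans (he4 s t)⟩
        rintro (a | ⟨⟨C', hC'⟩, a⟩)
        · constructor
          · rintro rfl
            exact absurd rfl (hH'.ne_top hH hα hC)
          · rintro ⟨b, hb⟩
            cases hb
        · constructor
          · intro h
            change f ⟨C', hC'⟩ a = H' at h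
            have hfa := hf ⟨C', hC'⟩ a
            rw [h] at hfa
            have hCC := hfa.component_unique hH hα hC' hC hH'
            subst hCC
            obtain ⟨b, hb⟩ := (he2 a).1 h
            exact ⟨b, by rw [← hb]⟩
          · rintro ⟨b, hb⟩
            cases hb
            exact (he2 _).2 ⟨b, rfl⟩

end Assemble

/-! ### The pieces of a decomposable GHD -/

section Pieces

variable {V : Type u} [DecidableEq V] {K : Type v} [CommMonoidWithZero K] {D : V → Type w}
  {H : Hypergraph V} {α : List (V × AggOp K)} {C : Finset V} {G : BagGraph V}

/-- The nodes outside the branches of the components form a GHD of the top hypergraph. -/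
theorem IsBranching.isGHD_top {T₀ : Set G.Node} {S : Finset V → Set G.Node}
    {r p : Finset V → G.Node} (b : IsBranching D H α G T₀ S r p) (hH : Covered H)
    (hα : IsOrdering H α) {T : Set G.Node} (hT : ∀ t, t ∈ T ↔ ∀ C ∈ components H α, t ∉ S C)
    (root : T) : IsGHD (topHypergraph H α) (G.restrict T root) := by
  -- `T` may exceed `T₀`: the tree may have branches that belong to no component.
  have hsub : T₀ ⊆ T := fun t ht => (hT t).2 fun C hC htS => b.notMem_top hC htS ht
  have hroot : G.root ∈ T := hsub b.root_mem
  -- A walk to the root is followed until it meets `T₀`; before that it cannot enter the branch of a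
  -- component, which is accessible from `T₀` only.
  have key : ∀ {a c : G.Node}, G.graph.Walk a c → c = G.root → a ∈ T →
      ReflTransGen (RelOn G.graph.Adj T) a G.root := by
    intro a c q
    induction q with
    | nil =>
      rintro rfl _
      exact .refl
    | @cons a d c had q ih =>
      intro hc ha
      by_cases haT : a ∈ T₀
      · exact reflTransGen_relOn_mono hsub (b.conn a haT _ b.root_mem)
      · have hd : d ∈ T := (hT d).2 fun C hC hdS =>
          (hT a).1 ha C hC (b.mem_of_adj hC hdS haT had.symm)
        exact .head ⟨ha, hd, had⟩ (ih hc hd)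
  have hTc : ConnOn G.graph.Adj T := by
    have hkey : ∀ a ∈ T, ReflTransGen (RelOn G.graph.Adj T) a G.root := fun a ha => by
      obtain ⟨q⟩ := b.isGHD.isTree.connected.preconnected a G.root
      exact key q rfl ha
    exact fun a ha c hc => (hkey a ha).trans
      (reflTransGen_relOn_symm (fun _ _ h => SimpleGraph.Adj.symm h) (hkey c hc))
  have hfin := b.isGHD.finite
  refine ⟨inferInstanceAs (Finite T), ⟨?_, b.isGHD.isTree.isAcyclic.induce T⟩, ?_, ?_, ?_⟩
  · exact @SimpleGraph.Connected.mk _ _ (preconnected_induce_iff_connOn.2 hTc) ⟨root⟩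
  · rintro ⟨t, ht⟩ A hA
    refine mem_outputs.2 ⟨b.isGHD.bag_subset t hA, fun hAα => ?_⟩
    obtain ⟨C, hC, hAC⟩ := exists_component H hAα
    exact (hT t).1 ht C hC (b.mem_branch hH hα hC hAC hA)
  · have hplus : ∀ C ∈ components H α, ∃ t : T, outputs H α ∩ plus H C ⊆ G.bag t := fun C hC =>
      ⟨⟨p C, hsub (b.p_mem C hC)⟩, fun A hA =>
        (b.mem_bag_of_mem_outputs hC (Finset.mem_inter.1 hA).1 (Finset.mem_inter.1 hA).2).1⟩
    intro F hF
    rcases Finset.mem_union.1 hF with hF | hF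
    · obtain ⟨hF, hFo⟩ := Finset.mem_filter.1 hF
      obtain ⟨t, ht⟩ := b.isGHD.covers F hF
      by_cases htT : t ∈ T
      · exact ⟨⟨t, htT⟩, ht⟩
      -- A hyperedge of outputs covered inside the branch of `C` lies in the interface, hence in the
      -- bag of `p C`.
      · obtain ⟨C, hC, htS⟩ : ∃ C ∈ components H α, t ∈ S C := by
          by_contra! hn
          exact htT ((hT t).2 hn)
        obtain ⟨s, hs⟩ := hplus C hC
        exact ⟨s, (Finset.subset_inter hFo (ht.trans (b.bag_subset_plus hC htS))).trans hs⟩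
    · obtain ⟨C, hC, rfl⟩ := Finset.mem_image.1 hF
      exact hplus C hC
  · intro A hA
    refine preconnected_induce_iff_connOn.2 (connOn_restrict.2 ?_)
    have : Subtype.val '' {t : T | A ∈ G.bag t} = T ∩ G.nodes A := by
      ext t
      constructor
      · rintro ⟨t, ht, rfl⟩
        exact ⟨t.2, ht⟩
      · rintro ⟨h1, h2⟩
        exact ⟨⟨t, h1⟩, h2, rfl⟩
    change ConnOn G.graph.Adj (Subtype.val '' {t : T | A ∈ G.bag t})
    rw [this]
    exact hTc.inter b.isGHD.isTree.isAcyclic (b.isGHD.connOn_nodes (mem_outputs.1 hA).1)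

/-- The root of each branch contains the interface, so the branch remains decomposable with the
extra hyperedge of `H_C⁺`, and the induction applies to it. -/
theorem IsDecomposable.exists_labelling [∀ A, Nontrivial (D A)] :
    ∀ (n : ℕ) {H : Hypergraph V} {α : List (V × AggOp K)} {G : BagGraph V}, α.length = n →
    Covered H → IsOrdering H α → IsDecomposable D H α G →
    ∃ f : G.Node → Hypergraph V, (∀ t, IsCharacteristic D H α (f t)) ∧
      ∀ H', IsCharacteristic D H α H' → ∃ (P : BagGraph V) (e : P.Node → G.Node), IsGHD H' P ∧
        Function.Injective e ∧ (∀ t, f t = H' ↔ t ∈ Set.range e) ∧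
        (∀ t, G.bag (e t) = P.bag t) ∧ ∀ s t, G.graph.Adj (e s) (e t) ↔ P.graph.Adj s t := by
  intro n
  induction n using Nat.strong_induction_on with
  | _ n ih =>
  intro H α G hn hH hα hG
  obtain ⟨T₀, S, r, p, b⟩ := hG.exists_branching
  have hsub : ∀ C : {C // C ∈ components H α}, ∃ f : S C.1 → Hypergraph V,
      (∀ t, IsCharacteristic D (subHypergraphPlus H α C) (subOrdering D H α C) (f t)) ∧
      ∀ H', IsCharacteristic D (subHypergraphPlus H α C) (subOrdering D H α C) H' →
        ∃ (P : BagGraph V) (e : P.Node → S C.1), IsGHD H' P ∧ Function.Injective e ∧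
          (∀ t, f t = H' ↔ t ∈ Set.range e) ∧ (∀ t, G.bag (e t) = P.bag t) ∧
          ∀ s t, G.graph.Adj (e s) (e t) ↔ P.graph.Adj s t := by
    rintro ⟨C, hC⟩
    obtain ⟨hr, hd⟩ := b.dec C hC
    exact ih _ (hn ▸ length_subOrdering_lt D H α C hC) rfl covered_subHypergraphPlus
      (isOrdering_subHypergraphPlus hH hα hC) (hd.to_subHypergraphPlus hH hα hC
        ⟨⟨r C, hr⟩, fun A hA => (b.mem_bag_of_mem_outputs hC (Finset.mem_inter.1 hA).1
          (Finset.mem_inter.1 hA).2).2⟩)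
  choose fC hfC hP using hsub
  -- Branches of different components are disjoint, so their labellings fit together; all remaining
  -- nodes are labelled by `H_0`.
  have hf : ∀ t, ∃ F : Hypergraph V, (∀ (C) (hC : C ∈ components H α) (ht : t ∈ S C),
      F = fC ⟨C, hC⟩ ⟨t, ht⟩) ∧ ((∀ C ∈ components H α, t ∉ S C) → F = topHypergraph H α) := by
    intro t
    by_cases h : ∃ C ∈ components H α, t ∈ S C
    · obtain ⟨C, hC, ht⟩ := h
      refine ⟨fC ⟨C, hC⟩ ⟨t, ht⟩, fun C' hC' ht' => ?_, fun h => absurd ht (h C hC)⟩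
      have := b.branch_unique hH hα hC hC' ht ht'
      subst this
      rfl
    · push Not at h
      exact ⟨_, fun C hC ht => absurd ht (h C hC), fun _ => rfl⟩
  choose f hf₁ hf₂ using hf
  have hcases : ∀ t, (∃ C ∈ components H α, t ∈ S C) ∨ ∀ C ∈ components H α, t ∉ S C := by
    intro t
    by_cases h : ∃ C ∈ components H α, t ∈ S C
    · exact .inl h
    · exact .inr (by simpa using h)
  refine ⟨f, fun t => ?_, fun H' hH' => ?_⟩
  · rcases hcases t with ⟨C, hC, ht⟩ | ht
    · rw [hf₁ t C hC ht]
      exact .sub H α C _ hC (hfC ⟨C, hC⟩ ⟨t, ht⟩)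
    · rw [hf₂ t ht]
      exact .top H α
  · cases hH' with
    | top =>
      have hroot : G.root ∈ {t | ∀ C ∈ components H α, t ∉ S C} :=
        fun C hC h => b.notMem_top hC h b.root_mem
      refine ⟨_, Subtype.val, b.isGHD_top hH hα (fun _ => Iff.rfl) ⟨G.root, hroot⟩, Subtype.val_injective,
        fun t => ?_, fun t => rfl, fun s t => Iff.rfl⟩
      constructor
      · intro h
        rcases hcases t with ⟨C, hC, ht⟩ | ht
        · have := hfC ⟨C, hC⟩ ⟨t, ht⟩
          rw [← hf₁ t C hC ht] at this
          exact absurd h (this.ne_top hH hα hC)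
        · exact ⟨⟨t, ht⟩, rfl⟩
      · rintro ⟨t, rfl⟩
        exact hf₂ _ t.2
    | sub _ _ C _ hC hH' =>
      obtain ⟨P, e, hGHD, he1, he2, he3, he4⟩ := hP ⟨C, hC⟩ H' hH'
      refine ⟨P, fun t => (e t).1, hGHD, fun s t hst => he1 (Subtype.ext hst), fun t => ?_,
        he3, he4⟩
      constructor
      · intro h
        rcases hcases t with ⟨C', hC', ht⟩ | ht
        · have hchar := hfC ⟨C', hC'⟩ ⟨t, ht⟩
          rw [← hf₁ t C' hC' ht, h] at hchar
          have := hchar.component_unique hH hα hC' hC hH'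
          subst this
          obtain ⟨s, hs⟩ := (he2 ⟨t, ht⟩).1 ((hf₁ t _ hC ht).symm.trans h)
          exact ⟨s, congrArg Subtype.val hs⟩
        · rw [hf₂ t ht] at h
          exact absurd h.symm (hH'.ne_top hH hα hC)
      · rintro ⟨s, rfl⟩
        rw [hf₁ _ C hC (e s).2]
        exact (he2 (e s)).2 ⟨s, rfl⟩

end Pieces

/-! ### Widths -/

section Width

variable {V : Type u} [DecidableEq V] {K : Type v} [CommMonoidWithZero K] {D : V → Type w}
  {H : Hypergraph V} {α : List (V × AggOp K)} {G : BagGraph V}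

theorem isAssembledFrom_of_labelling {P : characteristicHypergraphs D H α → BagGraph V}
    {f : G.Node → Hypergraph V} (hf : ∀ t, IsCharacteristic D H α (f t))
    (h : ∀ i, ∃ e : (P i).Node → G.Node, Function.Injective e ∧
      (∀ t, f t = i.1 ↔ t ∈ Set.range e) ∧ (∀ t, G.bag (e t) = (P i).bag t) ∧
      ∀ s t, G.graph.Adj (e s) (e t) ↔ (P i).graph.Adj s t) : IsAssembledFrom P G := by
  choose e he1 he2 he3 he4 using h
  refine ⟨Equiv.ofBijective (fun x => e x.1 x.2) ⟨?_, fun t => ?_⟩, he3, he4⟩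
  · rintro ⟨i, s⟩ ⟨j, t⟩ hst
    change e i s = e j t at hst
    have hi : f (e i s) = i.1 := (he2 i _).2 ⟨s, rfl⟩
    have hj : f (e j t) = j.1 := (he2 j _).2 ⟨t, rfl⟩
    have hij : i = j := Subtype.ext (by rw [← hi, hst, hj])
    subst hij
    rw [he1 i hst]
  · obtain ⟨s, hs⟩ := (he2 ⟨f t, hf t⟩ t).1 rfl
    exact ⟨⟨_, s⟩, hs⟩

theorem IsGHD.exists_bag_eq_width (hG : IsGHD H G) (γ : Finset V → ℝ) :
    ∃ t, γ (G.bag t) = G.width γ := by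
  have := hG.finite
  have := hG.isTree.connected.nonempty
  exact exists_eq_ciSup_of_finite

theorem IsGHD.le_width (hG : IsGHD H G) (γ : Finset V → ℝ) (t : G.Node) :
    γ (G.bag t) ≤ G.width γ := by
  have := hG.finite
  exact le_ciSup (f := fun t => γ (G.bag t)) (Set.finite_range _).bddAbove t

theorem IsAssembledFrom.isGreatest_width {ι : Type u} {P : ι → BagGraph V} {H' : ι → Hypergraph V}
    (hP : ∀ i, IsGHD (H' i) (P i)) (hG : IsGHD H G) (h : IsAssembledFrom P G)
    (γ : Finset V → ℝ) : IsGreatest (Set.range fun i => (P i).width γ) (G.width γ) := by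
  obtain ⟨e, he, -⟩ := h
  have hle : ∀ i, (P i).width γ ≤ G.width γ := by
    intro i
    obtain ⟨t, ht⟩ := (hP i).exists_bag_eq_width γ
    rw [← ht, ← he]
    exact hG.le_width γ _
  refine ⟨?_, by rintro _ ⟨i, rfl⟩; exact hle i⟩
  obtain ⟨t, ht⟩ := hG.exists_bag_eq_width γ
  obtain ⟨⟨i, s⟩, rfl⟩ := e.surjective t
  refine ⟨i, (hle i).antisymm ?_⟩
  rw [← ht, he]
  exact (hP i).le_width γ s

/-- The decomposition with a single bag. -/
def trivialGHD (H : Hypergraph V) : BagGraph V where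
  Node := PUnit
  graph := ⊥
  bag := fun _ => H.verts
  root := ⟨⟩

theorem isGHD_trivialGHD (H : Hypergraph V) : IsGHD H (trivialGHD H) where
  finite := inferInstanceAs (Finite PUnit)
  isTree :=
    have : Nonempty (trivialGHD H).Node := inferInstanceAs (Nonempty PUnit)
    have : Subsingleton (trivialGHD H).Node := inferInstanceAs (Subsingleton PUnit)
    SimpleGraph.IsTree.of_subsingleton
  bag_subset _ := Finset.Subset.refl _
  covers F hF := ⟨⟨⟩, H.edges_subset F hF⟩
  running_intersection A _ := by
    rintro ⟨⟨⟩, _⟩ ⟨⟨⟩, _⟩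
    exact .refl _

/-- A width is the value of `γ` at one of the finitely many sets of attributes, and the trivial
decomposition shows that there is one. -/
theorem exists_isLeast_width (H : Hypergraph V) (γ : Finset V → ℝ) :
    ∃ x, IsLeast {x | ∃ G : BagGraph V, IsGHD H G ∧ G.width γ = x} x := by
  have hfin : {x | ∃ G : BagGraph V, IsGHD H G ∧ G.width γ = x}.Finite := by
    refine (H.verts.powerset.finite_toSet.image γ).subset ?_
    rintro _ ⟨G, hG, rfl⟩
    obtain ⟨t, ht⟩ := hG.exists_bag_eq_width γ
    exact ⟨G.bag t, Finset.mem_coe.2 (Finset.mem_powerset.2 (hG.bag_subset t)), ht⟩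
  exact hfin.isCompact.exists_isLeast ⟨_, trivialGHD H, isGHD_trivialGHD H, rfl⟩

theorem exists_decomposable_assembledFrom [∀ A, Nontrivial (D A)] (hH : Covered H)
    (hα : IsOrdering H α) (P : characteristicHypergraphs D H α → BagGraph V)
    (hP : ∀ i, IsGHD i.1 (P i)) :
    ∃ G : BagGraph V, IsDecomposable D H α G ∧ IsAssembledFrom P G := by
  classical
  -- The values at hypergraphs that are not characteristic are irrelevant.
  let P' : Hypergraph V → BagGraph V := fun H' =>
    if h : IsCharacteristic D H α H' then P ⟨H', h⟩ else trivialGHD H'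
  have hPP : ∀ i, P' i.1 = P i := fun i => dif_pos i.2
  have hP' : ∀ H', IsCharacteristic D H α H' → IsGHD H' (P' H') := fun H' hH' => by
    rw [hPP ⟨H', hH'⟩]
    exact hP ⟨H', hH'⟩
  obtain ⟨t₀⟩ := (hP' _ (.top H α)).isTree.connected.nonempty
  obtain ⟨G, hG, -, f, hf, he⟩ := exists_decomposable_assembly _ rfl hH hα P' hP' t₀
  refine ⟨G, hG, isAssembledFrom_of_labelling hf fun i => ?_⟩
  rw [← hPP i]
  exact he i.1 i.2

end Width

end Ajar

/-! ### The main theorem. -/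

theorem mainTheorem7 {V : Type*} [DecidableEq V] {K : Type*} [CommMonoidWithZero K]
    (D : V → Type*) [∀ A, Nontrivial (D A)]
    (H : Ajar.Hypergraph V) (hH : ∀ A ∈ H.verts, ∃ F ∈ H.edges, A ∈ F)
    (α : List (V × Ajar.AggOp K)) (hα : Ajar.IsOrdering H α) :
    (∀ P : Ajar.characteristicHypergraphs D H α → Ajar.BagGraph V,
      (∀ i, Ajar.IsGHD i.1 (P i)) →
      ∃ G : Ajar.BagGraph V, Ajar.IsDecomposable D H α G ∧ Ajar.IsAssembledFrom P G ∧
        ∀ γ : Finset V → ℝ, Ajar.NodeMonotone H γ →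
          IsGreatest (Set.range fun i => (P i).width γ) (G.width γ)) ∧
    (∀ G : Ajar.BagGraph V, Ajar.IsDecomposable D H α G →
      ∃ P : Ajar.characteristicHypergraphs D H α → Ajar.BagGraph V,
        (∀ i, Ajar.IsGHD i.1 (P i)) ∧ Ajar.IsAssembledFrom P G ∧
        ∀ γ : Finset V → ℝ, Ajar.NodeMonotone H γ →
          IsGreatest (Set.range fun i => (P i).width γ) (G.width γ)) ∧
    (∀ γ : Finset V → ℝ, Ajar.NodeMonotone H γ →
      (∀ P : Ajar.characteristicHypergraphs D H α → Ajar.BagGraph V,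
        (∀ i, Ajar.IsOptimalGHD γ i.1 (P i)) →
        ∃ G : Ajar.BagGraph V, Ajar.IsAssembledFrom P G ∧ Ajar.IsDecomposable D H α G ∧
          Ajar.IsOptimalValid D γ H α G) ∧
      ∃ (w : Ajar.characteristicHypergraphs D H α → ℝ) (m : ℝ),
        (∀ i, IsLeast {x | ∃ G : Ajar.BagGraph V, Ajar.IsGHD i.1 G ∧ G.width γ = x} (w i)) ∧
        IsGreatest (Set.range w) m ∧
        IsLeast {x | ∃ G : Ajar.BagGraph V, Ajar.IsValid D H α G ∧ G.width γ = x} m) := by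
  refine ⟨fun P hP => ?_, fun G hG => ?_, fun γ hγ => ?_⟩
  · obtain ⟨G, hG, hPG⟩ := Ajar.exists_decomposable_assembledFrom hH hα P hP
    exact ⟨G, hG, hPG, fun γ _ => hPG.isGreatest_width hP hG.isGHD γ⟩
  · obtain ⟨f, hf, h⟩ := Ajar.IsDecomposable.exists_labelling _ rfl hH hα hG
    choose P e hP he using fun i : Ajar.characteristicHypergraphs D H α => h i.1 i.2
    have hPG : Ajar.IsAssembledFrom P G :=
      Ajar.isAssembledFrom_of_labelling hf fun i => ⟨e i, he i⟩
    exact ⟨P, hP, hPG, fun γ _ => hPG.isGreatest_width hP hG.isGHD γ⟩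
  · have hopt : ∀ P : Ajar.characteristicHypergraphs D H α → Ajar.BagGraph V,
        (∀ i, Ajar.IsOptimalGHD γ i.1 (P i)) → ∃ G : Ajar.BagGraph V, Ajar.IsAssembledFrom P G ∧
          Ajar.IsDecomposable D H α G ∧ Ajar.IsOptimalValid D γ H α G := by
      intro P hP
      obtain ⟨G, hG, hPG⟩ := Ajar.exists_decomposable_assembledFrom hH hα P fun i => (hP i).1
      refine ⟨G, hPG, hG, hG.isValid hH hα, fun G' hG' => ?_⟩
      -- The width of `G` is attained by some piece `P i`, which is optimal; a valid `G'` cut down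
      -- to the vertices of that hypergraph competes with it and is no wider than `G'`.
      obtain ⟨⟨i, hi⟩, -⟩ := hPG.isGreatest_width (fun i => (hP i).1) hG.isGHD γ
      rw [← hi]
      exact ((hP i).2 _ (hG'.isGHD_trim hH hα i.2)).trans (Ajar.width_trim_le hγ hG'.1 _)
    refine ⟨hopt, ?_⟩
    choose w hw using fun i : Ajar.characteristicHypergraphs D H α =>
      Ajar.exists_isLeast_width i.1 γ
    choose P hP hPw using fun i => (hw i).1
    have hPopt : ∀ i, Ajar.IsOptimalGHD γ i.1 (P i) := fun i =>
      ⟨hP i, fun G' hG' => by rw [hPw]; exact (hw i).2 ⟨G', hG', rfl⟩⟩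
    obtain ⟨G, hPG, hG, hGv⟩ := hopt P hPopt
    refine ⟨w, G.width γ, hw, ?_, ⟨G, hGv.1, rfl⟩, ?_⟩
    · have := hPG.isGreatest_width hP hG.isGHD γ
      simpa only [hPw] using this
    · rintro _ ⟨G', hG', rfl⟩
      exact hGv.2 G' hG'
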